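/- Let $d\ge 0$, let $Q,B$ be real $d\times d$ matrices with $Q$ symmetric nonnegative definite, and let $\Pi$ be a Lévy measure on $\mathbb{R}^d$ (i.e. $\Pi(\{0\})=0$ and $\int(1\wedge|y|^2)\,\Pi(dy)<\infty$). Assume that (1) for all $t>0$, $\det Q_t>0$, where $Q_t=\int_0^t e^{sB}Qe^{sB^*}\,ds$; (2) every eigenvalue of $B$ has negative real part, and $\int_{|x|\ge1}\log|x|\,\Pi(dx)<\infty$. Let $P=(P_t)_{t\ge0}$ be the Lévy–Ornstein–Uhlenbeck semigroup with data $(Q,B,\Pi)$, that is, the Feller semigroup of Markov transition kernels on $C_0(\mathbb{R}^d)$ whose generator is given on $C_c^\infty(\mathbb{R}^d)$ by $$Au(x)=\tfrac12\operatorname{tr}(Q\nabla^2u(x))+\langle Bx,\nabla u(x)\rangle+\int_{\mathbb{R}^d}\bigl[u(x+y)-u(x)-\langle\nabla u(x),y\rangle\mathbf 1_{\{|y|\le1\}}\bigr]\Pi(dy),$$ and let $\mu$ be its invariant probability distribution. Let $$\mathfrak m=\min\bigl\{n\ge0:\ \operatorname{rank}[Q^{1/2},BQ^{1/2},\dots,B^nQ^{1/2}]=d\bigr\}$$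 be the Kalman controllability index. For $1<p<\infty$ and $k\in\mathbb{N}_0$ let $$W^{k,p}(\mu)=\{u\in W^{k,p}_{loc}(\mathbb{R}^d):\ \partial^nu\in L^p(\mu)\text{ for all multi-indices } n \text{ with } |n|\le k\},\qquad \|u\|_{W^{k,p}(\mu)}=\sum_{|n|\le k}\|\partial^nu\|_{L^p(\mu)},$$ with weak derivatives $\partial^n$, and for $f\in L^p(\mu)$ let $P_tf(x)=\int f(y)\,P_t(x,dy)$. Then the following hold. (a) For every $t>0$, $P_t$ has a transition density with respect to Lebesgue measure, $P_t(x,dy)=p_t(x,y)\,dy$, where $p_t\ge0$ is smooth on $\mathbb{R}^d\times\mathbb{R}^d$. (b) $\mu$ is absolutely continuous with respect to Lebesgue measure, and has a density in $C_0^\infty(\mathbb{R}^d)$, that is, a smooth density all of whose derivatives (including the one of order $0$) vanish at infinity. (c) For all $1<p<\infty$, $k\in\mathbb{N}_0$ and $t\in(0,1]$: for $f\in L^p(\mu)$ the integral defining $P_tf(x)$ converges absolutely for $\mu$-almost every $x$, and $P_t$ maps $L^p(\mu)$ into $W^{k,p}(\mu)$ continuously. (d) For all $1<p<\infty$ and $k\in\mathbb{N}_0$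 there is a constant $C=C(k,p)>0$ (depending also on the fixed data $d,Q,B,\Pi$, but not on $t$, $n$, $f$) such that for all $t\in(0,1]$, all $n\in\mathbb{N}_0^d$ with $|n|=k$ and all $f\in L^p(\mu)$, $$\|\partial^nP_tf\|_{L^p(\mu)}\le\frac{C}{t^{k(\frac12+\mathfrak m)}}\,\|f\|_{L^p(\mu)}.$$ -/

import Mathlib

open MeasureTheory ProbabilityTheory Filter Topology
open scoped NNReal ENNReal ContDiff MatrixOrder ZeroAtInfty

namespace LevyOU

noncomputable section

/-- The Euclidean space `ℝ^d`. -/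
abbrev Rd (d : ℕ) : Type := EuclideanSpace ℝ (Fin d)

/-! ### The data `(Q, B, Π)` -/

/-- `Π` is a Lévy measure: `Π({0}) = 0` and `∫ (1 ∧ |y|²) Π(dy) < ∞`. -/
def IsLevyMeasure {d : ℕ} (Lm : Measure (Rd d)) : Prop :=
  Lm {0} = 0 ∧ ∫⁻ y, ENNReal.ofReal (min 1 (‖y‖ ^ 2)) ∂Lm < ⊤

/-- `Q_t = ∫_0^t e^{sB} Q e^{sB*} ds` (entrywise integral of a continuous matrix function). -/
def Qt {d : ℕ} (Q B : Matrix (Fin d) (Fin d) ℝ) (t : ℝ) : Matrix (Fin d) (Fin d) ℝ :=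
  Matrix.of fun i j =>
    ∫ s in (0 : ℝ)..t,
      (NormedSpace.exp (s • B) * Q * NormedSpace.exp (s • B.transpose)) i j

/-- The spectrum of the real matrix `B`, as a subset of `ℂ`, lies in the open left half-plane. -/
def IsStable {d : ℕ} (B : Matrix (Fin d) (Fin d) ℝ) : Prop :=
  ∀ z ∈ spectrum ℂ (B.map (fun a : ℝ => (a : ℂ))), z.re < 0

/-- `∫_{|x| ≥ 1} log |x| Π(dx) < ∞`. -/
def HasLogMoment {d : ℕ} (Lm : Measure (Rd d)) : Prop :=
  ∫⁻ x in {x : Rd d | 1 ≤ ‖x‖}, ENNReal.ofReal (Real.log ‖x‖) ∂Lm < ⊤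

/-- The `d × (n+1)d` block matrix `[Q^{1/2}, B Q^{1/2}, …, B^n Q^{1/2}]`. -/
def kalmanMatrix {d : ℕ} (Q B : Matrix (Fin d) (Fin d) ℝ) (n : ℕ) :
    Matrix (Fin d) (Fin (n + 1) × Fin d) ℝ :=
  Matrix.of fun i j => (B ^ (j.1 : ℕ) * CFC.sqrt Q) i j.2

/-- The Kalman controllability index
`𝔪 = min {n : rank [Q^{1/2}, B Q^{1/2}, …, B^n Q^{1/2}] = d}`. -/
def kalmanIndex {d : ℕ} (Q B : Matrix (Fin d) (Fin d) ℝ) : ℕ :=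
  sInf {n : ℕ | (kalmanMatrix Q B n).rank = d}

/-! ### Derivatives -/

/-- The partial derivative `∂u/∂x_i`. -/
def partialDeriv {d : ℕ} {F : Type*} [NormedAddCommGroup F] [NormedSpace ℝ F]
    (i : Fin d) (u : Rd d → F) : Rd d → F :=
  fun x => fderiv ℝ u x (EuclideanSpace.single i 1)

/-- `∂^n = (∂/∂x_1)^{n_1} ⋯ (∂/∂x_d)^{n_d}` for a multi-index `n`. -/
def multiDeriv {d : ℕ} {F : Type*} [NormedAddCommGroup F] [NormedSpace ℝ F]
    (n : Fin d → ℕ) (u : Rd d → F) : Rd d → F :=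
  (List.finRange d).foldr (fun i v => (partialDeriv i)^[n i] v) u

/-! ### The generator and the semigroup -/

/-- The Lévy–Ornstein–Uhlenbeck operator
`A u(x) = ½ tr(Q ∇²u(x)) + ⟨Bx, ∇u(x)⟩ + ∫ [u(x+y) - u(x) - ⟨∇u(x), y⟩ 1_{|y| ≤ 1}] Π(dy)`. -/
def generator {d : ℕ} (Q B : Matrix (Fin d) (Fin d) ℝ) (Lm : Measure (Rd d))
    (u : Rd d → ℂ) (x : Rd d) : ℂ :=
  (1 / 2 : ℂ) * ∑ i, ∑ j, (Q i j : ℂ) * partialDeriv i (partialDeriv j u) x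
    + fderiv ℝ u x (Matrix.toEuclideanLin B x)
    + ∫ y, (u (x + y) - u x - (if ‖y‖ ≤ 1 then fderiv ℝ u x y else 0)) ∂Lm

/-- The action `P f(x) = ∫ f(y) P(x, dy)` of a transition kernel on functions. -/
def act {d : ℕ} (P : Kernel (Rd d) (Rd d)) (f : Rd d → ℂ) : Rd d → ℂ :=
  fun x => ∫ y, f y ∂(P x)

/-- `(P_t)_{t ≥ 0}` is (given by the transition kernels of) a Feller semigroup on `C_0(ℝ^d)`. -/
structure IsFellerSemigroup {d : ℕ} (P : ℝ≥0 → Kernel (Rd d) (Rd d)) : Prop where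
  markov : ∀ t, IsMarkovKernel (P t)
  zero : P 0 = Kernel.id
  add : ∀ s t, P (s + t) = (P t).comp (P s)
  feller : ∀ t (f : C₀(Rd d, ℂ)), ∃ g : C₀(Rd d, ℂ), act (P t) f = g
  strongly_continuous : ∀ f : C₀(Rd d, ℂ), TendstoUniformly (fun t => act (P t) f) f (𝓝 0)

/-- `(P_t)_{t ≥ 0}` is the Lévy–Ornstein–Uhlenbeck semigroup with data `(Q, B, Π)`: a Feller
semigroup whose infinitesimal generator on `C_0(ℝ^d)` extends `(A, C_c^∞(ℝ^d))`, that is,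
`(P_t u - u) / t → A u` uniformly as `t ↓ 0` for every `u ∈ C_c^∞(ℝ^d)`. -/
structure IsLevyOUSemigroup {d : ℕ} (Q B : Matrix (Fin d) (Fin d) ℝ) (Lm : Measure (Rd d))
    (P : ℝ≥0 → Kernel (Rd d) (Rd d)) : Prop extends IsFellerSemigroup P where
  generator_eq : ∀ u : Rd d → ℂ, ContDiff ℝ ∞ u → HasCompactSupport u →
    TendstoUniformly (fun (t : ℝ≥0) x => ((t : ℝ) : ℂ)⁻¹ * (act (P t) u x - u x))
      (generator Q B Lm u) (𝓝[>] 0)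

/-! ### Function spaces -/

/-- `ρ ∈ C_0^∞(ℝ^d)`: smooth, and all derivatives (of order `0, 1, 2, …`) vanish at infinity. -/
def IsSmoothVanishing {d : ℕ} (ρ : Rd d → ℝ) : Prop :=
  ContDiff ℝ ∞ ρ ∧
    ∀ n : ℕ, Tendsto (iteratedFDeriv ℝ n ρ) (cocompact (Rd d)) (𝓝 0)

/-- `v` is the weak (distributional) derivative `∂^n u`. -/
def HasWeakDeriv {d : ℕ} (n : Fin d → ℕ) (u v : Rd d → ℂ) : Prop :=
  LocallyIntegrable u volume ∧ LocallyIntegrable v volume ∧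
    ∀ φ : Rd d → ℝ, ContDiff ℝ ∞ φ → HasCompactSupport φ →
      ∫ x, ((multiDeriv n φ x : ℝ) : ℂ) * u x = (-1) ^ (∑ i, n i) * ∫ x, (φ x : ℂ) * v x

open Classical in
/-- The weak derivative `∂^n u` (determined up to Lebesgue null sets), if there is one. -/
def weakDeriv {d : ℕ} (n : Fin d → ℕ) (u : Rd d → ℂ) : Rd d → ℂ :=
  if h : ∃ v, HasWeakDeriv n u v then h.choose else 0

/-- `u ∈ W^{k,p}(μ)`: `u ∈ W^{k,p}_loc(ℝ^d)` and `∂^n u ∈ L^p(μ)` for all `|n| ≤ k`. -/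
def MemSobolev {d : ℕ} (k : ℕ) (p : ℝ≥0∞) (μ : Measure (Rd d)) (u : Rd d → ℂ) : Prop :=
  ∀ n : Fin d → ℕ, ∑ i, n i ≤ k →
    HasWeakDeriv n u (weakDeriv n u) ∧
    (∀ K : Set (Rd d), IsCompact K → MemLp (weakDeriv n u) p (volume.restrict K)) ∧
    MemLp (weakDeriv n u) p μ

/-- The norm `∑_{|n| ≤ k} ‖∂^n u‖_{L^p(μ)}` of `W^{k,p}(μ)`. -/
def sobolevNorm {d : ℕ} (k : ℕ) (p : ℝ≥0∞) (μ : Measure (Rd d)) (u : Rd d → ℂ) : ℝ≥0∞ :=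
  ∑ j ∈ Finset.range (k + 1), ∑ n ∈ Finset.piAntidiag (Finset.univ : Finset (Fin d)) j,
    eLpNorm (weakDeriv n u) p μ

end

end LevyOU

/-!
# Smoothing by Lévy–Ornstein–Uhlenbeck semigroups

The semigroup is known only through its generator on test functions, so it is first identified.
Applying `d/dr P_r v_r = P_r (v_r' + A v_r)` to truncated characters `v_r` with frequency
`e^{(t-r)B^*} ξ` and removing the truncation gives the characteristic function of `P_t(x, ·)`
(`charFun_transition`), and hence the Mehler representation (`exists_mehler`): `P_t(x, ·)` is the
law of `e^{tB} x + S_t ζ + y` with `ζ` standard Gaussian, `S_t S_t^* = Q_t` and `y` independent of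
`ζ`. The law of `y`, with Lévy symbol integrated along the flow, is obtained in `exists_jumpLaw` from
compound Poisson laws and Lévy's continuity theorem.

Since `Q_t` is invertible, both `P_t(x, ·)` and the invariant law `μ` are Gaussian laws convolved
with a probability measure, so they have positive densities in `C_0^∞` (`exists_density`). In
particular `μ` has the same null sets as Lebesgue measure, and dominates it on compact sets.

For smooth bounded `u`, Gaussian integration by parts gives
`D_h P_s u (x) = E[⟨S_s⁻¹ e^{sB} h, ζ⟩ u(e^{sB} x + S_s ζ + y)]`, so that Hölder's inequality and the
invariance of `μ` bound `D_h P_s` on `L^p(μ)` by a multiple of `‖S_s⁻¹‖` (`eLpNorm_fderiv_act_le`).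
The Kalman index enters through `‖S_s⁻¹‖ ≤ C s^{-(1/2 + 𝔪)}` (`exists_sqrt_Qt`), which reduces by
Taylor expansion of `e^{sB^*}` to the equivalence of norms on polynomials of degree at most `𝔪`.
Because `D_h P_s u = P_s D_{e^{sB} h} u`, the derivatives of `P_t u` with `t = (k + 1) s` can be
distributed over `k` of the factors `P_s` (`eLpNorm_dirDeriv_iterate_le`). The bound passes to weak
derivatives of `P_t f` for `f ∈ L^p(μ)` by the density of test functions
(`exists_weak_dirDeriv_act`).
-/

namespace LevyOU

/-! ### Small-time lower bound for the controllability Gramian -/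

section Gramian

variable {E : Type*} [NormedAddCommGroup E] [InnerProductSpace ℝ E] [FiniteDimensional ℝ E]

lemma continuous_exp_smul (D : E →L[ℝ] E) :
    Continuous fun s : ℝ => NormedSpace.exp (s • D) :=
  continuous_iff_continuousAt.2 fun s => (hasDerivAt_exp_smul_const D s).continuousAt

lemma norm_exp_smul_sub_sum_le (D : E →L[ℝ] E) (m : ℕ) {s : ℝ} (hs0 : 0 ≤ s) (hs1 : s ≤ 1) :
    ‖NormedSpace.exp (s • D) -
        ∑ j ∈ Finset.range (m + 1), (j.factorial⁻¹ : ℝ) • (s • D) ^ j‖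
      ≤ s ^ (m + 1) * Real.exp ‖D‖ := by
  have h1 : HasSum (fun n : ℕ => (n.factorial⁻¹ : ℝ) • (s • D) ^ n) (NormedSpace.exp (s • D)) :=
    NormedSpace.exp_series_hasSum_exp' (𝕂 := ℝ) (s • D)
  have h2 : HasSum (fun n : ℕ => (n.factorial⁻¹ : ℝ) • ‖D‖ ^ n) (Real.exp ‖D‖) := by
    rw [Real.exp_eq_exp_ℝ]
    exact NormedSpace.exp_series_hasSum_exp' (𝕂 := ℝ) ‖D‖
  have h3 := h1.summable.sum_add_tsum_nat_add (m + 1)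
  rw [h1.tsum_eq] at h3
  rw [← h3, add_sub_cancel_left]
  have hle : ∀ i : ℕ, ‖((i + (m + 1)).factorial⁻¹ : ℝ) • (s • D) ^ (i + (m + 1))‖
      ≤ s ^ (m + 1) * (((i + (m + 1)).factorial⁻¹ : ℝ) • ‖D‖ ^ (i + (m + 1))) := by
    intro i
    rw [smul_pow, smul_smul, norm_smul, Real.norm_of_nonneg (by positivity), smul_eq_mul]
    have hp : s ^ (i + (m + 1)) ≤ s ^ (m + 1) := pow_le_pow_of_le_one hs0 hs1 (by omega)
    calc _ ≤ ((i + (m + 1)).factorial⁻¹ : ℝ) * s ^ (m + 1) * ‖D‖ ^ (i + (m + 1)) := by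
          gcongr
          exact norm_pow_le' D (by omega)
      _ = _ := by ring
  have hsum2 := (summable_nat_add_iff (m + 1)).2 h2.summable
  refine (tsum_of_norm_bounded (hsum2.hasSum.mul_left (s ^ (m + 1))) hle).trans ?_
  gcongr
  rw [← h2.tsum_eq, ← h2.summable.sum_add_tsum_nat_add (m + 1)]
  exact le_add_of_nonneg_left (Finset.sum_nonneg fun i _ => by positivity)

/-- Norm equivalence on the finite-dimensional space of `E`-valued polynomials of degree at most
`m`: the `L²(0,1)` norm dominates the coefficients. -/
lemma exists_le_integral_polynomial_sq (m : ℕ) :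
    ∃ c : ℝ, 0 < c ∧ ∀ a : Fin (m + 1) → E,
      c * ‖a‖ ^ 2 ≤ ∫ r in (0 : ℝ)..1, ‖∑ j : Fin (m + 1), r ^ (j : ℕ) • a j‖ ^ 2 := by
  let Φ : (Fin (m + 1) → E) → ℝ := fun a =>
    ∫ r in (0 : ℝ)..1, ‖∑ j : Fin (m + 1), r ^ (j : ℕ) • a j‖ ^ 2
  have hΦc : Continuous Φ := by
    apply intervalIntegral.continuous_parametric_intervalIntegral_of_continuous'
    unfold Function.uncurry
    fun_prop
  have hpos : ∀ a, a ≠ 0 → 0 < Φ a := by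
    intro a ha
    by_contra hcon
    have h0 : Φ a = 0 := le_antisymm (not_lt.1 hcon)
      (intervalIntegral.integral_nonneg zero_le_one fun r _ => by positivity)
    apply ha
    have hc : Continuous fun r : ℝ => ‖∑ j : Fin (m + 1), r ^ (j : ℕ) • a j‖ ^ 2 := by fun_prop
    have hz : ∀ r ∈ Set.Ioo (0 : ℝ) 1, ∑ j : Fin (m + 1), r ^ (j : ℕ) • a j = 0 := by
      intro r hr
      by_contra hne
      have : 0 < Φ a := by
        apply intervalIntegral.integral_pos zero_lt_one hc.continuousOn
        · intro x _; positivity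
        · exact ⟨r, ⟨hr.1.le, hr.2.le⟩, by positivity⟩
      exact this.ne' h0
    -- test against an arbitrary functional to reduce to scalar polynomials
    funext k
    refine ext_inner_left ℝ fun w => ?_
    let p : Polynomial ℝ := ∑ j : Fin (m + 1), Polynomial.C (inner ℝ w (a j)) * Polynomial.X ^ (j : ℕ)
    have hp : p = 0 := by
      apply Polynomial.eq_zero_of_infinite_isRoot
      refine (Set.Ioo_infinite (zero_lt_one (α := ℝ))).mono fun r hr => ?_
      simp only [p, Set.mem_ofPred_eq, Polynomial.IsRoot, Polynomial.eval_finsetSum,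
        Polynomial.eval_mul, Polynomial.eval_C, Polynomial.eval_pow, Polynomial.eval_X]
      have := congrArg (fun z => inner ℝ w z) (hz r hr)
      simp only [inner_sum, inner_smul_right, inner_zero_right] at this
      rw [← this]
      exact Finset.sum_congr rfl fun _ _ => mul_comm _ _
    have hck : p.coeff (k : ℕ) = inner ℝ w (a k) := by
      simp only [p, Polynomial.finsetSum_coeff, Polynomial.coeff_C_mul_X_pow]
      rw [Finset.sum_eq_single k]
      · simp
      · intro b _ hb
        rw [if_neg]
        exact fun h => hb (Fin.ext h.symm)
      · simp
    rw [← hck, hp]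
    simp
  have hhom : ∀ (s : ℝ) a, Φ (s • a) = s ^ 2 * Φ a := by
    intro s a
    simp only [Φ]
    rw [← intervalIntegral.integral_const_mul]
    congr 1
    ext r
    have : ∑ j : Fin (m + 1), r ^ (j : ℕ) • (s • a) j = s • ∑ j : Fin (m + 1), r ^ (j : ℕ) • a j := by
      rw [Finset.smul_sum]
      exact Finset.sum_congr rfl fun j _ => by rw [Pi.smul_apply, smul_comm]
    rw [this, norm_smul, mul_pow, Real.norm_eq_abs, sq_abs]
  rcases (Metric.sphere (0 : Fin (m + 1) → E) 1).eq_empty_or_nonempty with he | hne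
  · refine ⟨1, one_pos, fun a => ?_⟩
    have : a = 0 := by
      by_contra ha
      have : (‖a‖⁻¹ • a) ∈ Metric.sphere (0 : Fin (m + 1) → E) 1 := by
        simp [norm_smul, inv_mul_cancel₀ (norm_ne_zero_iff.2 ha)]
      rw [he] at this
      exact this
    subst this
    simp
  · obtain ⟨a₀, ha₀, hmin⟩ := (isCompact_sphere (0 : Fin (m + 1) → E) 1).exists_isMinOn hne
      hΦc.continuousOn
    have ha₀' : a₀ ≠ 0 := by
      rintro rfl
      simp at ha₀
    refine ⟨Φ a₀, hpos a₀ ha₀', fun a => ?_⟩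
    rcases eq_or_ne a 0 with rfl | ha
    · simp
    · have hmem : (‖a‖⁻¹ • a) ∈ Metric.sphere (0 : Fin (m + 1) → E) 1 := by
        simp [norm_smul, inv_mul_cancel₀ (norm_ne_zero_iff.2 ha)]
      have h1 : Φ a₀ ≤ Φ (‖a‖⁻¹ • a) := hmin hmem
      rw [hhom] at h1
      have hn : 0 < ‖a‖ := norm_pos_iff.2 ha
      calc Φ a₀ * ‖a‖ ^ 2 ≤ (‖a‖⁻¹ ^ 2 * Φ a) * ‖a‖ ^ 2 := by gcongr
        _ = Φ a := by field_simp

/-- Small-time lower bound for a controllability Gramian. If the maps `K, K D, …, K Dᵐ` have no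
common kernel, the Gramian over `[0, t]` is at least of order `t ^ (2 m + 1)`. On a short interval
`s ↦ K (exp (s D) ζ)` is its Taylor polynomial of degree `m` up to an error of order `s ^ (m + 1)`,
and the polynomial is bounded below by norm equivalence after rescaling time. -/
lemma exists_le_integral_exp_sq (K D : E →L[ℝ] E) (m : ℕ)
    (hK : ∀ ζ : E, (∀ j ≤ m, K ((D ^ j) ζ) = 0) → ζ = 0) :
    ∃ c : ℝ, 0 < c ∧ ∀ t : ℝ, 0 < t → t ≤ 1 → ∀ ζ : E,
      c * t ^ (2 * m + 1) * ‖ζ‖ ^ 2 ≤ ∫ s in (0 : ℝ)..t, ‖K (NormedSpace.exp (s • D) ζ)‖ ^ 2 := by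
  obtain ⟨c₁, hc₁, hpoly⟩ := exists_le_integral_polynomial_sq (E := E) m
  -- the Taylor coefficients control `ζ`
  let A : E →ₗ[ℝ] (Fin (m + 1) → E) := LinearMap.pi fun j =>
    ((((j : ℕ).factorial⁻¹ : ℝ) • (K ∘L D ^ (j : ℕ)) : E →L[ℝ] E) : E →ₗ[ℝ] E)
  have hAapp : ∀ ζ j, A ζ j = ((j : ℕ).factorial⁻¹ : ℝ) • K ((D ^ (j : ℕ)) ζ) := fun _ _ => rfl
  have hAinj : LinearMap.ker A = ⊥ := by
    rw [LinearMap.ker_eq_bot']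
    intro ζ hζ
    apply hK
    intro j hj
    have := congrFun hζ ⟨j, by omega⟩
    rw [hAapp] at this
    have hf : ((j.factorial : ℝ)⁻¹) ≠ 0 := by positivity
    simpa [hf, Nat.factorial_ne_zero] using this
  obtain ⟨κ, hκ0, hκ⟩ := A.exists_antilipschitzWith hAinj
  have hAle : ∀ ζ, ‖ζ‖ ≤ κ * ‖A ζ‖ := fun ζ => by
    simpa [dist_zero_right] using hκ.le_mul_dist ζ 0
  set C : ℝ := ‖K‖ * Real.exp ‖D‖ with hC
  have hC0 : 0 ≤ C := by positivity
  set c₂ : ℝ := c₁ / κ ^ 2 with hc₂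
  have hκ0' : (0 : ℝ) < κ := by exact_mod_cast hκ0
  have hc₂0 : 0 < c₂ := by positivity
  let p : E → ℝ → E := fun ζ s => ∑ j : Fin (m + 1), s ^ (j : ℕ) • A ζ j
  have hpc : ∀ ζ, Continuous (p ζ) := fun ζ => by fun_prop
  have hfc : ∀ ζ, Continuous fun s : ℝ => K (NormedSpace.exp (s • D) ζ) := by
    intro ζ
    have := continuous_exp_smul D
    fun_prop
  have hrem : ∀ ζ s, 0 ≤ s → s ≤ 1 →
      ‖K (NormedSpace.exp (s • D) ζ) - p ζ s‖ ≤ C * s ^ (m + 1) * ‖ζ‖ := by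
    intro ζ s hs0 hs1
    have hp : p ζ s =
        K ((∑ j ∈ Finset.range (m + 1), (j.factorial⁻¹ : ℝ) • (s • D) ^ j) ζ) := by
      rw [Finset.sum_range]
      simp only [p, hAapp, _root_.sum_apply, map_sum, smul_pow, smul_smul,
        _root_.smul_apply, map_smul]
      exact Finset.sum_congr rfl fun j _ => by rw [mul_comm]
    rw [hp, ← map_sub, ← _root_.sub_apply]
    calc _ ≤ ‖K‖ * (‖NormedSpace.exp (s • D) -
          ∑ j ∈ Finset.range (m + 1), (j.factorial⁻¹ : ℝ) • (s • D) ^ j‖ * ‖ζ‖) :=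
          (K.le_opNorm _).trans (by gcongr; exact ContinuousLinearMap.le_opNorm _ _)
      _ ≤ ‖K‖ * ((s ^ (m + 1) * Real.exp ‖D‖) * ‖ζ‖) := by
          gcongr; exact norm_exp_smul_sub_sum_le D m hs0 hs1
      _ = _ := by rw [hC]; ring
  have hmain : ∀ ζ : E, ∀ τ : ℝ, 0 < τ → τ ≤ 1 →
      c₂ * τ ^ (2 * m + 1) * ‖ζ‖ ^ 2 ≤ ∫ s in (0 : ℝ)..τ, ‖p ζ s‖ ^ 2 := by
    intro ζ τ hτ0 hτ1
    have hscale : ∫ s in (0 : ℝ)..τ, ‖p ζ s‖ ^ 2 =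
        τ * ∫ r in (0 : ℝ)..1, ‖p ζ (τ * r)‖ ^ 2 := by
      rw [← smul_eq_mul, intervalIntegral.smul_integral_comp_mul_left
        (f := fun s => ‖p ζ s‖ ^ 2)]
      simp
    rw [hscale]
    have h1 := hpoly fun j => τ ^ (j : ℕ) • A ζ j
    have h2 : ∀ r : ℝ, ∑ j : Fin (m + 1), r ^ (j : ℕ) • τ ^ (j : ℕ) • A ζ j = p ζ (τ * r) := by
      intro r
      simp only [p, smul_smul, mul_pow]
      exact Finset.sum_congr rfl fun j _ => by rw [mul_comm]
    simp only [h2] at h1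
    have h3 : τ ^ m * ‖A ζ‖ ≤ ‖fun j : Fin (m + 1) => τ ^ (j : ℕ) • A ζ j‖ := by
      rw [← Real.norm_of_nonneg (pow_nonneg hτ0.le m), ← norm_smul]
      rw [pi_norm_le_iff_of_nonneg (norm_nonneg _)]
      intro j
      refine le_trans ?_ (norm_le_pi_norm _ j)
      rw [Pi.smul_apply, norm_smul, norm_smul]
      gcongr
      rw [Real.norm_of_nonneg (by positivity), Real.norm_of_nonneg (by positivity)]
      exact pow_le_pow_of_le_one hτ0.le hτ1 (by omega)
    calc c₂ * τ ^ (2 * m + 1) * ‖ζ‖ ^ 2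
        ≤ c₂ * τ ^ (2 * m + 1) * (κ * ‖A ζ‖) ^ 2 := by gcongr; exact hAle ζ
      _ = τ * (c₁ * (τ ^ m * ‖A ζ‖) ^ 2) := by rw [hc₂]; field_simp; ring
      _ ≤ τ * (c₁ * ‖fun j : Fin (m + 1) => τ ^ (j : ℕ) • A ζ j‖ ^ 2) := by gcongr
      _ ≤ _ := by gcongr
  -- `t₀` is so small that the Taylor error costs at most half of the polynomial part
  obtain ⟨t₀, ht₀0, ht₀1, ht₀⟩ : ∃ t₀ : ℝ, 0 < t₀ ∧ t₀ ≤ 1 ∧ C ^ 2 * t₀ ^ 2 ≤ c₂ / 4 := by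
    refine ⟨min 1 (c₂ / (4 * (C ^ 2 + 1))), by positivity, min_le_left _ _, ?_⟩
    set t₀ := min 1 (c₂ / (4 * (C ^ 2 + 1)))
    have h0 : 0 ≤ t₀ := by positivity
    have h1 : t₀ ≤ 1 := min_le_left _ _
    have h2 : t₀ ≤ c₂ / (4 * (C ^ 2 + 1)) := min_le_right _ _
    calc C ^ 2 * t₀ ^ 2 ≤ (C ^ 2 + 1) * t₀ := by
          have h3 : t₀ ^ 2 ≤ t₀ := by nlinarith
          gcongr
          linarith
      _ ≤ (C ^ 2 + 1) * (c₂ / (4 * (C ^ 2 + 1))) := by gcongr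
      _ = c₂ / 4 := by field_simp
  refine ⟨c₂ / 4 * t₀ ^ (2 * m + 1), by positivity, fun t ht ht1 ζ => ?_⟩
  set τ := t * t₀ with hτ
  have hτ0 : 0 < τ := by positivity
  have hτt : τ ≤ t := mul_le_of_le_one_right ht.le ht₀1
  have hτt₀ : τ ≤ t₀ := mul_le_of_le_one_left ht₀0.le ht1
  have hτ1 : τ ≤ 1 := hτt.trans ht1
  have hint : ∀ a b : ℝ, IntervalIntegrable
      (fun s => ‖K (NormedSpace.exp (s • D) ζ)‖ ^ 2) volume a b := fun a b =>
    ((hfc ζ).norm.pow 2).intervalIntegrable a b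
  have hpt : ∀ s ∈ Set.Icc 0 τ, ‖p ζ s‖ ^ 2 / 2 - C ^ 2 * τ ^ (2 * m + 2) * ‖ζ‖ ^ 2
      ≤ ‖K (NormedSpace.exp (s • D) ζ)‖ ^ 2 := by
    intro s hs
    have h1 := hrem ζ s hs.1 (hs.2.trans hτ1)
    have h2 : ‖K (NormedSpace.exp (s • D) ζ) - p ζ s‖ ≤ C * τ ^ (m + 1) * ‖ζ‖ :=
      h1.trans (by gcongr; exacts [hs.1, hs.2])
    set x := K (NormedSpace.exp (s • D) ζ)
    have h3 : ‖p ζ s‖ ≤ ‖x‖ + C * τ ^ (m + 1) * ‖ζ‖ := by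
      have := norm_sub_norm_le (p ζ s) x
      rw [norm_sub_rev] at this
      linarith
    have h5 : ‖p ζ s‖ ^ 2 ≤ (‖x‖ + C * τ ^ (m + 1) * ‖ζ‖) ^ 2 := by gcongr
    have h6 : C ^ 2 * τ ^ (2 * m + 2) * ‖ζ‖ ^ 2 = (C * τ ^ (m + 1) * ‖ζ‖) ^ 2 := by ring
    rw [h6]
    nlinarith [sq_nonneg (‖x‖ - C * τ ^ (m + 1) * ‖ζ‖)]
  calc c₂ / 4 * t₀ ^ (2 * m + 1) * t ^ (2 * m + 1) * ‖ζ‖ ^ 2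
      = c₂ * τ ^ (2 * m + 1) * ‖ζ‖ ^ 2 / 2 - τ * (c₂ / 4 * τ ^ (2 * m) * ‖ζ‖ ^ 2) := by
        rw [hτ]; ring
    _ ≤ c₂ * τ ^ (2 * m + 1) * ‖ζ‖ ^ 2 / 2 - τ * (C ^ 2 * τ ^ (2 * m + 2) * ‖ζ‖ ^ 2) := by
        have : C ^ 2 * τ ^ (2 * m + 2) ≤ c₂ / 4 * τ ^ (2 * m) := by
          calc C ^ 2 * τ ^ (2 * m + 2) = C ^ 2 * τ ^ 2 * τ ^ (2 * m) := by ring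
            _ ≤ C ^ 2 * t₀ ^ 2 * τ ^ (2 * m) := by gcongr
            _ ≤ _ := by gcongr
        gcongr
    _ ≤ (∫ s in (0 : ℝ)..τ, ‖p ζ s‖ ^ 2) / 2 - τ * (C ^ 2 * τ ^ (2 * m + 2) * ‖ζ‖ ^ 2) := by
        gcongr; exact hmain ζ τ hτ0 hτ1
    _ = ∫ s in (0 : ℝ)..τ, (‖p ζ s‖ ^ 2 / 2 - C ^ 2 * τ ^ (2 * m + 2) * ‖ζ‖ ^ 2) := by
        rw [intervalIntegral.integral_sub, intervalIntegral.integral_div,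
          intervalIntegral.integral_const]
        · simp
        · exact (((hpc ζ).norm.pow 2).div_const 2).intervalIntegrable _ _
        · simp
    _ ≤ ∫ s in (0 : ℝ)..τ, ‖K (NormedSpace.exp (s • D) ζ)‖ ^ 2 := by
        apply intervalIntegral.integral_mono_on hτ0.le _ (hint _ _) hpt
        exact ((((hpc ζ).norm.pow 2).div_const 2).sub continuous_const).intervalIntegrable _ _
    _ ≤ ∫ s in (0 : ℝ)..t, ‖K (NormedSpace.exp (s • D) ζ)‖ ^ 2 := by
        apply intervalIntegral.integral_mono_interval le_rfl hτ0.le hτt _ (hint _ _)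
        exact Filter.Eventually.of_forall fun s => by positivity

lemma apply_exp_smul_eq_zero (K D : E →L[ℝ] E) (ζ : E)
    (h : ∀ j, K ((D ^ j) ζ) = 0) (s : ℝ) : K (NormedSpace.exp (s • D) ζ) = 0 := by
  have h1 : HasSum (fun n : ℕ => (n.factorial⁻¹ : ℝ) • (s • D) ^ n) (NormedSpace.exp (s • D)) :=
    NormedSpace.exp_series_hasSum_exp' (𝕂 := ℝ) (s • D)
  have h2 := (K.hasSum ((ContinuousLinearMap.apply ℝ E ζ).hasSum h1))
  refine h2.unique ?_
  convert hasSum_zero using 2 with n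
  change K (((n.factorial⁻¹ : ℝ) • (s • D) ^ n) ζ) = 0
  rw [smul_pow, smul_smul, _root_.smul_apply, map_smul, h, smul_zero]

end Gramian
end LevyOU

namespace LevyOU

/-! ### The covariance matrices `Q_t` and the Kalman index -/

section Covariance

variable {d : ℕ}

lemma toEuclideanCLM_exp (M : Matrix (Fin d) (Fin d) ℝ) :
    Matrix.toEuclideanCLM (𝕜 := ℝ) (NormedSpace.exp M) =
      NormedSpace.exp (Matrix.toEuclideanCLM (𝕜 := ℝ) M) := by
  let _ : NormedRing (Matrix (Fin d) (Fin d) ℝ) := Matrix.linftyOpNormedRing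
  let _ : NormedAlgebra ℝ (Matrix (Fin d) (Fin d) ℝ) := Matrix.linftyOpNormedAlgebra
  let _ : NormedAlgebra ℚ (Matrix (Fin d) (Fin d) ℝ) := NormedAlgebra.restrictScalars ℚ ℝ _
  refine NormedSpace.map_exp (Matrix.toEuclideanCLM (n := Fin d) (𝕜 := ℝ)) ?_ M
  exact LinearMap.continuous_of_finiteDimensional
    (Matrix.toEuclideanCLM (n := Fin d) (𝕜 := ℝ)).toAlgEquiv.toLinearMap

lemma continuous_matrix_exp_smul (M : Matrix (Fin d) (Fin d) ℝ) :
    Continuous fun s : ℝ => NormedSpace.exp (s • M) := by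
  have h := continuous_exp_smul (Matrix.toEuclideanCLM (𝕜 := ℝ) M)
  have h2 : Continuous (Matrix.toEuclideanCLM (n := Fin d) (𝕜 := ℝ)).symm :=
    LinearMap.continuous_of_finiteDimensional
      (Matrix.toEuclideanCLM (n := Fin d) (𝕜 := ℝ)).symm.toAlgEquiv.toLinearMap
  convert h2.comp h using 2 with s
  simp only [Function.comp, ← map_smul, ← toEuclideanCLM_exp]
  simp

/-- The operator `e^{sB*}` on `ℝ^d`. -/
noncomputable abbrev expAdj (B : Matrix (Fin d) (Fin d) ℝ) (s : ℝ) : Rd d →L[ℝ] Rd d :=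
  NormedSpace.exp (s • Matrix.toEuclideanCLM (𝕜 := ℝ) B.transpose)

lemma inner_Qt (Q B : Matrix (Fin d) (Fin d) ℝ) (t : ℝ) (ξ : Rd d) :
    inner ℝ ξ (Matrix.toEuclideanCLM (𝕜 := ℝ) (Qt Q B t) ξ) =
      ∫ s in (0 : ℝ)..t, inner ℝ (expAdj B s ξ)
        (Matrix.toEuclideanCLM (𝕜 := ℝ) Q (expAdj B s ξ)) := by
  have hc : ∀ i j, Continuous fun s : ℝ =>
      (NormedSpace.exp (s • B) * Q * NormedSpace.exp (s • B.transpose)) i j := by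
    intro i j
    have h1 := continuous_matrix_exp_smul B
    have h2 := continuous_matrix_exp_smul B.transpose
    exact ((h1.matrix_mul continuous_const).matrix_mul h2).matrix_elem i j
  have hpt : ∀ s : ℝ, inner ℝ (expAdj B s ξ)
        (Matrix.toEuclideanCLM (𝕜 := ℝ) Q (expAdj B s ξ)) =
      ∑ i, ∑ j, ξ i * ((NormedSpace.exp (s • B) * Q *
        NormedSpace.exp (s • B.transpose)) i j * ξ j) := by
    intro s
    have h1 : expAdj B s = Matrix.toEuclideanCLM (𝕜 := ℝ) (NormedSpace.exp (s • B.transpose)) := by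
      rw [toEuclideanCLM_exp, map_smul]
    have h2 : NormedSpace.exp (s • B) = (NormedSpace.exp (s • B.transpose)).transpose := by
      rw [← Matrix.exp_transpose, Matrix.transpose_smul, Matrix.transpose_transpose]
    rw [h1, h2, Matrix.inner_toEuclideanCLM]
    rw [Matrix.ofLp_toEuclideanCLM]
    set M := NormedSpace.exp (s • B.transpose)
    have h3 : (M.mulVec ξ.ofLp) ⬝ᵥ Q.mulVec (M.mulVec ξ.ofLp) =
        ξ.ofLp ⬝ᵥ (M.transpose * Q * M).mulVec ξ.ofLp := by
      rw [← Matrix.mulVec_mulVec, ← Matrix.mulVec_mulVec, Matrix.dotProduct_mulVec _ M.transpose,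
        Matrix.vecMul_transpose]
    rw [h3]
    simp only [dotProduct, Matrix.mulVec, Finset.mul_sum]
  simp_rw [hpt]
  rw [Matrix.inner_toEuclideanCLM]
  rw [intervalIntegral.integral_finsetSum fun i _ => Continuous.intervalIntegrable
    (continuous_finsetSum _ fun j _ => ((hc i j).mul_const _).const_mul _) _ _]
  simp only [dotProduct, Matrix.mulVec, Finset.mul_sum, Qt, Matrix.of_apply]
  refine Finset.sum_congr rfl fun i _ => ?_
  rw [intervalIntegral.integral_finsetSum fun j _ => Continuous.intervalIntegrable
    (((hc i j).mul_const _).const_mul _) _ _]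
  refine Finset.sum_congr rfl fun j _ => ?_
  rw [intervalIntegral.integral_const_mul, intervalIntegral.integral_mul_const]

lemma norm_sqrt_sq {Q : Matrix (Fin d) (Fin d) ℝ} (hQ : Q.PosSemidef) (η : Rd d) :
    ‖Matrix.toEuclideanCLM (𝕜 := ℝ) (CFC.sqrt Q) η‖ ^ 2 =
      inner ℝ η (Matrix.toEuclideanCLM (𝕜 := ℝ) Q η) := by
  have hsq : (CFC.sqrt Q) * CFC.sqrt Q = Q := by
    have : 0 ≤ Q := hQ.nonneg
    exact CFC.sqrt_mul_sqrt_self Q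
  have hT : (CFC.sqrt Q).transpose = CFC.sqrt Q := by
    have := (Matrix.nonneg_iff_posSemidef.1 (CFC.sqrt_nonneg Q)).isHermitian
    simpa [Matrix.IsHermitian, Matrix.conjTranspose_eq_transpose_of_trivial] using this
  rw [← real_inner_self_eq_norm_sq, Matrix.inner_toEuclideanCLM, Matrix.inner_toEuclideanCLM,
    Matrix.ofLp_toEuclideanCLM]
  conv_rhs => rw [← hsq, ← Matrix.mulVec_mulVec, Matrix.dotProduct_mulVec,
    ← Matrix.mulVec_transpose, hT]

lemma isHermitian_Qt {Q : Matrix (Fin d) (Fin d) ℝ} (hQ : Q.PosSemidef)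
    (B : Matrix (Fin d) (Fin d) ℝ) (t : ℝ) : (Qt Q B t).IsHermitian := by
  have hQT : Q.transpose = Q := by
    simpa [Matrix.IsHermitian, Matrix.conjTranspose_eq_transpose_of_trivial] using hQ.isHermitian
  ext i j
  simp only [Qt, Matrix.conjTranspose_apply, Matrix.of_apply, star_trivial]
  congr 1
  ext s
  rw [← Matrix.transpose_apply (NormedSpace.exp (s • B) * Q * _)]
  simp only [Matrix.transpose_mul, ← Matrix.exp_transpose, Matrix.transpose_smul,
    Matrix.transpose_transpose, hQT, mul_assoc]

lemma posSemidef_Qt {Q : Matrix (Fin d) (Fin d) ℝ} (hQ : Q.PosSemidef)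
    (B : Matrix (Fin d) (Fin d) ℝ) {t : ℝ} (ht : 0 ≤ t) : (Qt Q B t).PosSemidef := by
  rw [Matrix.posSemidef_iff_dotProduct_mulVec]
  refine ⟨isHermitian_Qt hQ B t, fun x => ?_⟩
  have h := inner_Qt Q B t (WithLp.toLp 2 x)
  rw [Matrix.inner_toEuclideanCLM] at h
  rw [star_trivial]
  refine le_of_le_of_eq ?_ h.symm
  refine intervalIntegral.integral_nonneg ht fun s _ => ?_
  rw [← norm_sqrt_sq hQ]
  positivity

/-- The Kalman matrix has full rank exactly when the transposed controllability maps have no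
common kernel. -/
lemma rank_kalmanMatrix_eq_iff (Q B : Matrix (Fin d) (Fin d) ℝ) (n : ℕ) :
    (kalmanMatrix Q B n).rank = d ↔
      ∀ ζ : Rd d, (∀ j ≤ n, Matrix.toEuclideanCLM (𝕜 := ℝ) (CFC.sqrt Q)
        ((Matrix.toEuclideanCLM (𝕜 := ℝ) B.transpose ^ j) ζ) = 0) → ζ = 0 := by
  have hT : (CFC.sqrt Q).transpose = CFC.sqrt Q := by
    have := (Matrix.nonneg_iff_posSemidef.1 (CFC.sqrt_nonneg Q)).isHermitian
    simpa [Matrix.IsHermitian, Matrix.conjTranspose_eq_transpose_of_trivial] using this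
  have hentry : ∀ (ζ : Rd d) (j : Fin (n + 1)) (l : Fin d),
      (kalmanMatrix Q B n).transpose.mulVec ζ.ofLp (j, l) =
        (Matrix.toEuclideanCLM (𝕜 := ℝ) (CFC.sqrt Q)
          ((Matrix.toEuclideanCLM (𝕜 := ℝ) B.transpose ^ (j : ℕ)) ζ)) l := by
    intro ζ j l
    rw [← map_pow, Matrix.ofLp_toEuclideanCLM, Matrix.ofLp_toEuclideanCLM, Matrix.mulVec_mulVec]
    conv_rhs => rw [← hT, ← Matrix.transpose_pow, ← Matrix.transpose_mul]
    rfl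
  have hker : (kalmanMatrix Q B n).rank = d ↔
      LinearMap.ker (kalmanMatrix Q B n).transpose.mulVecLin = ⊥ := by
    rw [← Matrix.rank_transpose, Matrix.rank]
    have h := LinearMap.finrank_range_add_finrank_ker (kalmanMatrix Q B n).transpose.mulVecLin
    rw [Module.finrank_fin_fun] at h
    rw [← Submodule.finrank_eq_zero]
    omega
  rw [hker, LinearMap.ker_eq_bot']
  constructor
  · intro h ζ hζ
    have : ζ.ofLp = 0 := by
      apply h
      ext ⟨j, l⟩
      rw [Matrix.mulVecLin_apply, hentry, hζ j (by omega)]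
      rfl
    exact (WithLp.ofLp_injective 2) this
  · intro h x hx
    have : (WithLp.toLp 2 x : Rd d) = 0 := by
      apply h
      intro j hj
      ext l
      rw [← hentry (WithLp.toLp 2 x) ⟨j, by omega⟩ l]
      exact congrFun hx _
    exact (WithLp.toLp_injective 2) this

/-- If `Q_1` is nondegenerate, some Kalman matrix has full rank, so that the Kalman index is a
genuine minimum. -/
lemma rank_kalmanMatrix_kalmanIndex {Q B : Matrix (Fin d) (Fin d) ℝ} (hQ : Q.PosSemidef)
    (hQt : (Qt Q B 1).PosDef) : (kalmanMatrix Q B (kalmanIndex Q B)).rank = d := by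
  apply Nat.sInf_mem (s := {n : ℕ | (kalmanMatrix Q B n).rank = d})
  obtain ⟨K, hK⟩ : ∃ K, K = Matrix.toEuclideanCLM (𝕜 := ℝ) (CFC.sqrt Q) := ⟨_, rfl⟩
  obtain ⟨D, hD⟩ : ∃ D, D = Matrix.toEuclideanCLM (𝕜 := ℝ) B.transpose := ⟨_, rfl⟩
  let V : ℕ → Submodule ℝ (Rd d) := fun n => ⨅ j : Fin (n + 1),
    LinearMap.ker ((K ∘L D ^ (j : ℕ) : Rd d →L[ℝ] Rd d) : Rd d →ₗ[ℝ] Rd d)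
  have hV : ∀ n ζ, ζ ∈ V n ↔ ∀ j ≤ n, K ((D ^ j) ζ) = 0 := by
    intro n ζ
    simp only [V, Submodule.mem_iInf, LinearMap.mem_ker]
    exact ⟨fun h j hj => h ⟨j, by omega⟩, fun h j => h j (by omega)⟩
  have hanti : Antitone V := fun a b hab ζ hζ =>
    (hV a ζ).2 fun j hj => (hV b ζ).1 hζ j (hj.trans hab)
  obtain ⟨N, hN⟩ := IsArtinian.monotone_stabilizes
    (⟨fun n => OrderDual.toDual (V n), hanti⟩ : ℕ →o (Submodule ℝ (Rd d))ᵒᵈ)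
  refine ⟨N, (rank_kalmanMatrix_eq_iff Q B N).2 fun ζ hζ => ?_⟩
  rw [← hK, ← hD] at hζ
  have hall : ∀ j, K ((D ^ j) ζ) = 0 := by
    intro j
    have h1 : ζ ∈ V (max N j) := by
      have : V N = V (max N j) := hN (max N j) (le_max_left _ _)
      rw [← this]
      exact (hV N ζ).2 hζ
    exact (hV _ ζ).1 h1 j (le_max_right _ _)
  have hexp : ∀ s : ℝ, K (NormedSpace.exp (s • D) ζ) = 0 :=
    apply_exp_smul_eq_zero K D ζ hall
  by_contra hne
  have hpos : 0 < inner ℝ ζ (Matrix.toEuclideanCLM (𝕜 := ℝ) (Qt Q B 1) ζ) := by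
    rw [Matrix.inner_toEuclideanCLM]
    have := (Matrix.posDef_iff_dotProduct_mulVec.1 hQt).2 (x := ζ.ofLp)
      (fun h => hne ((WithLp.ofLp_injective 2) h))
    simpa using this
  rw [inner_Qt] at hpos
  simp_rw [← norm_sqrt_sq hQ, ← hK, expAdj, ← hD] at hpos
  simp [hexp] at hpos

/-- Invertible square roots `S_t` of the covariances `Q_t`. The singular behaviour of their inverses
as `t ↓ 0` is governed by the Kalman index. -/
lemma exists_sqrt_Qt {Q B : Matrix (Fin d) (Fin d) ℝ} (hQ : Q.PosSemidef)
    (hQt : ∀ t : ℝ, 0 < t → 0 < (Qt Q B t).det) :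
    ∃ S : ℝ → Rd d ≃L[ℝ] Rd d,
      (∀ t : ℝ, 0 < t → ∀ ξ, charFun ((stdGaussian (Rd d)).map (S t)) ξ =
        Complex.exp (-(∫ s in (0 : ℝ)..t, inner ℝ (expAdj B s ξ)
          (Matrix.toEuclideanCLM (𝕜 := ℝ) Q (expAdj B s ξ)) : ℝ) / 2)) ∧
      ∃ C : ℝ, 0 < C ∧ ∀ t : ℝ, 0 < t → t ≤ 1 → ∀ v,
        ‖(S t).symm v‖ ≤ C / t ^ ((1 : ℝ) / 2 + kalmanIndex Q B) * ‖v‖ := by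
  have hpd : ∀ t : ℝ, 0 < t → (Qt Q B t).PosDef := fun t ht =>
    (posSemidef_Qt hQ B ht.le).posDef_iff_det_ne_zero.2 (hQt t ht).ne'
  have hex : ∀ t : ℝ, ∃ S : Rd d ≃L[ℝ] Rd d, 0 < t →
      (S : Rd d →L[ℝ] Rd d) = Matrix.toEuclideanCLM (𝕜 := ℝ) (CFC.sqrt (Qt Q B t)) := by
    intro t
    by_cases ht : 0 < t
    · have hu : IsUnit (CFC.sqrt (Qt Q B t)) := by
        have hsq : CFC.sqrt (Qt Q B t) * CFC.sqrt (Qt Q B t) = Qt Q B t := by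
          have : 0 ≤ Qt Q B t := (hpd t ht).posSemidef.nonneg
          exact CFC.sqrt_mul_sqrt_self _
        have h1 : IsUnit (Qt Q B t) := (hpd t ht).isUnit
        rw [← hsq] at h1
        exact isUnit_of_mul_isUnit_left h1
      obtain ⟨u, hu'⟩ := hu.map (Matrix.toEuclideanCLM (n := Fin d) (𝕜 := ℝ))
      exact ⟨ContinuousLinearEquiv.unitsEquiv ℝ (Rd d) u, fun _ => by rw [← hu']; rfl⟩
    · exact ⟨ContinuousLinearEquiv.refl ℝ _, fun h => absurd h ht⟩
  choose S hS using hex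
  refine ⟨S, fun t ht ξ => ?_, ?_⟩
  · have h1 : (stdGaussian (Rd d)).map (S t) = multivariateGaussian 0 (Qt Q B t) := by
      rw [multivariateGaussian]
      congr 1
      ext x
      rw [zero_add, ← hS t ht]
      rfl
    rw [h1, charFun_multivariateGaussian (hpd t ht).posSemidef, ← inner_Qt,
      Matrix.inner_toEuclideanCLM]
    simp [neg_div]
  · obtain ⟨c, hc, hle⟩ := exists_le_integral_exp_sq (Matrix.toEuclideanCLM (𝕜 := ℝ) (CFC.sqrt Q))
      (Matrix.toEuclideanCLM (𝕜 := ℝ) B.transpose) (kalmanIndex Q B)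
      ((rank_kalmanMatrix_eq_iff Q B _).1 (rank_kalmanMatrix_kalmanIndex hQ (hpd 1 one_pos)))
    refine ⟨(√c)⁻¹, by positivity, fun t ht ht1 v => ?_⟩
    set m := kalmanIndex Q B
    set ζ := (S t).symm v with hζ
    have hv : v = S t ζ := by simp [hζ]
    have h1 : c * t ^ (2 * m + 1) * ‖ζ‖ ^ 2 ≤ ‖v‖ ^ 2 := by
      have h2 : ‖v‖ ^ 2 = ‖Matrix.toEuclideanCLM (𝕜 := ℝ) (CFC.sqrt (Qt Q B t)) ζ‖ ^ 2 := by
        rw [hv, ← hS t ht]; rfl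
      rw [h2, norm_sqrt_sq (hpd t ht).posSemidef, inner_Qt]
      simp_rw [← norm_sqrt_sq hQ]
      exact hle t ht ht1 ζ
    have h3 : (√c * t ^ ((1 : ℝ) / 2 + m)) ^ 2 = c * t ^ (2 * m + 1) := by
      rw [mul_pow, Real.sq_sqrt hc.le, ← Real.rpow_natCast, ← Real.rpow_mul ht.le,
        ← Real.rpow_natCast]
      congr 2
      push_cast
      ring
    have h4 : √c * t ^ ((1 : ℝ) / 2 + m) * ‖ζ‖ ≤ ‖v‖ := by
      rw [← abs_of_nonneg (norm_nonneg v)]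
      apply abs_le_of_sq_le_sq' _ (abs_nonneg _) |>.2
      rw [mul_pow, h3, sq_abs]
      exact h1
    have hp : 0 < t ^ ((1 : ℝ) / 2 + m) := by positivity
    rw [div_mul_eq_mul_div, le_div_iff₀ hp]
    have hsc : 0 < √c := by positivity
    rw [inv_mul_eq_div, le_div_iff₀ hsc]
    linarith

end Covariance
end LevyOU

namespace LevyOU

/-! ### Infinitely divisible laws from their exponents -/

section CharFun

variable {E : Type*} [NormedAddCommGroup E] [InnerProductSpace ℝ E] [FiniteDimensional ℝ E]
  [MeasurableSpace E] [BorelSpace E]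

/-- Lévy's continuity theorem, including existence of the limit law: tightness follows from
continuity of the limit at the origin, and Prokhorov's theorem provides a limit point. -/
lemma exists_charFun_eq_of_tendsto {μ : ℕ → Measure E} [∀ i, IsProbabilityMeasure (μ i)]
    {f : E → ℂ} (hf : ContinuousAt f 0)
    (h : ∀ ξ, Tendsto (fun n => charFun (μ n) ξ) atTop (𝓝 (f ξ))) :
    ∃ ν : Measure E, IsProbabilityMeasure ν ∧ ∀ ξ, charFun ν ξ = f ξ := by
  have ht := isTightMeasureSet_of_tendsto_charFun hf h
  let ν : ℕ → ProbabilityMeasure E := fun n => ⟨μ n, inferInstance⟩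
  have hcomp : IsCompact (closure (Set.range ν)) := by
    apply isCompact_closure_of_isTightMeasureSet
    convert ht using 1
    ext ρ
    constructor
    · rintro ⟨_, ⟨n, rfl⟩, rfl⟩
      exact ⟨n, rfl⟩
    · rintro ⟨n, rfl⟩
      exact ⟨ν n, ⟨n, rfl⟩, rfl⟩
  obtain ⟨π, -, φ, hφ, hlim⟩ := hcomp.tendsto_subseq
    (x := ν) fun n => subset_closure (Set.mem_range_self n)
  refine ⟨π, inferInstance, fun ξ => ?_⟩
  have h1 := (ProbabilityMeasure.tendsto_iff_tendsto_charFun.1 hlim) ξ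
  exact tendsto_nhds_unique h1 ((h ξ).comp hφ.tendsto_atTop)

lemma exists_charFun_eq_pow (μ : Measure E) [IsProbabilityMeasure μ] (N : ℕ) :
    ∃ ν : Measure E, IsProbabilityMeasure ν ∧ ∀ ξ, charFun ν ξ = charFun μ ξ ^ N := by
  induction N with
  | zero => exact ⟨Measure.dirac 0, inferInstance, fun ξ => by simp⟩
  | succ N ih =>
    obtain ⟨ν, hν, h⟩ := ih
    exact ⟨ν ∗ μ, inferInstance, fun ξ => by rw [charFun_conv, h, pow_succ]⟩

/-- The compound Poisson law with jump intensity `m`, obtained as the limit of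
`((1 - m(E) / N) δ₀ + m / N)^{*N}`. -/
lemma exists_charFun_eq_exp_charFun_sub (m : Measure E) [IsFiniteMeasure m] :
    ∃ ν : Measure E, IsProbabilityMeasure ν ∧
      ∀ ξ, charFun ν ξ = Complex.exp (charFun m ξ - m.real Set.univ) := by
  set M := m.real Set.univ with hM
  obtain ⟨N₀, hN₀⟩ := exists_nat_ge (M + 1)
  have hM0 : 0 ≤ M := measureReal_nonneg
  let σ : ℕ → Measure E := fun k => ENNReal.ofReal (1 - M / ((k + N₀ : ℕ) : ℝ)) • Measure.dirac 0 +
    ENNReal.ofReal (1 / ((k + N₀ : ℕ) : ℝ)) • m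
  have hpos : ∀ k : ℕ, M + 1 ≤ ((k + N₀ : ℕ) : ℝ) := fun k => by
    push_cast
    have : (0 : ℝ) ≤ k := by positivity
    linarith
  have hnn : ∀ k : ℕ, 0 ≤ 1 - M / ((k + N₀ : ℕ) : ℝ) := fun k => by
    have := hpos k
    rw [sub_nonneg, div_le_one (by linarith)]
    linarith
  have hσ : ∀ k, IsProbabilityMeasure (σ k) := by
    intro k
    constructor
    have hk := hpos k
    simp only [σ, Measure.add_apply, Measure.smul_apply, measure_univ, smul_eq_mul, mul_one]
    rw [← ofReal_measureReal (μ := m) (s := Set.univ), ← ENNReal.ofReal_mul (by positivity),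
      ← ENNReal.ofReal_add (hnn k) (by positivity), ← ENNReal.ofReal_one]
    congr 1
    rw [← hM]
    field_simp
    ring
  have hcf : ∀ k ξ, charFun (σ k) ξ = 1 + (charFun m ξ - M) / ((k + N₀ : ℕ) : ℂ) := by
    intro k ξ
    have hk := hpos k
    have hi : ∀ (ρ : Measure E) [IsFiniteMeasure ρ],
        Integrable (fun x => Complex.exp (inner ℝ x ξ * Complex.I)) ρ := by
      intro ρ _
      refine (integrable_const (1 : ℝ)).mono' (by fun_prop) (ae_of_all _ fun x => ?_)
      simp [Complex.norm_exp_ofReal_mul_I]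
    rw [charFun_apply]
    simp only [σ]
    rw [integral_add_measure ((hi _).smul_measure ENNReal.ofReal_ne_top)
      ((hi _).smul_measure ENNReal.ofReal_ne_top), integral_smul_measure, integral_smul_measure,
      ← charFun_apply, ← charFun_apply, charFun_dirac]
    rw [ENNReal.toReal_ofReal (hnn k), ENNReal.toReal_ofReal (by positivity)]
    have hne : ((k : ℂ) + N₀) ≠ 0 := by
      have h0 : ((k + N₀ : ℕ) : ℝ) ≠ 0 := by linarith
      exact_mod_cast h0
    simp only [inner_zero_left, Complex.ofReal_zero, zero_mul, Complex.exp_zero, Complex.real_smul]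
    push_cast
    field_simp
    ring
  have hpow : ∀ k, ∃ ν : Measure E, IsProbabilityMeasure ν ∧
      ∀ ξ, charFun ν ξ = charFun (σ k) ξ ^ (k + N₀) := fun k => exists_charFun_eq_pow (σ k) _
  choose ν hν hνcf using hpow
  refine exists_charFun_eq_of_tendsto (μ := ν) ?_ fun ξ => ?_
  · have : Continuous (charFun m) := continuous_charFun
    fun_prop
  · simp_rw [hνcf, hcf]
    exact (Complex.tendsto_one_add_div_pow_exp (charFun m ξ - M)).comp (tendsto_add_atTop_nat N₀)

lemma norm_exp_mul_I_sub_one_sub_le (a : ℝ) :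
    ‖Complex.exp (a * Complex.I) - 1 - a * Complex.I‖ ≤ a ^ 2 := by
  have hd : ∀ x ∈ Set.uIcc 0 a, HasDerivWithinAt
      (fun x : ℝ => Complex.exp (x * Complex.I) - 1 - x * Complex.I)
      (Complex.exp (x * Complex.I) * Complex.I - Complex.I) (Set.uIcc 0 a) x := by
    intro x _
    have h1 : HasDerivAt (fun x : ℝ => (x : ℂ) * Complex.I) Complex.I x := by
      simpa using (Complex.ofRealCLM.hasDerivAt (x := x)).mul_const Complex.I
    exact ((h1.cexp.sub_const 1).sub h1).hasDerivWithinAt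
  have hb : ∀ x ∈ Set.uIcc 0 a,
      ‖Complex.exp (x * Complex.I) * Complex.I - Complex.I‖ ≤ |a| := by
    intro x hx
    have : Complex.exp (x * Complex.I) * Complex.I - Complex.I =
        (Complex.exp (Complex.I * x) - 1) * Complex.I := by ring_nf
    rw [this, norm_mul, Complex.norm_I, mul_one]
    refine (Real.norm_exp_I_mul_ofReal_sub_one_le).trans ?_
    simpa using Set.abs_sub_left_of_mem_uIcc hx
  have := (convex_uIcc 0 a).norm_image_sub_le_of_norm_hasDerivWithin_le hd hb
    Set.left_mem_uIcc Set.right_mem_uIcc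
  simpa [abs_mul_abs_self, ← sq] using this

/-- The integrand of the Lévy–Khintchine exponent. -/
noncomputable def levyIntegrand (ξ y : E) : ℂ :=
  Complex.exp (inner ℝ y ξ * Complex.I) - 1 - (if ‖y‖ ≤ 1 then inner ℝ y ξ * Complex.I else 0)

/-- The jump part of the Lévy–Khintchine exponent. -/
noncomputable def levySymbol (Lm : Measure E) (ξ : E) : ℂ := ∫ y, levyIntegrand ξ y ∂Lm

omit [FiniteDimensional ℝ E] [MeasurableSpace E] [BorelSpace E] in
lemma norm_levyIntegrand_le (ξ y : E) :
    ‖levyIntegrand ξ y‖ ≤ (2 + ‖ξ‖ ^ 2) * min 1 (‖y‖ ^ 2) := by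
  unfold levyIntegrand
  split_ifs with hy
  · rw [min_eq_right (by nlinarith [norm_nonneg y])]
    refine (norm_exp_mul_I_sub_one_sub_le _).trans ?_
    have h := abs_real_inner_le_norm y ξ
    have h2 : (inner ℝ y ξ) ^ 2 ≤ (‖y‖ * ‖ξ‖) ^ 2 := sq_le_sq' (by
      linarith [neg_abs_le (inner ℝ y ξ)]) ((le_abs_self _).trans h)
    nlinarith [sq_nonneg ‖y‖]
  · rw [min_eq_left (by nlinarith [norm_nonneg y]), sub_zero, mul_one]
    refine (norm_sub_le _ _).trans ?_
    rw [Complex.norm_exp_ofReal_mul_I, norm_one]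
    nlinarith [sq_nonneg ‖ξ‖]

lemma measurable_levyIntegrand : Measurable (Function.uncurry (levyIntegrand (E := E))) := by
  unfold levyIntegrand Function.uncurry
  refine Measurable.sub (by fun_prop) (Measurable.ite ?_ (by fun_prop) (by fun_prop))
  exact measurableSet_le (by fun_prop) measurable_const

lemma measurable_levyIntegrand_right (ξ : E) : Measurable (levyIntegrand ξ) :=
  measurable_levyIntegrand.of_uncurry_left

omit [FiniteDimensional ℝ E] [MeasurableSpace E] [BorelSpace E] in
lemma continuous_levyIntegrand_left (y : E) : Continuous fun ξ : E => levyIntegrand ξ y := by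
  unfold levyIntegrand
  split_ifs <;> fun_prop

omit [FiniteDimensional ℝ E] [BorelSpace E] in
lemma norm_levySymbol_le {Lm : Measure E}
    (hLm : Integrable (fun y : E => min 1 (‖y‖ ^ 2)) Lm) (ξ : E) :
    ‖levySymbol Lm ξ‖ ≤ (2 + ‖ξ‖ ^ 2) * ∫ y, min 1 (‖y‖ ^ 2) ∂Lm := by
  rw [← integral_const_mul]
  exact norm_integral_le_of_norm_le (hLm.const_mul _) (ae_of_all _ fun y => norm_levyIntegrand_le ξ y)

lemma continuous_levySymbol {Lm : Measure E}
    (hLm : Integrable (fun y : E => min 1 (‖y‖ ^ 2)) Lm) : Continuous (levySymbol Lm) := by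
  refine continuous_iff_continuousAt.2 fun ξ₀ => ?_
  refine continuousAt_of_dominated
    (bound := fun y => (2 + (‖ξ₀‖ + 1) ^ 2) * min 1 (‖y‖ ^ 2)) ?_ ?_ (hLm.const_mul _) ?_
  · exact Eventually.of_forall fun ξ => (measurable_levyIntegrand_right ξ).aestronglyMeasurable
  · filter_upwards [Metric.ball_mem_nhds ξ₀ one_pos] with ξ hξ
    refine ae_of_all _ fun y => (norm_levyIntegrand_le ξ y).trans ?_
    have : ‖ξ‖ ≤ ‖ξ₀‖ + 1 := by
      have := norm_sub_norm_le ξ ξ₀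
      rw [Metric.mem_ball, dist_eq_norm] at hξ
      linarith
    gcongr
  · exact ae_of_all _ fun y => (continuous_levyIntegrand_left y).continuousAt

lemma integrable_min_one_sq {d : ℕ} {Lm : Measure (Rd d)} (hLm : IsLevyMeasure Lm) :
    Integrable (fun y : Rd d => min 1 (‖y‖ ^ 2)) Lm := by
  refine ⟨by fun_prop, ?_⟩
  rw [hasFiniteIntegral_iff_ofReal (ae_of_all _ fun y => by positivity)]
  exact hLm.2

end CharFun

section JumpLaw

variable {d : ℕ}

lemma inner_exp_smul (B : Matrix (Fin d) (Fin d) ℝ) (s : ℝ) (y ξ : Rd d) :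
    inner ℝ (NormedSpace.exp (s • Matrix.toEuclideanCLM (𝕜 := ℝ) B) y) ξ =
      inner ℝ y (expAdj B s ξ) := by
  have h1 : ∀ M : Matrix (Fin d) (Fin d) ℝ, ∀ x z : Rd d,
      inner ℝ (Matrix.toEuclideanCLM (𝕜 := ℝ) M x) z =
        inner ℝ x (Matrix.toEuclideanCLM (𝕜 := ℝ) M.transpose z) := by
    intro M x z
    rw [real_inner_comm, Matrix.inner_toEuclideanCLM, Matrix.inner_toEuclideanCLM,
      Matrix.dotProduct_mulVec, ← Matrix.mulVec_transpose, dotProduct_comm]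
  rw [← map_smul, ← toEuclideanCLM_exp, h1, ← Matrix.exp_transpose, Matrix.transpose_smul,
    toEuclideanCLM_exp, map_smul]

lemma continuous_expAdj_apply (B : Matrix (Fin d) (Fin d) ℝ) :
    Continuous fun p : ℝ × Rd d => expAdj B p.1 p.2 := by
  have := continuous_exp_smul (Matrix.toEuclideanCLM (𝕜 := ℝ) B.transpose)
  exact (this.comp continuous_fst).clm_apply continuous_snd

/-- For a finite jump measure the jump law is a shifted compound Poisson law. -/
lemma exists_jumpLaw_of_isFiniteMeasure (B : Matrix (Fin d) (Fin d) ℝ) (Λ : Measure (Rd d))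
    [IsFiniteMeasure Λ] {t : ℝ} (ht : 0 ≤ t) :
    ∃ η : Measure (Rd d), IsProbabilityMeasure η ∧ ∀ ξ, charFun η ξ =
      Complex.exp (∫ s in (0 : ℝ)..t, levySymbol Λ (expAdj B s ξ)) := by
  have hexp := continuous_exp_smul (Matrix.toEuclideanCLM (𝕜 := ℝ) B)
  set U : ℝ → Rd d →L[ℝ] Rd d := fun s =>
    NormedSpace.exp (s • Matrix.toEuclideanCLM (𝕜 := ℝ) B) with hU
  have hUc : Continuous fun p : ℝ × Rd d => U p.1 p.2 :=
    (hexp.comp continuous_fst).clm_apply continuous_snd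
  set τ := (volume : Measure ℝ).restrict (Set.Ioc 0 t) with hτ
  let m : Measure (Rd d) := (τ.prod Λ).map fun p => U p.1 p.2
  obtain ⟨π, hπ, hπcf⟩ := exists_charFun_eq_exp_charFun_sub m
  set c : Rd d := ∫ y in {y : Rd d | ‖y‖ ≤ 1}, y ∂Λ with hc
  set b : Rd d := ∫ s in (0 : ℝ)..t, U s c with hb
  have hset : MeasurableSet {y : Rd d | ‖y‖ ≤ 1} := measurableSet_le (by fun_prop) measurable_const
  have hid : IntegrableOn (fun y : Rd d => y) {y : Rd d | ‖y‖ ≤ 1} Λ := by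
    refine (integrable_const (1 : ℝ)).mono' (by fun_prop) ?_
    exact ae_restrict_of_forall_mem hset fun y hy => hy
  have hi : ∀ ξ : Rd d, Integrable (fun x => Complex.exp (inner ℝ x ξ * Complex.I)) Λ := by
    intro ξ
    refine (integrable_const (1 : ℝ)).mono' (by fun_prop) (ae_of_all _ fun x => ?_)
    simp [Complex.norm_exp_ofReal_mul_I]
  have hsymb : ∀ ξ, levySymbol Λ ξ =
      charFun Λ ξ - Λ.real Set.univ - inner ℝ c ξ * Complex.I := by
    intro ξ
    have h2 : Integrable (fun y : Rd d =>
        (if ‖y‖ ≤ 1 then inner ℝ y ξ * Complex.I else 0 : ℂ)) Λ := by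
      have : IntegrableOn (fun y : Rd d => (inner ℝ y ξ * Complex.I : ℂ)) {y | ‖y‖ ≤ 1} Λ :=
        ((hid.inner_const ξ).ofReal).mul_const Complex.I
      refine (this.integrable_indicator hset).congr (ae_of_all _ fun y => ?_)
      simp [Set.indicator_apply]
    unfold levySymbol levyIntegrand
    rw [integral_sub (f := fun y : Rd d => Complex.exp (inner ℝ y ξ * Complex.I) - 1)
      ((hi ξ).sub (integrable_const _)) h2, integral_sub (hi ξ) (integrable_const _),
      ← charFun_apply]
    congr 1
    · simp
    · have : ∀ y : Rd d, (if ‖y‖ ≤ 1 then inner ℝ y ξ * Complex.I else 0 : ℂ) =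
          Set.indicator {y : Rd d | ‖y‖ ≤ 1} (fun y => (inner ℝ y ξ * Complex.I : ℂ)) y := by
        intro y; simp [Set.indicator_apply]
      simp_rw [this]
      rw [integral_indicator hset, integral_mul_const, integral_complex_ofReal]
      congr 2
      rw [hc, ← real_inner_comm, ← integral_inner hid]
      simp_rw [real_inner_comm]
  have hcexp : Continuous fun p : (ℝ × Rd d) => expAdj B p.1 p.2 := continuous_expAdj_apply B
  have hcfc : Continuous (charFun Λ) := continuous_charFun
  refine ⟨π ∗ Measure.dirac (-b), inferInstance, fun ξ => ?_⟩
  have hec : Continuous fun s : ℝ => expAdj B s ξ := hcexp.comp (by fun_prop : Continuous fun s => (s, ξ))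
  rw [charFun_conv, hπcf, charFun_dirac, ← Complex.exp_add]
  congr 1
  have hm1 : charFun m ξ = ∫ s in (0 : ℝ)..t, charFun Λ (expAdj B s ξ) := by
    rw [charFun_apply, integral_map hUc.measurable.aemeasurable (by fun_prop), integral_prod,
      intervalIntegral.integral_of_le ht]
    · simp_rw [charFun_apply, hU, inner_exp_smul]
      rfl
    · refine (integrable_const (1 : ℝ)).mono' ?_ (ae_of_all _ fun x => ?_)
      · have : Continuous fun p : ℝ × Rd d => Complex.exp (inner ℝ (U p.1 p.2) ξ * Complex.I) := by
          fun_prop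
        exact this.aestronglyMeasurable
      · simp [Complex.norm_exp_ofReal_mul_I]
  have hm2 : m.real Set.univ = t * Λ.real Set.univ := by
    rw [measureReal_def, Measure.map_apply hUc.measurable MeasurableSet.univ, Set.preimage_univ,
      ← Set.univ_prod_univ, Measure.prod_prod, ENNReal.toReal_mul, hτ, Measure.restrict_apply_univ,
      Real.volume_Ioc, sub_zero, ENNReal.toReal_ofReal ht]
    rfl
  have hb1 : inner ℝ b ξ = ∫ s in (0 : ℝ)..t, inner ℝ c (expAdj B s ξ) := by
    have hUi : IntervalIntegrable (fun s => U s c) volume 0 t :=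
      (hUc.comp (by fun_prop : Continuous fun s => (s, c))).intervalIntegrable _ _
    rw [hb, intervalIntegral.integral_of_le ht, intervalIntegral.integral_of_le ht,
      ← real_inner_comm, ← integral_inner ((intervalIntegrable_iff_integrableOn_Ioc_of_le ht).1 hUi)]
    refine integral_congr_ae (ae_of_all _ fun s => ?_)
    exact (real_inner_comm _ _).trans (inner_exp_smul B s c ξ)
  simp_rw [hsymb]
  rw [intervalIntegral.integral_sub, intervalIntegral.integral_sub, hm1, hm2,
    intervalIntegral.integral_const, intervalIntegral.integral_mul_const, inner_neg_left, hb1,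
    intervalIntegral.integral_ofReal]
  · simp only [sub_zero, Complex.real_smul]
    push_cast
    ring
  · exact (hcfc.comp hec).intervalIntegrable _ _
  · exact intervalIntegrable_const
  · exact ((hcfc.comp hec).sub continuous_const).intervalIntegrable _ _
  · exact Continuous.intervalIntegrable (by fun_prop) _ _

/-- The law of the jump part of the process at time `t`, constructed by truncating the small jumps
and passing to the limit in the exponents. -/
lemma exists_jumpLaw (B : Matrix (Fin d) (Fin d) ℝ) {Lm : Measure (Rd d)}
    (hLm : IsLevyMeasure Lm) {t : ℝ} (ht : 0 ≤ t) :
    ∃ η : Measure (Rd d), IsProbabilityMeasure η ∧ ∀ ξ, charFun η ξ =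
      Complex.exp (∫ s in (0 : ℝ)..t, levySymbol Lm (expAdj B s ξ)) := by
  have hint := integrable_min_one_sq hLm
  let A : ℕ → Set (Rd d) := fun n => {y | 1 / ((n : ℝ) + 1) < ‖y‖}
  have hA : ∀ n, MeasurableSet (A n) := fun n => measurableSet_lt measurable_const (by fun_prop)
  have hfin : ∀ n, IsFiniteMeasure (Lm.restrict (A n)) := by
    intro n
    rw [isFiniteMeasure_restrict]
    have hle : A n ⊆ {y | (1 / ((n : ℝ) + 1)) ^ 2 ≤ min 1 (‖y‖ ^ 2)} := by
      intro y hy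
      have h0 : (0 : ℝ) < 1 / ((n : ℝ) + 1) := by positivity
      have h1 : 1 / ((n : ℝ) + 1) ≤ 1 := by
        rw [div_le_one (by positivity)]
        have : (0 : ℝ) ≤ n := by positivity
        linarith
      have h2 : 1 / ((n : ℝ) + 1) < ‖y‖ := hy
      refine le_min (pow_le_one₀ h0.le h1) (by gcongr)
    exact ((measure_mono hle).trans_lt (hint.measure_ge_lt_top (by positivity))).ne
  have hη := fun n => exists_jumpLaw_of_isFiniteMeasure B (Lm.restrict (A n)) ht
  choose η hηp hηcf using hη
  have hcexp : Continuous fun p : (ℝ × Rd d) => expAdj B p.1 p.2 := continuous_expAdj_apply B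
  refine exists_charFun_eq_of_tendsto (μ := η) ?_ fun ξ => ?_
  · have h1 : Continuous fun ξ => ∫ s in (0 : ℝ)..t, levySymbol Lm (expAdj B s ξ) := by
      apply intervalIntegral.continuous_parametric_intervalIntegral_of_continuous'
      exact (continuous_levySymbol hint).comp (hcexp.comp continuous_swap)
    exact h1.cexp.continuousAt
  · simp_rw [hηcf]
    refine (Complex.continuous_exp.tendsto _).comp ?_
    have hec : Continuous fun s : ℝ => expAdj B s ξ :=
      hcexp.comp (by fun_prop : Continuous fun s => (s, ξ))
    have hintA : ∀ n, Integrable (fun y : Rd d => min 1 (‖y‖ ^ 2)) (Lm.restrict (A n)) :=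
      fun n => hint.restrict
    refine intervalIntegral.tendsto_integral_filter_of_dominated_convergence
      (fun s => (2 + ‖expAdj B s ξ‖ ^ 2) * ∫ y, min 1 (‖y‖ ^ 2) ∂Lm) ?_ ?_ ?_ ?_
    · exact Eventually.of_forall fun n =>
        ((continuous_levySymbol (hintA n)).comp hec).aestronglyMeasurable
    · refine Eventually.of_forall fun n => ae_of_all _ fun s _ => ?_
      refine (norm_levySymbol_le (hintA n) _).trans ?_
      gcongr
      · exact ae_of_all _ fun y => by positivity
      · exact Measure.restrict_le_self
    · exact Continuous.intervalIntegrable (by fun_prop) _ _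
    · refine ae_of_all _ fun s _ => ?_
      set ζ := expAdj B s ξ
      unfold levySymbol
      simp_rw [← integral_indicator (hA _)]
      refine tendsto_integral_of_dominated_convergence
        (fun y => (2 + ‖ζ‖ ^ 2) * min 1 (‖y‖ ^ 2)) ?_ (hint.const_mul _) ?_ ?_
      · exact fun n => ((measurable_levyIntegrand_right ζ).indicator (hA n)).aestronglyMeasurable
      · exact fun n => ae_of_all _ fun y =>
          (norm_indicator_le_norm_self _ _).trans (norm_levyIntegrand_le ζ y)
      · have h0 : ∀ᵐ y ∂Lm, y ≠ 0 := by
          rw [ae_iff]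
          simpa using hLm.1
        filter_upwards [h0] with y hy
        refine tendsto_const_nhds.congr' ?_
        have hlim : Tendsto (fun n : ℕ => 1 / ((n : ℝ) + 1)) atTop (𝓝 0) :=
          tendsto_one_div_add_atTop_nhds_zero_nat
        filter_upwards [hlim.eventually (gt_mem_nhds (norm_pos_iff.2 hy))] with n hn
        rw [Set.indicator_of_mem]
        exact hn

end JumpLaw
end LevyOU

namespace LevyOU

/-! ### Evolution of time-dependent functions under a Feller semigroup -/

section Evolution

variable {d : ℕ}

lemma norm_apply_le_norm (f : C₀(Rd d, ℂ)) (x : Rd d) : ‖f x‖ ≤ ‖f‖ := by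
  rw [← ZeroAtInftyContinuousMap.norm_toBCF_eq_norm]
  exact f.toBCF.norm_coe_le_norm x

lemma norm_le_of_forall_apply_le {f : C₀(Rd d, ℂ)} {C : ℝ} (hC : 0 ≤ C) (h : ∀ x, ‖f x‖ ≤ C) :
    ‖f‖ ≤ C := by
  rw [← ZeroAtInftyContinuousMap.norm_toBCF_eq_norm]
  exact (BoundedContinuousFunction.norm_le hC).2 h

lemma integrable_zeroAtInfty (μ : Measure (Rd d)) [IsFiniteMeasure μ] (f : C₀(Rd d, ℂ)) :
    Integrable f μ :=
  (integrable_const ‖f‖).mono' f.continuous.aestronglyMeasurable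
    (ae_of_all _ fun x => norm_apply_le_norm f x)

variable {P : ℝ≥0 → Kernel (Rd d) (Rd d)}

lemma norm_act_le (hP : IsFellerSemigroup P) (t : ℝ≥0) {f : Rd d → ℂ} {C : ℝ}
    (h : ∀ x, ‖f x‖ ≤ C) (x : Rd d) : ‖act (P t) f x‖ ≤ C := by
  have := hP.markov t
  simpa [act] using norm_integral_le_of_norm_le_const (μ := P t x) (ae_of_all _ h)

lemma act_add (hP : IsFellerSemigroup P) (s t : ℝ≥0) {f : Rd d → ℂ} {x : Rd d}
    (hf : Integrable f (P (s + t) x)) : act (P (s + t)) f x = act (P s) (act (P t) f) x := by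
  have h := hP.add s t
  unfold act
  rw [h] at hf ⊢
  exact Kernel.integral_comp hf

lemma act_sub_zeroAtInfty (hP : IsFellerSemigroup P) (t : ℝ≥0) (f g : C₀(Rd d, ℂ)) (x : Rd d) :
    act (P t) (f - g : C₀(Rd d, ℂ)) x = act (P t) f x - act (P t) g x := by
  have := hP.markov t
  exact integral_sub (integrable_zeroAtInfty _ f) (integrable_zeroAtInfty _ g)

lemma norm_act_sub_le (hP : IsFellerSemigroup P) (t : ℝ≥0) (f g : C₀(Rd d, ℂ)) (x : Rd d) :
    ‖act (P t) f x - act (P t) g x‖ ≤ ‖f - g‖ := by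
  rw [← act_sub_zeroAtInfty hP]
  exact norm_act_le hP t (fun y => norm_apply_le_norm _ y) x

/-- The difference of `P_{s + h} f` and `P_s f` is controlled uniformly by that of `P_h f` and
`f`. -/
lemma norm_act_add_sub_le (hP : IsFellerSemigroup P) (s h : ℝ≥0) (f : C₀(Rd d, ℂ)) {C : ℝ}
    (hC : ∀ y, ‖act (P h) f y - f y‖ ≤ C) (x : Rd d) :
    ‖act (P (s + h)) f x - act (P s) f x‖ ≤ C := by
  have := hP.markov
  obtain ⟨g, hg⟩ := hP.feller h f
  rw [act_add hP s h (integrable_zeroAtInfty _ f), hg, ← act_sub_zeroAtInfty hP]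
  refine norm_act_le hP s (fun y => ?_) x
  have := hC y
  rw [hg] at this
  exact this

lemma tendsto_toNNReal_nhdsGT : Tendsto Real.toNNReal (𝓝[>] (0 : ℝ)) (𝓝[>] (0 : ℝ≥0)) := by
  refine tendsto_nhdsWithin_of_tendsto_nhds_of_eventually_within _ ?_ ?_
  · have : Tendsto Real.toNNReal (𝓝 0) (𝓝 (Real.toNNReal 0)) :=
      continuous_real_toNNReal.tendsto 0
    rw [Real.toNNReal_zero] at this
    exact this.mono_left nhdsWithin_le_nhds
  · filter_upwards [self_mem_nhdsWithin] with x hx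
    simpa using hx

lemma continuousOn_act (hP : IsFellerSemigroup P) {v : ℝ → C₀(Rd d, ℂ)} (hv : Continuous v)
    (x : Rd d) : ContinuousOn (fun r => act (P r.toNNReal) (v r) x) (Set.Ici 0) := by
  intro s hs
  rw [Metric.continuousWithinAt_iff']
  intro ε hε
  have h1 := Metric.tendstoUniformly_iff.1 (hP.strongly_continuous (v s)) (ε / 2) (by linarith)
  have h2 : Tendsto (fun r : ℝ => Real.toNNReal |r - s|) (𝓝 s) (𝓝 0) := by
    have : Continuous fun r : ℝ => Real.toNNReal |r - s| := by fun_prop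
    simpa using this.tendsto s
  have h3 := (h2.mono_left (nhdsWithin_le_nhds (s := Set.Ici 0))).eventually h1
  have h4 := (Metric.tendsto_nhds.1 (hv.tendsto s) (ε / 2) (by linarith)).filter_mono
    (nhdsWithin_le_nhds (s := Set.Ici 0))
  filter_upwards [h3, h4, self_mem_nhdsWithin] with r hr1 hr2 hr0
  rw [dist_eq_norm] at hr2 ⊢
  have hr1' : ∀ y, ‖act (P (Real.toNNReal |r - s|)) (v s) y - v s y‖ ≤ ε / 2 := fun y => by
    have := hr1 y
    rw [dist_comm, dist_eq_norm] at this
    exact this.le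
  have hA : ‖act (P r.toNNReal) (v r) x - act (P r.toNNReal) (v s) x‖ < ε / 2 :=
    (norm_act_sub_le hP _ _ _ x).trans_lt hr2
  have hB : ‖act (P r.toNNReal) (v s) x - act (P s.toNNReal) (v s) x‖ ≤ ε / 2 := by
    rcases le_total s r with h | h
    · have : r.toNNReal = s.toNNReal + Real.toNNReal |r - s| := by
        rw [← Real.toNNReal_add hs (abs_nonneg _), abs_of_nonneg (by linarith)]
        congr 1; ring
      rw [this]
      exact norm_act_add_sub_le hP _ _ _ hr1' x
    · have : s.toNNReal = r.toNNReal + Real.toNNReal |r - s| := by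
        rw [← Real.toNNReal_add hr0 (abs_nonneg _), abs_of_nonpos (by linarith)]
        congr 1; ring
      rw [this, norm_sub_rev]
      exact norm_act_add_sub_le hP _ _ _ hr1' x
  calc _ = ‖(act (P r.toNNReal) (v r) x - act (P r.toNNReal) (v s) x) +
        (act (P r.toNNReal) (v s) x - act (P s.toNNReal) (v s) x)‖ := by congr 1; ring
    _ < ε := (norm_add_le _ _).trans_lt (by linarith)

/-- The product rule `d/dr P_r v_r = P_r (v_r' + A v_r)` for the right derivative. -/
lemma hasDerivWithinAt_act (hP : IsFellerSemigroup P) {v : ℝ → C₀(Rd d, ℂ)} {dv : C₀(Rd d, ℂ)}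
    {s : ℝ} (hs : 0 ≤ s) (hv : HasDerivAt v dv s) {g : Rd d → ℂ}
    (hg : TendstoUniformly
      (fun (t : ℝ≥0) x => ((t : ℝ) : ℂ)⁻¹ * (act (P t) (v s) x - v s x)) g (𝓝[>] 0)) (x : Rd d) :
    HasDerivWithinAt (fun r => act (P r.toNNReal) (v r) x)
      (act (P s.toNNReal) (fun y => dv y + g y) x) (Set.Ioi s) s := by
  have hmk := hP.markov
  rw [hasDerivWithinAt_iff_tendsto_slope' Set.self_notMem_Ioi]
  have hsh : Tendsto (fun r : ℝ => r - s) (𝓝[>] s) (𝓝[>] 0) := by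
    refine tendsto_nhdsWithin_of_tendsto_nhds_of_eventually_within _ ?_ ?_
    · have : Tendsto (fun r : ℝ => r - s) (𝓝 s) (𝓝 (s - s)) := by
        apply Continuous.tendsto; fun_prop
      rw [sub_self] at this
      exact this.mono_left nhdsWithin_le_nhds
    · filter_upwards [self_mem_nhdsWithin] with r hr
      simpa using hr
  have hnn := tendsto_toNNReal_nhdsGT.comp hsh
  -- continuity and boundedness of the uniform limit `g`
  have hcont : Continuous g := by
    refine hg.continuous (Frequently.of_forall fun t => ?_)
    obtain ⟨f, hf⟩ := hP.feller t (v s)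
    rw [hf]
    exact continuous_const.mul (f.continuous.sub (v s).continuous)
  obtain ⟨Cg, hCg⟩ : ∃ C, ∀ y, ‖g y‖ ≤ C := by
    obtain ⟨t, ht⟩ := (Metric.tendstoUniformly_iff.1 hg 1 one_pos).exists
    refine ⟨1 + ‖((t : ℝ) : ℂ)⁻¹‖ * (‖v s‖ + ‖v s‖), fun y => ?_⟩
    have h1 := ht y
    rw [dist_eq_norm] at h1
    have h2 : ‖((t : ℝ) : ℂ)⁻¹ * (act (P t) (v s) y - v s y)‖ ≤
        ‖((t : ℝ) : ℂ)⁻¹‖ * (‖v s‖ + ‖v s‖) := by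
      rw [norm_mul]
      gcongr
      exact (norm_sub_le _ _).trans
        (add_le_add (norm_act_le hP t (norm_apply_le_norm _) y) (norm_apply_le_norm _ y))
    have h3 := norm_le_insert' (g y) (((t : ℝ) : ℂ)⁻¹ * (act (P t) (v s) y - v s y))
    linarith
  have hgi : ∀ t, Integrable g (P t x) := fun t =>
    (integrable_const Cg).mono' hcont.aestronglyMeasurable (ae_of_all _ hCg)
  rw [Metric.tendsto_nhds]
  intro ε hε
  have e1 : ∀ᶠ r in 𝓝[>] s, ‖v r - v s - (r - s) • dv‖ ≤ ε / 4 * ‖r - s‖ :=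
    ((hasDerivAt_iff_isLittleO.1 hv).bound (by linarith : 0 < ε / 4)).filter_mono
      nhdsWithin_le_nhds
  have e2 := hnn.eventually (Metric.tendstoUniformly_iff.1 hg (ε / 4) (by linarith))
  have e3 := (hnn.mono_right nhdsWithin_le_nhds).eventually
    (Metric.tendstoUniformly_iff.1 (hP.strongly_continuous dv) (ε / 4) (by linarith))
  filter_upwards [e1, e2, e3, self_mem_nhdsWithin] with r h1 h2 h3 hr
  have hr0 : 0 < r - s := sub_pos.2 hr
  set h : ℝ≥0 := (r - s).toNNReal with hh
  have hhr : (h : ℝ) = r - s := Real.coe_toNNReal _ hr0.le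
  have hr' : r.toNNReal = s.toNNReal + h := by
    rw [hh, ← Real.toNNReal_add hs hr0.le]; congr 1; ring
  simp only [Function.comp, ← hh] at h2 h3
  set σ := s.toNNReal
  have hc0 : ((r - s : ℝ) : ℂ) ≠ 0 := by exact_mod_cast hr0.ne'
  obtain ⟨f₁, hf₁⟩ := hP.feller h (v s)
  -- split the difference quotient into the three errors
  have hA : ‖((r - s : ℝ) : ℂ)⁻¹ * (act (P (σ + h)) (v r) x - act (P (σ + h)) (v s) x)
      - act (P (σ + h)) dv x‖ ≤ ε / 4 := by
    have : ((r - s : ℝ) : ℂ)⁻¹ * (act (P (σ + h)) (v r) x - act (P (σ + h)) (v s) x)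
      - act (P (σ + h)) dv x = ((r - s : ℝ) : ℂ)⁻¹ *
        act (P (σ + h)) (v r - v s - (r - s) • dv : C₀(Rd d, ℂ)) x := by
      have h4 : act (P (σ + h)) ((r - s) • dv : C₀(Rd d, ℂ)) x =
          ((r - s : ℝ) : ℂ) * act (P (σ + h)) dv x := by
        unfold act
        rw [← integral_const_mul]
        rfl
      rw [act_sub_zeroAtInfty hP, act_sub_zeroAtInfty hP, h4]
      field_simp
    rw [this, norm_mul]
    have h5 := norm_act_le hP (σ + h) (fun y => (norm_apply_le_norm _ y).trans h1) x
    rw [norm_inv, Complex.norm_real]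
    have : 0 < ‖r - s‖ := norm_pos_iff.2 hr0.ne'
    rw [inv_mul_le_iff₀ this]
    linarith
  have hB : ‖act (P (σ + h)) dv x - act (P σ) dv x‖ ≤ ε / 4 := by
    refine norm_act_add_sub_le hP σ h dv (fun y => ?_) x
    have := h3 y
    rw [dist_comm, dist_eq_norm] at this
    exact this.le
  have hC : ‖((r - s : ℝ) : ℂ)⁻¹ * (act (P (σ + h)) (v s) x - act (P σ) (v s) x)
      - act (P σ) g x‖ ≤ ε / 4 := by
    have : ((r - s : ℝ) : ℂ)⁻¹ * (act (P (σ + h)) (v s) x - act (P σ) (v s) x) - act (P σ) g x =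
        act (P σ) (fun y => ((r - s : ℝ) : ℂ)⁻¹ * (f₁ y - v s y) - g y) x := by
      rw [act_add hP σ h (integrable_zeroAtInfty _ _), hf₁, ← act_sub_zeroAtInfty hP]
      unfold act
      rw [integral_sub ?_ (hgi σ), integral_const_mul]
      · rfl
      · exact ((integrable_zeroAtInfty (P σ x) f₁).sub
          (integrable_zeroAtInfty (P σ x) (v s))).const_mul _
    rw [this]
    refine norm_act_le hP σ (fun y => ?_) x
    have := h2 y
    rw [hf₁, dist_comm, dist_eq_norm, hhr] at this
    exact this.le
  have hsum : act (P σ) (fun y => dv y + g y) x = act (P σ) dv x + act (P σ) g x :=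
    integral_add (integrable_zeroAtInfty _ dv) (hgi σ)
  rw [dist_eq_norm, slope_def_module, hsum, hr']
  have hsmul : (r - s)⁻¹ • (act (P (σ + h)) (v r) x - act (P σ) (v s) x) =
      ((r - s : ℝ) : ℂ)⁻¹ * (act (P (σ + h)) (v r) x - act (P σ) (v s) x) := by
    rw [Complex.real_smul]; push_cast; rfl
  rw [hsmul]
  set c := ((r - s : ℝ) : ℂ)⁻¹
  calc _ = ‖(c * (act (P (σ + h)) (v r) x - act (P (σ + h)) (v s) x) - act (P (σ + h)) dv x) +
        (act (P (σ + h)) dv x - act (P σ) dv x) +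
        (c * (act (P (σ + h)) (v s) x - act (P σ) (v s) x) - act (P σ) g x)‖ := by
        congr 1; ring
    _ ≤ ε / 4 + ε / 4 + ε / 4 := (norm_add₃_le).trans (by gcongr)
    _ < ε := by linarith

end Evolution
end LevyOU

namespace LevyOU

/-! ### Truncated characters as test functions -/

section TestFunction

variable {d : ℕ}

/-- `χ` is a smooth cutoff, equal to `1` on the ball of radius `R`, whose derivatives satisfy
bounds with the constant `C`; the point is that `C` will not depend on `R`. -/
structure IsCutoff (C R : ℝ) (χ : Rd d → ℝ) : Prop where
  contDiff : ContDiff ℝ ∞ χ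
  hasCompactSupport : HasCompactSupport χ
  eq_one : ∀ x, ‖x‖ ≤ R → χ x = 1
  abs_le : ∀ x, |χ x| ≤ 1
  fderiv_le : ∀ x, ‖fderiv ℝ χ x‖ ≤ C
  fderiv_sub_le : ∀ x y, ‖fderiv ℝ χ x - fderiv ℝ χ y‖ ≤ C * ‖x - y‖
  fderiv_mul_le : ∀ x, ‖fderiv ℝ χ x‖ * ‖x‖ ≤ C

lemma exists_isCutoff (d : ℕ) :
    ∃ C : ℝ, 0 ≤ C ∧ ∀ R : ℝ, 1 ≤ R → ∃ χ : Rd d → ℝ, IsCutoff C R χ := by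
  let φ : ContDiffBump (0 : Rd d) := ⟨1, 2, one_pos, one_lt_two⟩
  have hφ : ContDiff ℝ ∞ φ := φ.contDiff
  have hφc : HasCompactSupport φ := φ.hasCompactSupport
  have hd : ContDiff ℝ ∞ (fderiv ℝ φ) := hφ.fderiv_right le_rfl
  have hdc : HasCompactSupport (fderiv ℝ φ) := hφc.fderiv ℝ
  obtain ⟨C₁, hC₁⟩ := hdc.exists_bound_of_continuous hd.continuous
  obtain ⟨C₂, hC₂⟩ := ContDiff.lipschitzWith_of_hasCompactSupport hdc hd (by simp)
  obtain ⟨C₃, hC₃⟩ := (hdc.smul_left (f := fun x : Rd d => ‖x‖)).exists_bound_of_continuous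
    (continuous_norm.smul hd.continuous)
  have hC₁0 : 0 ≤ C₁ := (norm_nonneg _).trans (hC₁ 0)
  have hC₃0 : 0 ≤ C₃ := (norm_nonneg _).trans (hC₃ 0)
  refine ⟨C₁ + C₂ + C₃, by positivity, fun R hR => ⟨fun x => φ (R⁻¹ • x), ?_⟩⟩
  have hR0 : 0 < R := by linarith
  have hRi : R⁻¹ ≤ 1 := inv_le_one_of_one_le₀ hR
  have hfd : ∀ x, fderiv ℝ (fun x => φ (R⁻¹ • x)) x = R⁻¹ • fderiv ℝ φ (R⁻¹ • x) := fun x =>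
    fderiv_comp_smul (f := φ) R⁻¹
  constructor
  · fun_prop
  · exact hφc.comp_smul (inv_ne_zero hR0.ne')
  · intro x hx
    apply φ.one_of_mem_closedBall
    simp only [Metric.mem_closedBall, dist_zero_right, norm_smul, norm_inv, Real.norm_of_nonneg hR0.le]
    change R⁻¹ * ‖x‖ ≤ 1
    rw [inv_mul_le_iff₀ hR0]
    linarith
  · intro x
    rw [abs_of_nonneg φ.nonneg]
    exact φ.le_one
  · intro x
    rw [hfd, norm_smul, Real.norm_of_nonneg (by positivity)]
    have := hC₁ (R⁻¹ • x)
    have h2 : (0 : ℝ) ≤ C₂ := C₂.2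
    nlinarith [norm_nonneg (fderiv ℝ φ (R⁻¹ • x))]
  · intro x y
    rw [hfd, hfd, ← smul_sub, norm_smul, Real.norm_of_nonneg (by positivity)]
    have h1 := hC₂.dist_le_mul (R⁻¹ • x) (R⁻¹ • y)
    rw [dist_eq_norm, dist_eq_norm, ← smul_sub, norm_smul, Real.norm_of_nonneg (by positivity)] at h1
    calc _ ≤ R⁻¹ * (C₂ * (R⁻¹ * ‖x - y‖)) := by gcongr
      _ ≤ 1 * (C₂ * (1 * ‖x - y‖)) := by gcongr
      _ = C₂ * ‖x - y‖ := by ring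
      _ ≤ _ := by gcongr; linarith
  · intro x
    have h1 : ‖‖R⁻¹ • x‖ • fderiv ℝ φ (R⁻¹ • x)‖ ≤ C₃ := hC₃ _
    rw [norm_smul, norm_norm, norm_smul, Real.norm_of_nonneg (by positivity)] at h1
    rw [hfd, norm_smul, Real.norm_of_nonneg (by positivity)]
    have h2 : (0 : ℝ) ≤ C₂ := C₂.2
    calc _ = R⁻¹ * ‖x‖ * ‖fderiv ℝ φ (R⁻¹ • x)‖ := by ring
      _ ≤ C₃ := h1
      _ ≤ _ := by linarith

/-- The character `x ↦ exp (i ⟨x, ξ⟩)`. -/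
noncomputable def character (ξ x : Rd d) : ℂ := Complex.exp (inner ℝ x ξ * Complex.I)

/-- A character cut off by `χ`. -/
noncomputable def cutChar (χ : Rd d → ℝ) (ξ x : Rd d) : ℂ := χ x * character ξ x

lemma norm_character (ξ x : Rd d) : ‖character ξ x‖ = 1 := Complex.norm_exp_ofReal_mul_I _

lemma character_add (ξ x y : Rd d) : character ξ (x + y) = character ξ x * character ξ y := by
  simp only [character]
  rw [← Complex.exp_add, inner_add_left]
  push_cast
  ring_nf

lemma contDiff_character (ξ : Rd d) : ContDiff ℝ ∞ (character ξ) := by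
  unfold character
  refine ContDiff.cexp (ContDiff.mul ?_ contDiff_const)
  exact Complex.ofRealCLM.contDiff.comp (contDiff_id.inner ℝ contDiff_const)

lemma norm_character_sub_le (ξ x y : Rd d) :
    ‖character ξ x - character ξ y‖ ≤ ‖ξ‖ * ‖x - y‖ := by
  have h : character ξ x = character ξ (x - y) * character ξ y := by
    rw [← character_add, sub_add_cancel]
  rw [h, ← sub_one_mul, norm_mul, norm_character, mul_one, character, mul_comm (_ : ℂ) Complex.I]
  refine Real.norm_exp_I_mul_ofReal_sub_one_le.trans ?_
  rw [mul_comm ‖ξ‖]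
  exact abs_real_inner_le_norm _ _

lemma hasFDerivAt_character (ξ x : Rd d) :
    HasFDerivAt (character ξ)
      ((character ξ x * Complex.I) • Complex.ofRealCLM ∘L innerSL ℝ ξ) x := by
  have h1 : HasFDerivAt (fun x : Rd d => ((inner ℝ x ξ : ℝ) : ℂ))
      (Complex.ofRealCLM ∘L innerSL ℝ ξ) x := by
    have : (fun x : Rd d => ((inner ℝ x ξ : ℝ) : ℂ)) =
        fun x => (Complex.ofRealCLM ∘L innerSL ℝ ξ) x := by
      ext x; simp [real_inner_comm]
    rw [this]
    exact ContinuousLinearMap.hasFDerivAt _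
  have h2 := (h1.mul_const Complex.I).cexp
  refine h2.congr_fderiv ?_
  rw [smul_smul]
  rfl

lemma IsCutoff.contDiff_cutChar {C R : ℝ} {χ : Rd d → ℝ} (h : IsCutoff C R χ) (ξ : Rd d) :
    ContDiff ℝ ∞ (cutChar χ ξ) :=
  (Complex.ofRealCLM.contDiff.comp h.contDiff).mul (contDiff_character ξ)

lemma IsCutoff.hasCompactSupport_cutChar {C R : ℝ} {χ : Rd d → ℝ} (h : IsCutoff C R χ)
    (ξ : Rd d) : HasCompactSupport (cutChar χ ξ) :=
  (h.hasCompactSupport.comp_left (g := fun r : ℝ => (r : ℂ)) Complex.ofReal_zero).mul_right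

lemma IsCutoff.norm_cutChar_le {C R : ℝ} {χ : Rd d → ℝ} (h : IsCutoff C R χ) (ξ x : Rd d) :
    ‖cutChar χ ξ x‖ ≤ 1 := by
  rw [cutChar, norm_mul, norm_character, mul_one, Complex.norm_real]
  exact h.abs_le x

lemma IsCutoff.fderiv_cutChar {C R : ℝ} {χ : Rd d → ℝ} (h : IsCutoff C R χ) (ξ x : Rd d) :
    fderiv ℝ (cutChar χ ξ) x = character ξ x • (Complex.ofRealCLM ∘L fderiv ℝ χ x +
      (χ x * Complex.I) • Complex.ofRealCLM ∘L innerSL ℝ ξ) := by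
  have h1 : HasFDerivAt (fun x => (χ x : ℂ)) (Complex.ofRealCLM ∘L fderiv ℝ χ x) x :=
    Complex.ofRealCLM.hasFDerivAt.comp x
      (h.contDiff.differentiable (by simp)).differentiableAt.hasFDerivAt
  have h2 := h1.mul (hasFDerivAt_character ξ x)
  rw [show cutChar χ ξ = (fun x => (χ x : ℂ)) * character ξ from rfl, h2.fderiv]
  rw [smul_add, add_comm, smul_smul, smul_smul]
  congr 2
  ring

lemma norm_ofReal_comp_le (L : Rd d →L[ℝ] ℝ) : ‖Complex.ofRealCLM ∘L L‖ ≤ ‖L‖ :=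
  ContinuousLinearMap.opNorm_le_bound _ (norm_nonneg _) fun x => by
    simpa using L.le_opNorm x

/-- A Lipschitz bound for the gradient of a truncated character, uniform in the cutoff radius. -/
lemma IsCutoff.norm_fderiv_cutChar_sub_le {C R : ℝ} (hC : 0 ≤ C) {χ : Rd d → ℝ}
    (h : IsCutoff C R χ) {K : ℝ} {ξ : Rd d} (hξ : ‖ξ‖ ≤ K) (x y : Rd d) :
    ‖fderiv ℝ (cutChar χ ξ) x - fderiv ℝ (cutChar χ ξ) y‖
      ≤ (C * (1 + K) + K * (C + K)) * ‖x - y‖ := by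
  have hK : 0 ≤ K := (norm_nonneg ξ).trans hξ
  set ι := Complex.ofRealCLM ∘L innerSL ℝ ξ with hι
  have hιn : ‖ι‖ ≤ K := (norm_ofReal_comp_le _).trans ((innerSL_apply_norm ℝ ξ).le.trans hξ)
  set W : Rd d → (Rd d →L[ℝ] ℂ) := fun x =>
    Complex.ofRealCLM ∘L fderiv ℝ χ x + (χ x * Complex.I) • ι with hW
  have hWn : ∀ x, ‖W x‖ ≤ C + K := by
    intro x
    refine (norm_add_le _ _).trans (add_le_add ((norm_ofReal_comp_le _).trans (h.fderiv_le x)) ?_)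
    rw [norm_smul, norm_mul, Complex.norm_I, mul_one, Complex.norm_real]
    calc ‖χ x‖ * ‖ι‖ ≤ 1 * K := by gcongr; exact h.abs_le x
      _ = K := one_mul K
  have hχl : ‖χ x - χ y‖ ≤ C * ‖x - y‖ :=
    (convex_univ).norm_image_sub_le_of_norm_fderiv_le (𝕜 := ℝ)
      (fun z _ => (h.contDiff.differentiable (by simp)).differentiableAt)
      (fun z _ => h.fderiv_le z) (Set.mem_univ _) (Set.mem_univ _)
  have hWl : ‖W x - W y‖ ≤ C * (1 + K) * ‖x - y‖ := by
    have : W x - W y = Complex.ofRealCLM ∘L (fderiv ℝ χ x - fderiv ℝ χ y) +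
        (((χ x - χ y : ℝ) : ℂ) * Complex.I) • ι := by
      refine ContinuousLinearMap.ext fun v => ?_
      change ((fderiv ℝ χ x v : ℝ) : ℂ) + χ x * Complex.I * ι v -
        (((fderiv ℝ χ y v : ℝ) : ℂ) + χ y * Complex.I * ι v) =
        ((fderiv ℝ χ x v - fderiv ℝ χ y v : ℝ) : ℂ) + ((χ x - χ y : ℝ) : ℂ) * Complex.I * ι v
      push_cast
      ring
    rw [this]
    refine (norm_add_le _ _).trans ?_
    have h1 := (norm_ofReal_comp_le _).trans (h.fderiv_sub_le x y)
    have h2 : ‖(((χ x - χ y : ℝ) : ℂ) * Complex.I) • ι‖ ≤ C * ‖x - y‖ * K := by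
      rw [norm_smul, norm_mul, Complex.norm_I, mul_one, Complex.norm_real]
      gcongr
    linarith
  rw [h.fderiv_cutChar, h.fderiv_cutChar]
  have : character ξ x • W x - character ξ y • W y =
      character ξ x • (W x - W y) + (character ξ x - character ξ y) • W y := by
    refine ContinuousLinearMap.ext fun v => ?_
    change character ξ x * W x v - character ξ y * W y v =
      character ξ x * (W x v - W y v) + (character ξ x - character ξ y) * W y v
    ring
  change ‖character ξ x • W x - character ξ y • W y‖ ≤ _
  rw [this]
  refine (norm_add_le _ _).trans ?_
  rw [norm_smul, norm_smul, norm_character, one_mul]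
  have h3 : ‖character ξ x - character ξ y‖ * ‖W y‖ ≤ (K * ‖x - y‖) * (C + K) := by
    gcongr
    · exact (norm_character_sub_le ξ x y).trans (by gcongr)
    · exact hWn y
  linarith

/-- A quadratic Taylor bound for functions with Lipschitz gradient. -/
lemma norm_taylor_le {u : Rd d → ℂ} (hu : Differentiable ℝ u) {L : ℝ} (hL : 0 ≤ L)
    (h : ∀ x y, ‖fderiv ℝ u x - fderiv ℝ u y‖ ≤ L * ‖x - y‖) (x y : Rd d) :
    ‖u (x + y) - u x - fderiv ℝ u x y‖ ≤ L * ‖y‖ ^ 2 := by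
  have h1 := (convex_closedBall x ‖y‖).norm_image_sub_le_of_norm_fderiv_le (𝕜 := ℝ)
    (f := fun z => u z - fderiv ℝ u x z) (C := L * ‖y‖) (x := x) (y := x + y)
    (fun z _ => (hu.differentiableAt).sub (fderiv ℝ u x).differentiableAt)
    (fun z hz => by
      rw [fderiv_fun_sub hu.differentiableAt (fderiv ℝ u x).differentiableAt,
        ContinuousLinearMap.fderiv]
      refine (h z x).trans ?_
      gcongr
      simpa [dist_eq_norm] using hz)
    (by simp) (by simp)
  simp only [add_sub_cancel_left, map_add] at h1
  calc _ = ‖u (x + y) - (fderiv ℝ u x x + fderiv ℝ u x y) - (u x - fderiv ℝ u x x)‖ := by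
        congr 1; ring
    _ ≤ _ := h1
    _ = _ := by ring

/-- The full Lévy–Khintchine exponent `-½ ⟨Qξ, ξ⟩ + ∫ (e^{i⟨y, ξ⟩} - 1 - i⟨y, ξ⟩ 1_{|y| ≤ 1}) Π(dy)`
of the noise driving the process. -/
noncomputable def symbol (Q : Matrix (Fin d) (Fin d) ℝ) (Lm : Measure (Rd d)) (ξ : Rd d) : ℂ :=
  -(inner ℝ ξ (Matrix.toEuclideanCLM (𝕜 := ℝ) Q ξ) : ℝ) / 2 + levySymbol Lm ξ

/-- The generator applied to a truncated character, without the term that the time derivative of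
the character cancels. -/
noncomputable def generatorRest (Q B : Matrix (Fin d) (Fin d) ℝ) (Lm : Measure (Rd d))
    (χ : Rd d → ℝ) (ξ x : Rd d) : ℂ :=
  generator Q B Lm (cutChar χ ξ) x -
    inner ℝ (Matrix.toEuclideanCLM (𝕜 := ℝ) B x) ξ * Complex.I * cutChar χ ξ x

lemma differentiable_cutChar {C R : ℝ} {χ : Rd d → ℝ} (h : IsCutoff C R χ) (ξ : Rd d) :
    Differentiable ℝ (cutChar χ ξ) := (h.contDiff_cutChar ξ).differentiable (by simp)

lemma IsCutoff.norm_integrand_le {C R : ℝ} (hC : 0 ≤ C) {χ : Rd d → ℝ}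
    (h : IsCutoff C R χ) {K : ℝ} {ξ : Rd d} (hξ : ‖ξ‖ ≤ K) (x y : Rd d) :
    ‖cutChar χ ξ (x + y) - cutChar χ ξ x -
        (if ‖y‖ ≤ 1 then fderiv ℝ (cutChar χ ξ) x y else 0)‖
      ≤ (C * (1 + K) + K * (C + K) + 2) * min 1 (‖y‖ ^ 2) := by
  have hK : 0 ≤ K := (norm_nonneg ξ).trans hξ
  split_ifs with hy
  · rw [min_eq_right (by nlinarith [norm_nonneg y])]
    refine (norm_taylor_le (differentiable_cutChar h ξ) (by positivity)
      (h.norm_fderiv_cutChar_sub_le hC hξ) x y).trans ?_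
    exact mul_le_mul_of_nonneg_right (by linarith) (by positivity)
  · rw [min_eq_left (by nlinarith [norm_nonneg y]), sub_zero, mul_one]
    have h0 : 0 ≤ C * (1 + K) + K * (C + K) := by positivity
    linarith [norm_sub_le (cutChar χ ξ (x + y)) (cutChar χ ξ x), h.norm_cutChar_le ξ (x + y),
      h.norm_cutChar_le ξ x]

lemma IsCutoff.norm_generatorRest_le {C R : ℝ} (hC : 0 ≤ C) {χ : Rd d → ℝ}
    (h : IsCutoff C R χ) {K : ℝ} {ξ : Rd d} (hξ : ‖ξ‖ ≤ K)
    (Q B : Matrix (Fin d) (Fin d) ℝ) {Lm : Measure (Rd d)}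
    (hLm : Integrable (fun y : Rd d => min 1 (‖y‖ ^ 2)) Lm) (x : Rd d) :
    ‖generatorRest Q B Lm χ ξ x‖ ≤
      (1 / 2) * ∑ i, ∑ j, ‖(Q i j : ℂ)‖ * (C * (1 + K) + K * (C + K)) +
        ‖Matrix.toEuclideanCLM (𝕜 := ℝ) B‖ * C +
        (C * (1 + K) + K * (C + K) + 2) * ∫ y, min 1 (‖y‖ ^ 2) ∂Lm := by
  have hK : 0 ≤ K := (norm_nonneg ξ).trans hξ
  have hL : 0 ≤ C * (1 + K) + K * (C + K) := by positivity
  have hdrift : fderiv ℝ (cutChar χ ξ) x (Matrix.toEuclideanLin B x) -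
      inner ℝ (Matrix.toEuclideanCLM (𝕜 := ℝ) B x) ξ * Complex.I * cutChar χ ξ x =
      character ξ x * (fderiv ℝ χ x (Matrix.toEuclideanCLM (𝕜 := ℝ) B x) : ℝ) := by
    rw [h.fderiv_cutChar]
    change character ξ x * (((fderiv ℝ χ x (Matrix.toEuclideanCLM (𝕜 := ℝ) B x) : ℝ) : ℂ) +
      χ x * Complex.I * ((inner ℝ ξ (Matrix.toEuclideanCLM (𝕜 := ℝ) B x) : ℝ) : ℂ)) - _ = _
    rw [real_inner_comm, cutChar]
    ring
  have hsplit : generatorRest Q B Lm χ ξ x =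
      (1 / 2 : ℂ) * ∑ i, ∑ j, (Q i j : ℂ) * partialDeriv i (partialDeriv j (cutChar χ ξ)) x +
      character ξ x * (fderiv ℝ χ x (Matrix.toEuclideanCLM (𝕜 := ℝ) B x) : ℝ) +
      ∫ y, (cutChar χ ξ (x + y) - cutChar χ ξ x -
        (if ‖y‖ ≤ 1 then fderiv ℝ (cutChar χ ξ) x y else 0)) ∂Lm := by
    rw [← hdrift, generatorRest, generator]
    ring
  rw [hsplit]
  refine norm_add₃_le.trans (add_le_add (add_le_add ?_ ?_) ?_)
  · rw [norm_mul]
    have : ‖(1 / 2 : ℂ)‖ = 1 / 2 := by norm_num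
    rw [this]
    gcongr
    refine (norm_sum_le _ _).trans (Finset.sum_le_sum fun i _ => ?_)
    refine (norm_sum_le _ _).trans (Finset.sum_le_sum fun j _ => ?_)
    rw [norm_mul]
    gcongr
    have hsingle : ‖EuclideanSpace.single j (1 : ℝ)‖ = 1 := by simp
    have hlip : LipschitzWith ⟨C * (1 + K) + K * (C + K), hL⟩ (partialDeriv j (cutChar χ ξ)) := by
      refine LipschitzWith.of_dist_le_mul fun z w => ?_
      rw [dist_eq_norm, dist_eq_norm, partialDeriv, partialDeriv, ← _root_.sub_apply]
      refine (ContinuousLinearMap.le_opNorm _ _).trans ?_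
      rw [hsingle, mul_one]
      exact h.norm_fderiv_cutChar_sub_le hC hξ z w
    have h1 := norm_fderiv_le_of_lipschitz ℝ (x₀ := x) hlip
    refine (ContinuousLinearMap.le_opNorm _ _).trans ?_
    rw [PiLp.norm_single, norm_one, mul_one]
    exact h1
  · rw [norm_mul, norm_character, one_mul, Complex.norm_real]
    calc _ ≤ ‖fderiv ℝ χ x‖ * (‖Matrix.toEuclideanCLM (𝕜 := ℝ) B‖ * ‖x‖) :=
          (ContinuousLinearMap.le_opNorm _ _).trans
            (by gcongr; exact ContinuousLinearMap.le_opNorm _ _)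
      _ = ‖Matrix.toEuclideanCLM (𝕜 := ℝ) B‖ * (‖fderiv ℝ χ x‖ * ‖x‖) := by ring
      _ ≤ _ := by gcongr; exact h.fderiv_mul_le x
  · rw [← integral_const_mul]
    exact norm_integral_le_of_norm_le (hLm.const_mul _)
      (ae_of_all _ fun y => h.norm_integrand_le hC hξ x y)

/-- Near a fixed point the truncation is eventually invisible to the local part of the generator,
and the jump part converges by dominated convergence. -/
lemma tendsto_generatorRest {C : ℝ} (hC : 0 ≤ C) {χ : ℕ → Rd d → ℝ}
    (h : ∀ n : ℕ, IsCutoff C (n + 1) (χ n)) (Q B : Matrix (Fin d) (Fin d) ℝ) {Lm : Measure (Rd d)}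
    (hLm : Integrable (fun y : Rd d => min 1 (‖y‖ ^ 2)) Lm) (ξ x : Rd d) :
    Tendsto (fun n => generatorRest Q B Lm (χ n) ξ x) atTop
      (𝓝 (symbol Q Lm ξ * character ξ x)) := by
  have hcut : ∀ z : Rd d, ∀ᶠ n : ℕ in atTop, cutChar (χ n) ξ z = character ξ z := by
    intro z
    filter_upwards [eventually_ge_atTop ⌈‖z‖⌉₊] with n hn
    have : ‖z‖ ≤ n + 1 := (Nat.le_ceil _).trans (by
      have : (⌈‖z‖⌉₊ : ℝ) ≤ n := by exact_mod_cast hn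
      linarith)
    rw [cutChar, (h n).eq_one z this, Complex.ofReal_one, one_mul]
  have hloc : ∀ᶠ n : ℕ in atTop, cutChar (χ n) ξ =ᶠ[𝓝 x] character ξ := by
    filter_upwards [eventually_ge_atTop ⌈‖x‖⌉₊] with n hn
    have h1 : ‖x‖ < n + 1 := (Nat.le_ceil _).trans_lt (by
      have : (⌈‖x‖⌉₊ : ℝ) ≤ n := by exact_mod_cast hn
      linarith)
    have h2 : ∀ᶠ z in 𝓝 x, ‖z‖ < n + 1 := continuous_norm.continuousAt.eventually_lt_const h1
    filter_upwards [h2] with z hz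
    rw [cutChar, (h n).eq_one z hz.le, Complex.ofReal_one, one_mul]
  have hpd : ∀ j : Fin d, partialDeriv j (character ξ) = fun z => ξ j * Complex.I * character ξ z := by
    intro j
    ext z
    rw [partialDeriv, (hasFDerivAt_character ξ z).fderiv]
    change character ξ z * Complex.I * ((inner ℝ ξ (EuclideanSpace.single j 1) : ℝ) : ℂ) = _
    rw [EuclideanSpace.inner_single_right]
    simp
    ring
  have hpd2 : ∀ i j : Fin d, partialDeriv i (partialDeriv j (character ξ)) x =
      -(ξ i * ξ j : ℂ) * character ξ x := by
    intro i j
    rw [hpd j, partialDeriv,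
      ((hasFDerivAt_character ξ x).const_mul (ξ j * Complex.I : ℂ)).fderiv]
    have := congrFun (hpd i) x
    rw [partialDeriv, (hasFDerivAt_character ξ x).fderiv] at this
    change (ξ j * Complex.I : ℂ) *
      (((character ξ x * Complex.I) • Complex.ofRealCLM ∘L innerSL ℝ ξ) _) = _
    rw [this]
    linear_combination (ξ i * ξ j * character ξ x : ℂ) * Complex.I_mul_I
  have hfd : fderiv ℝ (character ξ) x =
      (character ξ x * Complex.I) • Complex.ofRealCLM ∘L innerSL ℝ ξ :=
    (hasFDerivAt_character ξ x).fderiv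
  have hfdapp : ∀ y, fderiv ℝ (character ξ) x y = inner ℝ y ξ * Complex.I * character ξ x := by
    intro y
    rw [hfd]
    change character ξ x * Complex.I * ((inner ℝ ξ y : ℝ) : ℂ) = _
    rw [real_inner_comm]
    ring
  -- the jump part
  have hjump : Tendsto (fun n => ∫ y, (cutChar (χ n) ξ (x + y) - cutChar (χ n) ξ x -
        (if ‖y‖ ≤ 1 then fderiv ℝ (cutChar (χ n) ξ) x y else 0)) ∂Lm) atTop
      (𝓝 (levySymbol Lm ξ * character ξ x)) := by
    have heq : levySymbol Lm ξ * character ξ x =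
        ∫ y, levyIntegrand ξ y * character ξ x ∂Lm := by
      rw [integral_mul_const]; rfl
    rw [heq]
    refine tendsto_integral_of_dominated_convergence
      (fun y => (C * (1 + ‖ξ‖) + ‖ξ‖ * (C + ‖ξ‖) + 2) * min 1 (‖y‖ ^ 2)) ?_
      (hLm.const_mul _) (fun n => ae_of_all _ fun y => (h n).norm_integrand_le hC le_rfl x y) ?_
    · intro n
      have hc := ((h n).contDiff_cutChar ξ).continuous
      refine Measurable.aestronglyMeasurable (Measurable.sub ?_ (Measurable.ite ?_ ?_ ?_))
      · fun_prop
      · exact measurableSet_le (by fun_prop) measurable_const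
      · fun_prop
      · fun_prop
    · refine ae_of_all _ fun y => tendsto_const_nhds.congr' ?_
      filter_upwards [hcut (x + y), hloc] with n h1 h2
      rw [h1, h2.eq_of_nhds, h2.fderiv_eq, hfdapp, character_add, levyIntegrand]
      change _ = character ξ x * Complex.exp (inner ℝ y ξ * Complex.I) - _ - _
      split_ifs <;> ring
  have hQ : (1 / 2 : ℂ) * ∑ i, ∑ j, (Q i j : ℂ) * (-(ξ i * ξ j : ℂ) * character ξ x) =
      -(inner ℝ ξ (Matrix.toEuclideanCLM (𝕜 := ℝ) Q ξ) : ℝ) / 2 * character ξ x := by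
    rw [Matrix.inner_toEuclideanCLM]
    simp only [dotProduct, Matrix.mulVec]
    push_cast
    simp only [Finset.mul_sum, neg_div, Finset.sum_div, Finset.sum_mul, neg_mul,
      ← Finset.sum_neg_distrib]
    refine Finset.sum_congr rfl fun i _ => Finset.sum_congr rfl fun j _ => ?_
    ring
  have hlim : symbol Q Lm ξ * character ξ x =
      (1 / 2 : ℂ) * ∑ i, ∑ j, (Q i j : ℂ) * (-(ξ i * ξ j : ℂ) * character ξ x) +
        levySymbol Lm ξ * character ξ x := by
    rw [hQ, symbol]; ring
  rw [hlim]
  refine (hjump.const_add _).congr' ?_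
  filter_upwards [hloc] with n hn
  have hp2 : ∀ i j : Fin d, partialDeriv i (partialDeriv j (cutChar (χ n) ξ)) x =
      -(ξ i * ξ j : ℂ) * character ξ x := by
    intro i j
    rw [← hpd2 i j]
    have : partialDeriv j (cutChar (χ n) ξ) =ᶠ[𝓝 x] partialDeriv j (character ξ) := by
      filter_upwards [hn.eventuallyEq_nhds] with z hz
      simp only [partialDeriv]
      rw [hz.fderiv_eq]
    simp only [partialDeriv] at this ⊢
    rw [this.fderiv_eq]
  have hdr : fderiv ℝ (cutChar (χ n) ξ) x (Matrix.toEuclideanLin B x) =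
      inner ℝ (Matrix.toEuclideanCLM (𝕜 := ℝ) B x) ξ * Complex.I * cutChar (χ n) ξ x := by
    rw [hn.fderiv_eq, hn.eq_of_nhds]
    exact hfdapp _
  rw [generatorRest, generator, hdr]
  simp only [hp2]
  ring

end TestFunction
end LevyOU

namespace LevyOU

/-! ### Characteristic functions of the transition kernels -/

section Identification

variable {d : ℕ}

/-- A truncated character as an element of `C_0`. -/
noncomputable def IsCutoff.cutCharC₀ {C R : ℝ} {χ : Rd d → ℝ} (h : IsCutoff C R χ) (ξ : Rd d) :
    C₀(Rd d, ℂ) :=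
  ⟨⟨cutChar χ ξ, (h.contDiff_cutChar ξ).continuous⟩,
    HasCompactSupport.is_zero_at_infty (h.hasCompactSupport_cutChar ξ)⟩

/-- The derivative of a truncated character in the direction `ζ` of its frequency. -/
noncomputable def IsCutoff.derivC₀ {C R : ℝ} {χ : Rd d → ℝ} (h : IsCutoff C R χ) (ξ ζ : Rd d) :
    C₀(Rd d, ℂ) :=
  have hc : Continuous fun x : Rd d => cutChar χ ξ x * (inner ℝ x ζ * Complex.I) :=
    (h.contDiff_cutChar ξ).continuous.mul (by fun_prop)
  ⟨⟨_, hc⟩, HasCompactSupport.is_zero_at_infty ((h.hasCompactSupport_cutChar ξ).mul_right)⟩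

lemma IsCutoff.derivC₀_apply {C R : ℝ} {χ : Rd d → ℝ} (h : IsCutoff C R χ) (ξ ζ x : Rd d) :
    h.derivC₀ ξ ζ x = cutChar χ ξ x * (inner ℝ x ζ * Complex.I) := rfl

lemma IsCutoff.hasDerivAt_cutCharC₀ {C R : ℝ} {χ : Rd d → ℝ} (h : IsCutoff C R χ)
    {ξ : ℝ → Rd d} {ζ : Rd d} {s : ℝ} (hξ : HasDerivAt ξ ζ s) :
    HasDerivAt (fun r => h.cutCharC₀ (ξ r)) (h.derivC₀ (ξ s) ζ) s := by
  obtain ⟨M, hM0, hM⟩ : ∃ M : ℝ, 0 ≤ M ∧ ∀ x, χ x ≠ 0 → ‖x‖ ≤ M := by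
    obtain ⟨M, hM⟩ := h.hasCompactSupport.isCompact.isBounded.exists_norm_le
    refine ⟨max M 0, le_max_right _ _, fun x hx => (hM x ?_).trans (le_max_left _ _)⟩
    exact subset_tsupport _ hx
  rw [hasDerivAt_iff_isLittleO] at hξ ⊢
  have hO : (fun r => ξ r - ξ s) =O[𝓝 s] fun r => r - s :=
    (hasDerivAt_iff_isLittleO.2 hξ).isBigO_sub
  have hsq : (fun r => ‖ξ r - ξ s‖ ^ 2) =o[𝓝 s] fun r => r - s := by
    have h1 : (fun r => ‖ξ r - ξ s‖ ^ 2) =O[𝓝 s] fun r => (r - s) ^ 2 := by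
      have := hO.norm_left.mul hO.norm_left
      simpa [sq] using this
    refine h1.trans_isLittleO ?_
    have h2 : (fun r : ℝ => r - s) =o[𝓝 s] fun _ => (1 : ℝ) := by
      rw [Asymptotics.isLittleO_one_iff]
      have : Tendsto (fun r : ℝ => r - s) (𝓝 s) (𝓝 (s - s)) := by
        apply Continuous.tendsto; fun_prop
      simpa using this
    simpa [sq] using (h2.mul_isBigO (Asymptotics.isBigO_refl (fun r : ℝ => r - s) (𝓝 s)))
  have hsum : (fun r => M ^ 2 * ‖ξ r - ξ s‖ ^ 2 + M * ‖ξ r - ξ s - (r - s) • ζ‖) =o[𝓝 s]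
      fun r => r - s := (hsq.const_mul_left _).add (hξ.norm_left.const_mul_left _)
  refine Asymptotics.IsBigO.trans_isLittleO (Asymptotics.IsBigO.of_bound 1 ?_) hsum
  refine Eventually.of_forall fun r => ?_
  rw [one_mul, Real.norm_of_nonneg (by positivity)]
  refine norm_le_of_forall_apply_le (by positivity) fun x => ?_
  change ‖cutChar χ (ξ r) x - cutChar χ (ξ s) x - (r - s) • (h.derivC₀ (ξ s) ζ x)‖ ≤ _
  rw [h.derivC₀_apply]
  by_cases hx : χ x = 0
  · simp only [cutChar, hx]
    simp
    positivity
  have hxM := hM x hx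
  set a : ℝ := inner ℝ x (ξ r - ξ s) with ha
  set b : ℝ := inner ℝ x ((r - s) • ζ) with hb
  have h1 : cutChar χ (ξ r) x - cutChar χ (ξ s) x -
      (r - s) • (cutChar χ (ξ s) x * (inner ℝ x ζ * Complex.I)) =
      cutChar χ (ξ s) x * ((Complex.exp (a * Complex.I) - 1 - a * Complex.I) +
        (a - b : ℝ) * Complex.I) := by
    have h2 : character (ξ r) x = character (ξ s) x * Complex.exp (a * Complex.I) := by
      simp only [character, ha]
      rw [← Complex.exp_add, inner_sub_right]
      push_cast
      ring_nf
    rw [cutChar, cutChar, h2, Complex.real_smul, hb, inner_smul_right]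
    push_cast
    ring
  rw [h1, norm_mul]
  have h3 : ‖(Complex.exp (a * Complex.I) - 1 - a * Complex.I) + (a - b : ℝ) * Complex.I‖ ≤
      M ^ 2 * ‖ξ r - ξ s‖ ^ 2 + M * ‖ξ r - ξ s - (r - s) • ζ‖ := by
    refine (norm_add_le _ _).trans (add_le_add ((norm_exp_mul_I_sub_one_sub_le a).trans ?_) ?_)
    · rw [← sq_abs, ← mul_pow]
      have := (abs_real_inner_le_norm x (ξ r - ξ s)).trans
        (mul_le_mul_of_nonneg_right hxM (norm_nonneg _))
      gcongr
    · rw [norm_mul, Complex.norm_I, mul_one, Complex.norm_real, ha, hb, ← inner_sub_right]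
      exact (abs_real_inner_le_norm _ _).trans (by gcongr)
  calc _ ≤ 1 * _ := mul_le_mul_of_nonneg_right (h.norm_cutChar_le _ _) (norm_nonneg _)
    _ = _ := one_mul _
    _ ≤ _ := h3

lemma hasDerivAt_expAdj_sub (B : Matrix (Fin d) (Fin d) ℝ) (t s : ℝ) (ξ : Rd d) :
    HasDerivAt (fun r => expAdj B (t - r) ξ)
      (-(Matrix.toEuclideanCLM (𝕜 := ℝ) B.transpose (expAdj B (t - s) ξ))) s := by
  have h1 := hasDerivAt_exp_smul_const' (𝕂 := ℝ)
    (Matrix.toEuclideanCLM (𝕜 := ℝ) B.transpose : Rd d →L[ℝ] Rd d) (t - s)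
  have h2 : HasDerivAt (fun r : ℝ => t - r) (-1) s := by
    simpa using (hasDerivAt_id s).const_sub t
  have h3 := h1.scomp s h2
  have h4 : HasDerivAt (fun r => expAdj B (t - r) ξ) _ s :=
    (ContinuousLinearMap.apply ℝ (Rd d) ξ).hasFDerivAt.comp_hasDerivAt s h3
  refine h4.congr_deriv ?_
  rw [neg_one_smul]
  rfl

lemma exp_zero_smul_apply {E : Type*} [NormedAddCommGroup E] [NormedSpace ℝ E]
    (D : E →L[ℝ] E) (x : E) : NormedSpace.exp ((0 : ℝ) • D) x = x := by
  rw [zero_smul, NormedSpace.exp_zero]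
  rfl

lemma expAdj_zero (B : Matrix (Fin d) (Fin d) ℝ) (ξ : Rd d) : expAdj B 0 ξ = ξ := by
  exact exp_zero_smul_apply _ ξ

lemma continuous_symbol (Q : Matrix (Fin d) (Fin d) ℝ) {Lm : Measure (Rd d)}
    (hLm : Integrable (fun y : Rd d => min 1 (‖y‖ ^ 2)) Lm) : Continuous (symbol Q Lm) := by
  have := continuous_levySymbol hLm
  unfold symbol
  fun_prop

/-- Characteristic functions of the transition kernels. With `ξ_s = e^{(t-s)B*} ξ` and
`c(s) = exp (-∫_0^s ψ(ξ_r) dr)`, where `ψ` is the exponent of the noise, the function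
`c(s) exp (i ⟨·, ξ_s⟩)` formally solves the backward equation, so that its integral against
`P_s(x, ·)` does not depend on `s`. Truncation makes it an admissible test function. The truncation
errors are uniformly bounded and tend to `0` pointwise, and `P_s(x, ·)` is a probability measure, so
no moment bounds are needed to remove it. -/
theorem charFun_transition {Q B : Matrix (Fin d) (Fin d) ℝ} {Lm : Measure (Rd d)}
    {P : ℝ≥0 → Kernel (Rd d) (Rd d)} (hP : IsLevyOUSemigroup Q B Lm P)
    (hLm : IsLevyMeasure Lm) (t : ℝ≥0) (x ξ : Rd d) :
    charFun (P t x) ξ = character (expAdj B t ξ) x *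
      Complex.exp (∫ s in (0 : ℝ)..t, symbol Q Lm (expAdj B s ξ)) := by
  have hF := hP.toIsFellerSemigroup
  have hmk := hF.markov
  have hint := integrable_min_one_sq hLm
  have hψc := continuous_symbol Q hint
  have ht0 : (0 : ℝ) ≤ t := t.2
  have hexpc : Continuous fun p : ℝ × Rd d => expAdj B p.1 p.2 := continuous_expAdj_apply B
  set ζ : ℝ → Rd d := fun s => expAdj B (t - s) ξ with hζ
  have hζc : Continuous ζ := hexpc.comp (by fun_prop : Continuous fun s : ℝ => ((t : ℝ) - s, ξ))
  obtain ⟨K, hK⟩ : ∃ K, ∀ s ∈ Set.Icc (0 : ℝ) t, ‖ζ s‖ ≤ K :=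
    isCompact_Icc.exists_bound_of_continuousOn hζc.continuousOn
  have hK0 : 0 ≤ K := (norm_nonneg _).trans (hK 0 ⟨le_rfl, ht0⟩)
  set c : ℝ → ℂ := fun s => Complex.exp (-∫ r in (0 : ℝ)..s, symbol Q Lm (ζ r)) with hc
  have hcd : ∀ s, HasDerivAt c (-symbol Q Lm (ζ s) * c s) s := by
    intro s
    have h1 : HasDerivAt (fun s => ∫ r in (0 : ℝ)..s, symbol Q Lm (ζ r)) (symbol Q Lm (ζ s)) s :=
      ((hψc.comp hζc).integral_hasStrictDerivAt 0 s).hasDerivAt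
    have h2 := h1.neg.cexp
    rw [mul_comm] at h2
    exact h2
  have hcc : Continuous c := continuous_iff_continuousAt.2 fun s => (hcd s).continuousAt
  obtain ⟨Kc, hKc⟩ : ∃ K, ∀ s ∈ Set.Icc (0 : ℝ) t, ‖c s‖ ≤ K :=
    isCompact_Icc.exists_bound_of_continuousOn hcc.continuousOn
  have hKc0 : 0 ≤ Kc := (norm_nonneg _).trans (hKc 0 ⟨le_rfl, ht0⟩)
  obtain ⟨Kψ, hKψ⟩ : ∃ K, ∀ s ∈ Set.Icc (0 : ℝ) t, ‖symbol Q Lm (ζ s)‖ ≤ K :=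
    isCompact_Icc.exists_bound_of_continuousOn (hψc.comp hζc).continuousOn
  obtain ⟨C, hC0, hC⟩ := exists_isCutoff d
  choose χ hχ using fun n : ℕ => hC (n + 1) (by have : (0 : ℝ) ≤ n := by positivity
                                                linarith)
  set G : ℕ → ℝ → ℂ := fun n s => c s * act (P s.toNNReal) ((hχ n).cutCharC₀ (ζ s)) x with hG
  set D : ℕ → ℝ → ℂ := fun n s => c s *
    (act (P s.toNNReal) (generatorRest Q B Lm (χ n) (ζ s)) x -
      symbol Q Lm (ζ s) * act (P s.toNNReal) ((hχ n).cutCharC₀ (ζ s)) x) with hD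
  have hvd : ∀ n s, HasDerivAt (fun r => (hχ n).cutCharC₀ (ζ r))
      ((hχ n).derivC₀ (ζ s) (-(Matrix.toEuclideanCLM (𝕜 := ℝ) B.transpose (ζ s)))) s :=
    fun n s => (hχ n).hasDerivAt_cutCharC₀ (hasDerivAt_expAdj_sub B t s ξ)
  have hvc : ∀ n, Continuous fun r => (hχ n).cutCharC₀ (ζ r) := fun n =>
    continuous_iff_continuousAt.2 fun s => (hvd n s).continuousAt
  have hadj : ∀ y z : Rd d, inner ℝ y (-(Matrix.toEuclideanCLM (𝕜 := ℝ) B.transpose z)) =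
      -inner ℝ (Matrix.toEuclideanCLM (𝕜 := ℝ) B y) z := by
    intro y z
    rw [inner_neg_right, Matrix.inner_toEuclideanCLM, real_inner_comm, Matrix.inner_toEuclideanCLM,
      Matrix.dotProduct_mulVec, Matrix.vecMul_transpose, dotProduct_comm]
  have hGd : ∀ n, ∀ s, 0 ≤ s → HasDerivWithinAt (G n) (D n s) (Set.Ioi s) s := by
    intro n s hs
    have h1 := hasDerivWithinAt_act hF hs (hvd n s)
      (hP.generator_eq _ ((hχ n).contDiff_cutChar (ζ s)) ((hχ n).hasCompactSupport_cutChar (ζ s))) x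
    have h2 := (hcd s).hasDerivWithinAt.mul h1 (s := Set.Ioi s)
    refine h2.congr_deriv ?_
    have h3 : (fun y => (hχ n).derivC₀ (ζ s)
        (-(Matrix.toEuclideanCLM (𝕜 := ℝ) B.transpose (ζ s))) y +
          generator Q B Lm ((hχ n).cutCharC₀ (ζ s)) y) = generatorRest Q B Lm (χ n) (ζ s) := by
      ext y
      rw [(hχ n).derivC₀_apply, hadj, generatorRest]
      change _ + generator Q B Lm (cutChar (χ n) (ζ s)) y = _
      push_cast
      ring
    rw [h3, hD]
    ring
  have hGc : ∀ n, ContinuousOn (G n) (Set.Icc 0 t) := fun n =>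
    hcc.continuousOn.mul ((continuousOn_act hF (hvc n) x).mono fun s hs => hs.1)
  obtain ⟨Kg, hKg⟩ : ∃ Kg, ∀ n, ∀ s ∈ Set.Icc (0 : ℝ) t, ∀ y,
      ‖generatorRest Q B Lm (χ n) (ζ s) y‖ ≤ Kg :=
    ⟨_, fun n s hs y => (hχ n).norm_generatorRest_le hC0 (hK s hs) Q B hint y⟩
  have hDb : ∀ n, ∀ s ∈ Set.Icc (0 : ℝ) t, ‖D n s‖ ≤ Kc * (Kg + Kψ * 1) := by
    intro n s hs
    rw [hD, norm_mul]
    refine mul_le_mul (hKc s hs) ((norm_sub_le _ _).trans (add_le_add ?_ ?_)) (norm_nonneg _) hKc0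
    · exact norm_act_le hF _ (hKg n s hs) x
    · rw [norm_mul]
      exact mul_le_mul (hKψ s hs) (norm_act_le hF _ ((hχ n).norm_cutChar_le _) x) (norm_nonneg _)
        ((norm_nonneg _).trans (hKψ s hs))
  -- `D n` is measurable since it is a right derivative
  have hDm : ∀ n, AEStronglyMeasurable (D n) (volume.restrict (Set.Ioc 0 (t : ℝ))) := by
    intro n
    refine (stronglyMeasurable_derivWithin_Ioi (G n)).aestronglyMeasurable.congr ?_
    refine ae_restrict_of_forall_mem measurableSet_Ioc fun s hs => ?_
    exact (hGd n s hs.1.le).derivWithin (uniqueDiffWithinAt_Ioi s)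
  have hDi : ∀ n, IntervalIntegrable (D n) volume 0 t := by
    intro n
    rw [intervalIntegrable_iff_integrableOn_Ioc_of_le ht0]
    exact (integrable_const (Kc * (Kg + Kψ * 1))).mono' (hDm n)
      (ae_restrict_of_forall_mem measurableSet_Ioc fun s hs => hDb n s ⟨hs.1.le, hs.2⟩)
  have hFTC : ∀ n, ∫ s in (0 : ℝ)..t, D n s = G n t - G n 0 := fun n =>
    intervalIntegral.integral_eq_sub_of_hasDeriv_right_of_le ht0 (hGc n)
      (fun s hs => hGd n s hs.1.le) (hDi n)
  -- removal of the truncation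
  have hcut : ∀ s : ℝ, Tendsto (fun n => act (P s.toNNReal) ((hχ n).cutCharC₀ (ζ s)) x) atTop
      (𝓝 (act (P s.toNNReal) (character (ζ s)) x)) := by
    intro s
    refine tendsto_integral_of_dominated_convergence (fun _ => 1) ?_ (integrable_const _) ?_ ?_
    · exact fun n => ((hχ n).contDiff_cutChar (ζ s)).continuous.aestronglyMeasurable
    · exact fun n => ae_of_all _ fun y => (hχ n).norm_cutChar_le _ y
    · refine ae_of_all _ fun y => tendsto_const_nhds.congr' ?_
      filter_upwards [eventually_ge_atTop ⌈‖y‖⌉₊] with n hn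
      have : ‖y‖ ≤ n + 1 := (Nat.le_ceil _).trans (by
        have : (⌈‖y‖⌉₊ : ℝ) ≤ n := by exact_mod_cast hn
        linarith)
      change _ = cutChar (χ n) (ζ s) y
      rw [cutChar, (hχ n).eq_one y this, Complex.ofReal_one, one_mul]
  have hGlim : ∀ s : ℝ, Tendsto (fun n => G n s) atTop
      (𝓝 (c s * act (P s.toNNReal) (character (ζ s)) x)) := fun s => (hcut s).const_mul _
  have hDlim : ∀ s ∈ Set.Icc (0 : ℝ) t, Tendsto (fun n => D n s) atTop (𝓝 0) := by
    intro s hs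
    have h1 : Tendsto (fun n => act (P s.toNNReal) (generatorRest Q B Lm (χ n) (ζ s)) x) atTop
        (𝓝 (act (P s.toNNReal) (fun y => symbol Q Lm (ζ s) * character (ζ s) y) x)) := by
      refine tendsto_integral_of_dominated_convergence (fun _ => Kg) ?_ (integrable_const _) ?_ ?_
      · intro n
        -- the generator applied to a test function is a uniform limit of continuous functions
        have hgc : Continuous (generator Q B Lm (cutChar (χ n) (ζ s))) := by
          refine (hP.generator_eq _ ((hχ n).contDiff_cutChar (ζ s))
            ((hχ n).hasCompactSupport_cutChar (ζ s))).continuous (Frequently.of_forall fun r => ?_)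
          obtain ⟨f, hf⟩ := hF.feller r ((hχ n).cutCharC₀ (ζ s))
          have hf' : act (P r) (cutChar (χ n) (ζ s)) = f := hf
          rw [hf']
          exact continuous_const.mul
            (f.continuous.sub ((hχ n).contDiff_cutChar (ζ s)).continuous)
        have hcc' := ((hχ n).contDiff_cutChar (ζ s)).continuous
        have : Continuous (generatorRest Q B Lm (χ n) (ζ s)) := by
          unfold generatorRest
          fun_prop
        exact this.aestronglyMeasurable
      · exact fun n => ae_of_all _ (hKg n s hs)
      · exact ae_of_all _ fun y => tendsto_generatorRest hC0 hχ Q B hint (ζ s) y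
    have h2 : act (P s.toNNReal) (fun y => symbol Q Lm (ζ s) * character (ζ s) y) x =
        symbol Q Lm (ζ s) * act (P s.toNNReal) (character (ζ s)) x := integral_const_mul _ _
    have h3 := (h1.sub ((hcut s).const_mul (symbol Q Lm (ζ s)))).const_mul (c s)
    rw [h2, sub_self, mul_zero] at h3
    exact h3
  have hIlim : Tendsto (fun n => ∫ s in (0 : ℝ)..t, D n s) atTop (𝓝 0) := by
    have := intervalIntegral.tendsto_integral_filter_of_dominated_convergence
      (μ := volume) (a := (0 : ℝ)) (b := t) (F := D) (f := fun _ => (0 : ℂ)) (l := atTop)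
      (fun _ => Kc * (Kg + Kψ * 1)) ?_ ?_ ?_ ?_
    · simpa using this
    · refine Eventually.of_forall fun n => ?_
      rw [Set.uIoc_of_le ht0]
      exact hDm n
    · refine Eventually.of_forall fun n => ae_of_all _ fun s hs => ?_
      rw [Set.uIoc_of_le ht0] at hs
      exact hDb n s ⟨hs.1.le, hs.2⟩
    · exact intervalIntegrable_const
    · refine ae_of_all _ fun s hs => ?_
      rw [Set.uIoc_of_le ht0] at hs
      exact hDlim s ⟨hs.1.le, hs.2⟩
  have hkey := tendsto_nhds_unique hIlim
    (((hGlim t).sub (hGlim 0)).congr fun n => (hFTC n).symm)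
  have hkey' := sub_eq_zero.1 hkey.symm
  have hζt : ζ t = ξ := by simp only [hζ, sub_self, expAdj_zero]
  have hζ0 : ζ 0 = expAdj B t ξ := by simp [hζ]
  have hc0 : c 0 = 1 := by simp [hc]
  have hct : c t = Complex.exp (-∫ s in (0 : ℝ)..t, symbol Q Lm (expAdj B s ξ)) := by
    have := intervalIntegral.integral_comp_sub_left (a := (0 : ℝ)) (b := t)
      (fun s => symbol Q Lm (expAdj B s ξ)) (t : ℝ)
    rw [sub_self, sub_zero] at this
    simp only [hc, hζ]
    rw [this]
  have hx0 : act (P 0) (character (expAdj B t ξ)) x = character (expAdj B t ξ) x := by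
    rw [act, hF.zero, Kernel.id_apply]
    exact integral_dirac _ _
  rw [hζt, hζ0, hc0, hct, Real.toNNReal_coe, Real.toNNReal_zero, hx0, one_mul] at hkey'
  have hcf : charFun (P t x) ξ = act (P t) (character ξ) x := rfl
  rw [hcf, ← hkey', mul_right_comm, ← Complex.exp_add]
  simp

end Identification
end LevyOU

namespace LevyOU

variable {d : ℕ}

/-! ### The Mehler representation -/

lemma exp_mul_exp_of_add_eq_zero {E : Type*} [NormedAddCommGroup E] [NormedSpace ℝ E]
    [CompleteSpace E] {a b : E →L[ℝ] E} (h : a + b = 0) :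
    NormedSpace.exp a * NormedSpace.exp b = 1 := by
  have hc : Commute a b := by
    rw [eq_neg_of_add_eq_zero_right h]
    exact (Commute.refl a).neg_right
  let +nondep : NormedAlgebra ℚ (E →L[ℝ] E) := .restrictScalars ℚ ℝ _
  rw [← NormedSpace.exp_add_of_commute hc, h, NormedSpace.exp_zero]

/-- The linear flow `e^{tB}` as an invertible continuous linear map. -/
noncomputable def flow (B : Matrix (Fin d) (Fin d) ℝ) (t : ℝ) : Rd d ≃L[ℝ] Rd d :=
  ContinuousLinearEquiv.equivOfInverse
    (NormedSpace.exp (t • Matrix.toEuclideanCLM (𝕜 := ℝ) B))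
    (NormedSpace.exp (-(t • Matrix.toEuclideanCLM (𝕜 := ℝ) B)))
    (fun v => DFunLike.congr_fun (exp_mul_exp_of_add_eq_zero (neg_add_cancel _)) v)
    (fun v => DFunLike.congr_fun (exp_mul_exp_of_add_eq_zero (add_neg_cancel _)) v)

lemma flow_apply (B : Matrix (Fin d) (Fin d) ℝ) (t : ℝ) (v : Rd d) :
    flow B t v = NormedSpace.exp (t • Matrix.toEuclideanCLM (𝕜 := ℝ) B) v := rfl

lemma exists_norm_flow_apply_le (B : Matrix (Fin d) (Fin d) ℝ) :
    ∃ a : ℝ, 1 ≤ a ∧ ∀ t : ℝ, 0 ≤ t → t ≤ 1 → ∀ v, ‖flow B t v‖ ≤ a * ‖v‖ := by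
  obtain ⟨a, ha⟩ := (isCompact_Icc (a := (0 : ℝ)) (b := 1)).exists_bound_of_continuousOn
    (continuous_exp_smul (Matrix.toEuclideanCLM (𝕜 := ℝ) B)).continuousOn
  refine ⟨max a 1, le_max_right _ _, fun t h0 h1 v => ?_⟩
  rw [flow_apply]
  refine (ContinuousLinearMap.le_opNorm _ _).trans ?_
  gcongr
  exact (ha t ⟨h0, h1⟩).trans (le_max_left _ _)

/-- The law at time `t` of the process started at `x` is that of `e^{tB} x + S_t ζ + y`, where `ζ`
is a standard Gaussian vector, `y` is independent of `ζ`, and `S_t S_t^* = Q_t`. -/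
theorem exists_mehler {Q B : Matrix (Fin d) (Fin d) ℝ} {Lm : Measure (Rd d)}
    {P : ℝ≥0 → Kernel (Rd d) (Rd d)} (hP : IsLevyOUSemigroup Q B Lm P)
    (hQ : Q.PosSemidef) (hLm : IsLevyMeasure Lm)
    (hQt : ∀ t : ℝ, 0 < t → 0 < (Qt Q B t).det) :
    ∃ S : ℝ → Rd d ≃L[ℝ] Rd d,
      (∀ t : ℝ≥0, 0 < t → ∃ η : Measure (Rd d), IsProbabilityMeasure η ∧
        ∀ x, P t x = ((stdGaussian (Rd d)).prod η).map fun z => flow B t x + (S t z.1 + z.2)) ∧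
      ∃ C, 0 < C ∧ ∀ t : ℝ, 0 < t → t ≤ 1 → ∀ v,
        ‖(S t).symm v‖ ≤ C / t ^ ((1 : ℝ) / 2 + kalmanIndex Q B) * ‖v‖ := by
  obtain ⟨S, hS, hC⟩ := exists_sqrt_Qt hQ hQt
  refine ⟨S, fun t ht => ?_, hC⟩
  obtain ⟨η, hη, hηc⟩ := exists_jumpLaw B hLm (NNReal.coe_nonneg t)
  refine ⟨η, hη, fun x => ?_⟩
  have := hP.markov t
  have hSm : AEMeasurable (S t) (stdGaussian (Rd d)) := (S t).continuous.measurable.aemeasurable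
  have : IsProbabilityMeasure ((stdGaussian (Rd d)).map (S t)) :=
    Measure.isProbabilityMeasure_map hSm
  have hmap : ((stdGaussian (Rd d)).prod η).map (fun z => flow B t x + (S t z.1 + z.2)) =
      (((stdGaussian (Rd d)).map (S t)) ∗ η).map (flow B t x + ·) := by
    have e : (((stdGaussian (Rd d)).map (S t)).prod η) =
        ((stdGaussian (Rd d)).prod η).map (Prod.map (S t) id) := by
      rw [← Measure.map_prod_map _ _ (S t).continuous.measurable measurable_id, Measure.map_id]
    rw [Measure.conv, e, Measure.map_map (by fun_prop) (by fun_prop),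
      Measure.map_map (by fun_prop) (by fun_prop)]
    rfl
  rw [hmap]
  have : IsProbabilityMeasure ((((stdGaussian (Rd d)).map (S t)) ∗ η).map (flow B t x + ·)) :=
    Measure.isProbabilityMeasure_map (by fun_prop)
  refine Measure.ext_of_charFun (funext fun ξ => ?_)
  rw [charFun_map_const_add, charFun_conv, hS t (by exact_mod_cast ht), hηc, flow_apply,
    inner_exp_smul, charFun_transition hP hLm, character, mul_comm, ← Complex.exp_add]
  have hc := (continuous_expAdj_apply B).comp (g := fun p : ℝ × Rd d => expAdj B p.1 p.2)
    (f := fun s : ℝ => (s, ξ)) (by fun_prop)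
  have hc : Continuous fun s : ℝ => expAdj B s ξ := hc
  have h1 : Continuous fun s : ℝ => inner ℝ (expAdj B s ξ)
      (Matrix.toEuclideanCLM (𝕜 := ℝ) Q (expAdj B s ξ)) := by fun_prop
  have h2 : Continuous fun s : ℝ => levySymbol Lm (expAdj B s ξ) :=
    (continuous_levySymbol (integrable_min_one_sq hLm)).comp hc
  have h3 : Continuous fun s : ℝ => (-(inner ℝ (expAdj B s ξ)
      (Matrix.toEuclideanCLM (𝕜 := ℝ) Q (expAdj B s ξ)) : ℝ) / 2 : ℂ) :=
    (Complex.continuous_ofReal.comp h1).neg.div_const 2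
  simp only [symbol]
  rw [intervalIntegral.integral_add (h3.intervalIntegrable _ _) (h2.intervalIntegrable _ _),
    ← intervalIntegral.integral_ofReal, intervalIntegral.integral_div,
    intervalIntegral.integral_neg, Complex.exp_add, Complex.exp_add]

end LevyOU

namespace LevyOU

/-! ### Averages of smooth functions -/

section Smooth

variable {E F G : Type*} [NormedAddCommGroup E] [NormedSpace ℝ E]
  [NormedAddCommGroup F] [NormedSpace ℝ F] [NormedAddCommGroup G] [NormedSpace ℝ G]

/-- A smooth function which is bounded together with each of its derivatives. -/
structure IsSmoothBounded (u : E → F) : Prop where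
  contDiff : ContDiff ℝ ∞ u
  bounded : ∀ n : ℕ, ∃ C : ℝ, ∀ x, ‖iteratedFDeriv ℝ n u x‖ ≤ C

namespace IsSmoothBounded

variable {u : E → F}

lemma exists_norm_le (h : IsSmoothBounded u) : ∃ C : ℝ, ∀ x, ‖u x‖ ≤ C := by
  simpa using h.bounded 0

lemma exists_norm_fderiv_le (h : IsSmoothBounded u) : ∃ C : ℝ, ∀ x, ‖fderiv ℝ u x‖ ≤ C := by
  simpa [norm_iteratedFDeriv_one] using h.bounded 1

lemma differentiable (h : IsSmoothBounded u) : Differentiable ℝ u :=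
  h.contDiff.differentiable (by simp)

lemma continuous_fderiv (h : IsSmoothBounded u) : Continuous (fderiv ℝ u) :=
  h.contDiff.continuous_fderiv (by simp)

lemma fderiv_apply (h : IsSmoothBounded u) (v : E) : IsSmoothBounded fun x => fderiv ℝ u x v := by
  have hc : ContDiff ℝ ∞ (fderiv ℝ u) := h.contDiff.fderiv_right (by simp)
  refine ⟨hc.clm_apply contDiff_const, fun n => ?_⟩
  obtain ⟨C, hC⟩ := h.bounded (n + 1)
  refine ⟨‖v‖ * C, fun x => ?_⟩
  refine (norm_iteratedFDeriv_clm_apply_const hc.contDiffAt (by exact_mod_cast le_top)).trans ?_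
  rw [norm_iteratedFDeriv_fderiv]
  exact mul_le_mul_of_nonneg_left (hC x) (norm_nonneg v)

lemma comp_clm (h : IsSmoothBounded u) (A : G →L[ℝ] E) : IsSmoothBounded (u ∘ A) := by
  refine ⟨h.contDiff.comp A.contDiff, fun n => ?_⟩
  obtain ⟨C, hC⟩ := h.bounded n
  refine ⟨C * ∏ _i : Fin n, ‖A‖, fun x => ?_⟩
  rw [A.iteratedFDeriv_comp_right h.contDiff x (by exact_mod_cast le_top)]
  refine (ContinuousMultilinearMap.norm_compContinuousLinearMap_le _ _).trans ?_
  gcongr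
  exact hC _

end IsSmoothBounded

lemma isSmoothBounded_of_hasCompactSupport {u : E → F} (hu : ContDiff ℝ ∞ u)
    (hc : HasCompactSupport u) : IsSmoothBounded u :=
  ⟨hu, fun n => (hc.iteratedFDeriv n).exists_bound_of_continuous
    (hu.continuous_iteratedFDeriv (by exact_mod_cast le_top))⟩

variable [MeasurableSpace E] [BorelSpace E] [SecondCountableTopology E]

lemma hasFDerivAt_integral_comp_add {u : E → F} (ν : Measure E) [IsFiniteMeasure ν]
    (hu : Differentiable ℝ u) (hu' : Continuous (fderiv ℝ u)) {C C' : ℝ} (hC : ∀ x, ‖u x‖ ≤ C)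
    (hC' : ∀ x, ‖fderiv ℝ u x‖ ≤ C') (x : E) :
    HasFDerivAt (fun x => ∫ w, u (x + w) ∂ν) (∫ w, fderiv ℝ u (x + w) ∂ν) x := by
  have hm : ∀ x, AEStronglyMeasurable (fun w => u (x + w)) ν := fun x =>
    (hu.continuous.comp (continuous_const.add continuous_id)).aestronglyMeasurable
  refine hasFDerivAt_integral_of_dominated_of_fderiv_le (F := fun x w => u (x + w))
    (F' := fun x w => fderiv ℝ u (x + w)) (bound := fun _ => C') univ_mem
    (Eventually.of_forall hm) ?_ ?_ ?_ (integrable_const _) ?_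
  · exact Integrable.of_bound (hm x) C (ae_of_all _ fun w => hC _)
  · exact (hu'.comp (continuous_const.add continuous_id)).aestronglyMeasurable
  · exact ae_of_all _ fun w x _ => hC' _
  · exact ae_of_all _ fun w x _ => (hasFDerivAt_comp_add_right w).2 (hu (x + w)).hasFDerivAt

theorem IsSmoothBounded.hasFTaylorSeriesUpTo_integral {u : E → F} (h : IsSmoothBounded u)
    (ν : Measure E) [IsFiniteMeasure ν] :
    HasFTaylorSeriesUpTo ∞ (fun x => ∫ w, u (x + w) ∂ν)
      (fun x n => ∫ w, iteratedFDeriv ℝ n u (x + w) ∂ν) := by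
  have key : ∀ (m : ℕ) (x : E), HasFDerivAt (fun y => ∫ w, iteratedFDeriv ℝ m u (y + w) ∂ν)
      (∫ w, fderiv ℝ (iteratedFDeriv ℝ m u) (x + w) ∂ν) x := by
    intro m x
    obtain ⟨C, hC⟩ := h.bounded m
    obtain ⟨C', hC'⟩ := h.bounded (m + 1)
    refine hasFDerivAt_integral_comp_add ν
      (h.contDiff.differentiable_iteratedFDeriv (by exact_mod_cast ENat.natCast_lt_top m)) ?_ hC
      (fun y => by rw [norm_fderiv_iteratedFDeriv]; exact hC' y) x
    rw [fderiv_iteratedFDeriv]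
    exact (LinearIsometryEquiv.continuous _).comp
      (h.contDiff.continuous_iteratedFDeriv (by exact_mod_cast le_top))
  refine ⟨fun x => ?_, fun m _ x => ?_, fun m _ => ?_⟩
  · have h1 := (continuousMultilinearCurryFin0 ℝ E F).toContinuousLinearEquiv.integral_comp_comm
      (μ := ν) (fun w => iteratedFDeriv ℝ 0 u (x + w))
    exact h1.symm
  · refine (key m x).congr_fderiv ?_
    have h1 := ContinuousLinearEquiv.integral_comp_comm (μ := ν) (𝕜 := ℝ)
      (E := ContinuousMultilinearMap ℝ (fun _ : Fin (m + 1) => E) F)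
      (F := E →L[ℝ] ContinuousMultilinearMap ℝ (fun _ : Fin m => E) F)
      ((continuousMultilinearCurryLeftEquiv ℝ (fun _ : Fin (m + 1) => E)
        F).toContinuousLinearEquiv :) (fun w => iteratedFDeriv ℝ (m + 1) u (x + w))
    exact h1
  · exact continuous_iff_continuousAt.2 fun x => (key m x).continuousAt

theorem IsSmoothBounded.integral_comp_add {u : E → F} (h : IsSmoothBounded u)
    (ν : Measure E) [IsProbabilityMeasure ν] :
    IsSmoothBounded fun x => ∫ w, u (x + w) ∂ν := by
  have hT := h.hasFTaylorSeriesUpTo_integral ν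
  refine ⟨hT.contDiff, fun n => ?_⟩
  obtain ⟨C, hC⟩ := h.bounded n
  refine ⟨C, fun x => ?_⟩
  rw [← hT.eq_iteratedFDeriv (by exact_mod_cast le_top)]
  simpa using norm_integral_le_of_norm_le_const (μ := ν) (ae_of_all _ fun w => hC (x + w))

lemma IsSmoothBounded.fderiv_integral_comp_add {u : E → F} (h : IsSmoothBounded u)
    (ν : Measure E) [IsProbabilityMeasure ν] (x v : E) [CompleteSpace F] :
    fderiv ℝ (fun x => ∫ w, u (x + w) ∂ν) x v = ∫ w, fderiv ℝ u (x + w) v ∂ν := by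
  obtain ⟨C, hC⟩ := h.exists_norm_le
  obtain ⟨C', hC'⟩ := h.exists_norm_fderiv_le
  have hm : Continuous fun w => fderiv ℝ u (x + w) :=
    h.continuous_fderiv.comp (continuous_const.add continuous_id)
  rw [(hasFDerivAt_integral_comp_add ν h.differentiable h.continuous_fderiv hC hC' x).fderiv,
    ContinuousLinearMap.integral_apply]
  exact Integrable.of_bound hm.aestronglyMeasurable C' (ae_of_all _ fun w => hC' _)

end Smooth

section Vanishing

variable {d : ℕ}

lemma exists_norm_le_of_tendsto_cocompact {G : Type*} [NormedAddCommGroup G] {f : Rd d → G}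
    (hf : Continuous f) (h : Tendsto f (cocompact (Rd d)) (𝓝 0)) : ∃ C : ℝ, ∀ x, ‖f x‖ ≤ C := by
  have h1 : ∀ᶠ x in cocompact (Rd d), ‖f x‖ < 1 := by
    have := h.norm
    rw [norm_zero] at this
    exact this.eventually_lt_const one_pos
  obtain ⟨K, hK, hKs⟩ := mem_cocompact.1 h1
  obtain ⟨C, hC⟩ := hK.exists_bound_of_continuousOn hf.continuousOn
  refine ⟨max C 1, fun x => ?_⟩
  by_cases hx : x ∈ K
  · exact (hC x hx).trans (le_max_left _ _)
  · exact (hKs hx).le.trans (le_max_right _ _)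

lemma IsSmoothVanishing.isSmoothBounded {ρ : Rd d → ℝ} (h : IsSmoothVanishing ρ) :
    IsSmoothBounded ρ :=
  ⟨h.1, fun n => exists_norm_le_of_tendsto_cocompact
    (h.1.continuous_iteratedFDeriv (by exact_mod_cast le_top)) (h.2 n)⟩

instance isCountablyGenerated_cocompact : (cocompact (Rd d)).IsCountablyGenerated := by
  rw [← Metric.cobounded_eq_cocompact, ← comap_norm_atTop]
  infer_instance

theorem IsSmoothVanishing.integral_comp_add {ρ : Rd d → ℝ} (h : IsSmoothVanishing ρ)
    (ν : Measure (Rd d)) [IsProbabilityMeasure ν] :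
    IsSmoothVanishing fun x => ∫ w, ρ (x + w) ∂ν := by
  have hb := h.isSmoothBounded
  refine ⟨(hb.integral_comp_add ν).contDiff, fun n => ?_⟩
  obtain ⟨C, hC⟩ := hb.bounded n
  have e : iteratedFDeriv ℝ n (fun x => ∫ w, ρ (x + w) ∂ν) =
      fun x => ∫ w, iteratedFDeriv ℝ n ρ (x + w) ∂ν := funext fun x =>
    ((hb.hasFTaylorSeriesUpTo_integral ν).eq_iteratedFDeriv (by exact_mod_cast le_top) x).symm
  rw [e, ← integral_zero (Rd d) (ContinuousMultilinearMap ℝ (fun _ : Fin n => Rd d) ℝ) (μ := ν)]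
  refine tendsto_integral_filter_of_dominated_convergence (fun _ => C)
    (Eventually.of_forall fun x => ?_) (Eventually.of_forall fun x => ae_of_all _ fun w => hC _)
    (integrable_const _) (ae_of_all _ fun w => ?_)
  · exact ((h.1.continuous_iteratedFDeriv (by exact_mod_cast le_top)).comp
      (continuous_const.add continuous_id)).aestronglyMeasurable
  · exact (h.2 n).comp (Homeomorph.addRight w).isClosedEmbedding.tendsto_cocompact

lemma IsSmoothVanishing.comp_equiv {ρ : Rd d → ℝ} (h : IsSmoothVanishing ρ)
    (A : Rd d ≃L[ℝ] Rd d) : IsSmoothVanishing (ρ ∘ A) := by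
  refine ⟨h.1.comp A.contDiff, fun n => ?_⟩
  have h1 := (h.2 n).comp A.toHomeomorph.isClosedEmbedding.tendsto_cocompact
  refine squeeze_zero_norm (a := fun x => ‖iteratedFDeriv ℝ n ρ (A x)‖ *
    ∏ _i : Fin n, ‖(A : Rd d →L[ℝ] Rd d)‖) (fun x => ?_) ?_
  · have := (A : Rd d →L[ℝ] Rd d).iteratedFDeriv_comp_right h.1 x (i := n)
      (by exact_mod_cast le_top)
    change ‖iteratedFDeriv ℝ n (ρ ∘ (A : Rd d →L[ℝ] Rd d)) x‖ ≤ _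
    rw [this]
    exact ContinuousMultilinearMap.norm_compContinuousLinearMap_le _ _
  · simpa using h1.norm.mul_const (∏ _i : Fin n, ‖(A : Rd d →L[ℝ] Rd d)‖)

lemma IsSmoothVanishing.const_mul {ρ : Rd d → ℝ} (h : IsSmoothVanishing ρ) (c : ℝ) :
    IsSmoothVanishing fun x => c * ρ x := by
  refine ⟨contDiff_const.mul h.1, fun n => ?_⟩
  have e : iteratedFDeriv ℝ n (fun x => c * ρ x) = fun x => c • iteratedFDeriv ℝ n ρ x :=
    funext fun x => iteratedFDeriv_const_smul_apply' (a := c)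
      (h.1.of_le (by exact_mod_cast le_top)).contDiffAt
  rw [e]
  simpa using (h.2 n).const_smul c

/-- By the Faà di Bruno formula, each derivative of the Gaussian is bounded by the Gaussian times a
power of `1 + |x|`. -/
lemma isSmoothVanishing_exp_neg_sq : IsSmoothVanishing fun x : Rd d => Real.exp (-‖x‖ ^ 2 / 2) := by
  have hq : Function.HasTemperateGrowth fun x : Rd d => -‖x‖ ^ 2 / 2 := by
    have : Function.HasTemperateGrowth fun x : Rd d => ‖x‖ ^ 2 := by fun_prop
    have h2 := this.neg.mul (Function.HasTemperateGrowth.const (1 / 2 : ℝ))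
    refine (funext fun x => ?_ : (fun x : Rd d => -‖x‖ ^ 2 / 2) = _) ▸ h2
    simp; ring
  refine ⟨Real.contDiff_exp.comp hq.1, fun n => ?_⟩
  obtain ⟨k, C, hC0, hC⟩ := hq.norm_iteratedFDeriv_le_uniform n
  have hb : ∀ x : Rd d, ‖iteratedFDeriv ℝ n (fun x : Rd d => Real.exp (-‖x‖ ^ 2 / 2)) x‖ ≤
      n.factorial * Real.exp (-‖x‖ ^ 2 / 2) * ((1 + C) * (1 + ‖x‖) ^ k) ^ n := by
    intro x
    have h1 : (1 : ℝ) ≤ (1 + ‖x‖) ^ k := one_le_pow₀ (by linarith [norm_nonneg x])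
    refine norm_iteratedFDeriv_comp_le (g := Real.exp) Real.contDiff_exp hq.1
      (by exact_mod_cast le_top) x (fun i _ => ?_) (fun i hi hin => ?_)
    · rw [norm_iteratedFDeriv_eq_norm_iteratedDeriv, iteratedDeriv_eq_iterate,
        Real.iter_deriv_exp, Real.norm_of_nonneg (Real.exp_pos _).le]
    · refine (hC i hin x).trans ?_
      refine le_trans ?_ (le_self_pow₀ (by nlinarith) (by omega))
      nlinarith
  refine squeeze_zero_norm hb ?_
  have h1 : Tendsto (fun r : ℝ => n.factorial * Real.exp (-r ^ 2 / 2) *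
      ((1 + C) * (1 + r) ^ k) ^ n) atTop (𝓝 0) := by
    have h2 : Tendsto (fun r : ℝ => n.factorial * (1 + C) ^ n * Real.exp 1 *
        ((r + 1) ^ (k * n) * Real.exp (-(r + 1)))) atTop (𝓝 0) := by
      have := ((Real.tendsto_pow_mul_exp_neg_atTop_nhds_zero (k * n)).comp
        (tendsto_atTop_add_const_right atTop (1 : ℝ) tendsto_id)).const_mul
        (n.factorial * (1 + C) ^ n * Real.exp 1)
      simpa using this
    refine squeeze_zero' ?_ ?_ h2
    · filter_upwards [eventually_ge_atTop 0] with r hr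
      positivity
    · filter_upwards [eventually_ge_atTop 2] with r hr
      have e1 : Real.exp (-r ^ 2 / 2) ≤ Real.exp 1 * Real.exp (-(r + 1)) := by
        rw [← Real.exp_add]
        exact Real.exp_le_exp.2 (by nlinarith)
      have e2 : (0 : ℝ) ≤ n.factorial * (1 + C) ^ n * (r + 1) ^ (k * n) := by positivity
      calc _ = n.factorial * (1 + C) ^ n * (r + 1) ^ (k * n) * Real.exp (-r ^ 2 / 2) := by
            rw [mul_pow, pow_mul, add_comm r 1]; ring
        _ ≤ _ := mul_le_mul_of_nonneg_left e1 e2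
        _ = _ := by ring
  exact h1.comp (by rw [← Metric.cobounded_eq_cocompact]; exact tendsto_norm_cobounded_atTop)

end Vanishing

end LevyOU

namespace LevyOU

variable {d : ℕ}

/-! ### The density of a nondegenerate Gaussian vector plus an independent vector -/

lemma integrable_exp_neg_sq_mul_character (ξ : Rd d) :
    Integrable fun x : Rd d => (Real.exp (-‖x‖ ^ 2 / 2) : ℂ) * character ξ x := by
  have h := GaussianFourier.integrable_cexp_neg_mul_sq_norm_add (b := 1 / 2) (by norm_num)
    Complex.I ξ
  refine h.congr (ae_of_all _ fun x => ?_)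
  simp only [character]
  rw [Complex.ofReal_exp, ← Complex.exp_add, real_inner_comm]
  push_cast
  ring_nf

lemma integral_exp_neg_sq_mul_character (ξ : Rd d) :
    ∫ x : Rd d, (Real.exp (-‖x‖ ^ 2 / 2) : ℂ) * character ξ x =
      (Real.pi / (1 / 2 : ℂ)) ^ (Module.finrank ℝ (Rd d) / 2 : ℂ) *
        Complex.exp (-‖ξ‖ ^ 2 / 2) := by
  have h := GaussianFourier.integral_cexp_neg_mul_sq_norm_add (b := 1 / 2) (by norm_num)
    Complex.I ξ
  rw [Complex.I_sq] at h
  refine (integral_congr_ae (ae_of_all _ fun x => ?_)).trans (h.trans ?_)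
  · simp only [character]
    rw [Complex.ofReal_exp, ← Complex.exp_add, real_inner_comm]
    push_cast
    ring_nf
  · congr 2
    ring

lemma integrable_exp_neg_sq : Integrable fun x : Rd d => Real.exp (-‖x‖ ^ 2 / 2) := by
  have := (integrable_exp_neg_sq_mul_character (0 : Rd d)).re
  simpa [character, ← Complex.ofReal_exp] using this

/-- The density of the standard Gaussian law. -/
noncomputable def gaussianDensity (x : Rd d) : ℝ :=
  (∫ y : Rd d, Real.exp (-‖y‖ ^ 2 / 2))⁻¹ * Real.exp (-‖x‖ ^ 2 / 2)

lemma ofReal_integral_exp_neg_sq :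
    ((∫ y : Rd d, Real.exp (-‖y‖ ^ 2 / 2) : ℝ) : ℂ) =
      (Real.pi / (1 / 2 : ℂ)) ^ (Module.finrank ℝ (Rd d) / 2 : ℂ) := by
  have h := integral_exp_neg_sq_mul_character (0 : Rd d)
  refine Eq.trans ?_ (h.trans ?_)
  · rw [← integral_complex_ofReal]
    simp [character]
  · simp

lemma integral_exp_neg_sq_pos : 0 < ∫ y : Rd d, Real.exp (-‖y‖ ^ 2 / 2) := by
  refine lt_of_le_of_ne (integral_nonneg fun _ => (Real.exp_pos _).le) fun h => ?_
  have h1 := ofReal_integral_exp_neg_sq (d := d)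
  rw [← h, Complex.ofReal_zero, eq_comm, Complex.cpow_eq_zero_iff] at h1
  exact (by simp : (Real.pi / (1 / 2 : ℂ)) ≠ 0) h1.1

lemma gaussianDensity_pos (x : Rd d) : 0 < gaussianDensity x :=
  mul_pos (inv_pos.2 integral_exp_neg_sq_pos) (Real.exp_pos _)

lemma isSmoothVanishing_gaussianDensity : IsSmoothVanishing (gaussianDensity (d := d)) :=
  isSmoothVanishing_exp_neg_sq.const_mul _

lemma measurable_gaussianDensity : Measurable (gaussianDensity (d := d)) :=
  isSmoothVanishing_gaussianDensity.1.continuous.measurable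

lemma integrable_gaussianDensity : Integrable (gaussianDensity (d := d)) :=
  integrable_exp_neg_sq.const_mul _

theorem stdGaussian_eq_withDensity :
    stdGaussian (Rd d) = volume.withDensity fun x => ENNReal.ofReal (gaussianDensity x) := by
  have : IsFiniteMeasure (volume.withDensity fun x : Rd d => ENNReal.ofReal (gaussianDensity x)) :=
    isFiniteMeasure_withDensity_ofReal integrable_gaussianDensity.2
  refine Measure.ext_of_charFun (funext fun ξ => ?_)
  rw [charFun_stdGaussian, charFun_apply, integral_withDensity_eq_integral_toReal_smul
    measurable_gaussianDensity.ennreal_ofReal (ae_of_all _ fun _ => ENNReal.ofReal_lt_top)]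
  have h1 : ∀ x : Rd d, (ENNReal.ofReal (gaussianDensity x)).toReal •
      Complex.exp ((inner ℝ x ξ : ℝ) * Complex.I) =
      ((∫ y : Rd d, Real.exp (-‖y‖ ^ 2 / 2) : ℝ) : ℂ)⁻¹ *
        ((Real.exp (-‖x‖ ^ 2 / 2) : ℂ) * character ξ x) := by
    intro x
    rw [ENNReal.toReal_ofReal (gaussianDensity_pos x).le, gaussianDensity, Complex.real_smul,
      character]
    push_cast
    ring
  simp_rw [h1]
  rw [integral_const_mul, integral_exp_neg_sq_mul_character, ← ofReal_integral_exp_neg_sq,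
    ← mul_assoc, inv_mul_cancel₀ (by exact_mod_cast integral_exp_neg_sq_pos.ne'), one_mul]

/-- The law of `S ζ + y` with `ζ` standard Gaussian, `S` invertible and `y` independent of `ζ` has a
positive density in `C_0^∞`, because it is an average of translates of a Gaussian density. -/
theorem exists_density (S : Rd d ≃L[ℝ] Rd d) (m : Measure (Rd d)) [IsProbabilityMeasure m] :
    ∃ ρ : Rd d → ℝ, IsSmoothVanishing ρ ∧ (∀ x, 0 < ρ x) ∧
      ((stdGaussian (Rd d)).prod m).map (fun z => S z.1 + z.2) =
        volume.withDensity fun x => ENNReal.ofReal (ρ x) := by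
  obtain ⟨D, hD0, hD⟩ : ∃ D : ℝ≥0, 0 < D ∧
      (volume : Measure (Rd d)).map S = (D : ℝ≥0∞) • volume := by
    have := S.isAddHaarMeasure_map (volume : Measure (Rd d))
    have h := Measure.isAddLeftInvariant_eq_smul ((volume : Measure (Rd d)).map S) volume
    exact ⟨_, Measure.addHaarScalarFactor_pos_of_isAddHaarMeasure _ _, h⟩
  set g : Rd d → ℝ := fun x => D * gaussianDensity (S.symm x) with hg
  have hgv : IsSmoothVanishing g :=
    (isSmoothVanishing_gaussianDensity.comp_equiv S.symm).const_mul _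
  have hgpos : ∀ x, 0 < g x := fun x => mul_pos (by exact_mod_cast hD0) (gaussianDensity_pos _)
  have hgc : Continuous g := hgv.1.continuous
  obtain ⟨C, hC⟩ := hgv.isSmoothBounded.exists_norm_le
  have hint : ∀ x, Integrable (fun w => g (x - w)) m := fun x =>
    Integrable.of_bound (by fun_prop) C (ae_of_all _ fun w => hC _)
  have hneg : ∀ x, ∫ w, g (x + w) ∂(m.map Neg.neg) = ∫ w, g (x - w) ∂m := by
    intro x
    rw [integral_map (by fun_prop) (by fun_prop)]
    simp [sub_eq_add_neg]
  have : IsProbabilityMeasure (m.map Neg.neg) := Measure.isProbabilityMeasure_map (by fun_prop)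
  refine ⟨fun x => ∫ w, g (x + w) ∂(m.map Neg.neg), hgv.integral_comp_add _, fun x => ?_, ?_⟩
  · beta_reduce
    rw [hneg, integral_pos_iff_support_of_nonneg (fun w => (hgpos _).le) (hint x)]
    have : Function.support (fun w => g (x - w)) = Set.univ :=
      Set.eq_univ_of_forall fun w => (hgpos _).ne'
    rw [this, measure_univ]
    exact one_pos
  · simp_rw [hneg]
    refine Measure.ext_of_lintegral _ fun F hF => ?_
    have hm : Measurable fun z : Rd d × Rd d => S z.1 + z.2 := by fun_prop
    have hinner : ∀ w, ∫⁻ ζ, F (S ζ + w) ∂(stdGaussian (Rd d)) =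
        ∫⁻ x, ENNReal.ofReal (g (x - w)) * F x := by
      intro w
      have hK : Measurable fun x => ENNReal.ofReal (gaussianDensity (S.symm x)) * F (x + w) :=
        (measurable_gaussianDensity.comp S.symm.continuous.measurable).ennreal_ofReal.mul
          (hF.comp (measurable_add_const w))
      rw [stdGaussian_eq_withDensity, lintegral_withDensity_eq_lintegral_mul _
        measurable_gaussianDensity.ennreal_ofReal
        (show Measurable fun ζ => F (S ζ + w) from hF.comp (by fun_prop))]
      calc _ = ∫⁻ ζ : Rd d, ENNReal.ofReal (gaussianDensity (S.symm (S ζ))) * F (S ζ + w) := by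
            simp
        _ = ∫⁻ x, ENNReal.ofReal (gaussianDensity (S.symm x)) * F (x + w)
              ∂((volume : Measure (Rd d)).map S) :=
            (lintegral_map hK S.continuous.measurable).symm
        _ = ∫⁻ x, ENNReal.ofReal (g x) * F (x + w) := by
            rw [hD, lintegral_smul_measure, smul_eq_mul, ← lintegral_const_mul _ hK]
            refine lintegral_congr fun x => ?_
            change _ = ENNReal.ofReal (D * gaussianDensity (S.symm x)) * _
            rw [ENNReal.ofReal_mul D.coe_nonneg, ← mul_assoc, ENNReal.ofReal_coe_nnreal]
        _ = _ := by
            rw [← lintegral_sub_right_eq_self _ w]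
            simp
    rw [lintegral_map hF hm, lintegral_prod_symm' (fun z : Rd d × Rd d => F (S z.1 + z.2))
      (hF.comp hm)]
    simp_rw [hinner]
    have hm2 : Measurable fun p : Rd d × Rd d => ENNReal.ofReal (g (p.2 - p.1)) * F p.2 :=
      (Continuous.measurable (by fun_prop)).ennreal_ofReal.mul (hF.comp measurable_snd)
    have hm3 : Measurable fun x => ENNReal.ofReal (∫ w, g (x - w) ∂m) := by
      have : Continuous fun x => ∫ w, g (x - w) ∂m := by
        simp_rw [← hneg]
        exact (hgv.integral_comp_add (m.map Neg.neg)).1.continuous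
      exact this.measurable.ennreal_ofReal
    rw [lintegral_lintegral_swap hm2.aemeasurable, lintegral_withDensity_eq_lintegral_mul _ hm3 hF]
    refine lintegral_congr fun x => ?_
    rw [lintegral_mul_const _ (Continuous.measurable (by fun_prop)).ennreal_ofReal,
      Pi.mul_apply, ofReal_integral_eq_lintegral_ofReal (hint x) (ae_of_all _ fun w => (hgpos _).le)]

lemma integral_stdGaussian {G : Type*} [NormedAddCommGroup G] [NormedSpace ℝ G] (f : Rd d → G) :
    ∫ x, f x ∂(stdGaussian (Rd d)) = ∫ x, gaussianDensity x • f x := by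
  rw [stdGaussian_eq_withDensity, integral_withDensity_eq_integral_toReal_smul
    measurable_gaussianDensity.ennreal_ofReal (ae_of_all _ fun _ => ENNReal.ofReal_lt_top)]
  simp_rw [ENNReal.toReal_ofReal (gaussianDensity_pos _).le]

lemma integrable_stdGaussian_iff {G : Type*} [NormedAddCommGroup G] [NormedSpace ℝ G]
    {f : Rd d → G} : Integrable f (stdGaussian (Rd d)) ↔
      Integrable fun x => gaussianDensity x • f x := by
  rw [stdGaussian_eq_withDensity, integrable_withDensity_iff_integrable_smul'
    measurable_gaussianDensity.ennreal_ofReal (ae_of_all _ fun _ => ENNReal.ofReal_lt_top)]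
  simp_rw [ENNReal.toReal_ofReal (gaussianDensity_pos _).le]

/-- Gaussian integration by parts. -/
theorem integral_fderiv_stdGaussian {F : Rd d → ℂ} (hF : ContDiff ℝ 1 F) {C C' : ℝ}
    (hC : ∀ x, ‖F x‖ ≤ C) (hC' : ∀ x, ‖fderiv ℝ F x‖ ≤ C') (v : Rd d) :
    ∫ ζ, fderiv ℝ F ζ v ∂(stdGaussian (Rd d)) =
      ∫ ζ, ((inner ℝ v ζ : ℝ) : ℂ) * F ζ ∂(stdGaussian (Rd d)) := by
  have hder : ∀ ζ : Rd d, HasFDerivAt (gaussianDensity (d := d))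
      ((-gaussianDensity ζ) • (innerSL ℝ ζ)) ζ := by
    intro ζ
    have h1 : HasFDerivAt (fun x : Rd d => -‖x‖ ^ 2 / 2) (-(innerSL ℝ ζ)) ζ := by
      have := ((hasStrictFDerivAt_norm_sq ζ).hasFDerivAt.const_mul (-1 / 2 : ℝ))
      refine (this.congr_fderiv ?_).congr_of_eventuallyEq (Eventually.of_forall fun x => ?_)
      · ext w
        simp
        ring
      · simp; ring
    refine ((h1.exp.const_mul (∫ y : Rd d, Real.exp (-‖y‖ ^ 2 / 2))⁻¹)).congr_fderiv ?_
    ext w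
    simp [gaussianDensity]
    ring
  have hDF : Continuous fun ζ => fderiv ℝ F ζ v := by
    have := hF.continuous_fderiv one_ne_zero
    fun_prop
  have hbF : Integrable F (stdGaussian (Rd d)) :=
    Integrable.of_bound hF.continuous.aestronglyMeasurable C (ae_of_all _ hC)
  have hbDF : Integrable (fun ζ => fderiv ℝ F ζ v) (stdGaussian (Rd d)) :=
    Integrable.of_bound hDF.aestronglyMeasurable (C' * ‖v‖) (ae_of_all _ fun ζ =>
      ((fderiv ℝ F ζ).le_opNorm v).trans (mul_le_mul_of_nonneg_right (hC' ζ) (norm_nonneg v)))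
  have hbl : Integrable (fun ζ => ((inner ℝ v ζ : ℝ) : ℂ) * F ζ) (stdGaussian (Rd d)) := by
    have h1 : Integrable (fun ζ : Rd d => ((inner ℝ v ζ : ℝ) : ℂ)) (stdGaussian (Rd d)) :=
      (IsGaussian.integrable_dual _ (innerSL ℝ v)).ofReal
    exact h1.mul_bdd hF.continuous.aestronglyMeasurable (ae_of_all _ hC)
  have hneg : ∀ ζ, fderiv ℝ (gaussianDensity (d := d)) ζ v • F ζ =
      -(gaussianDensity ζ • (((inner ℝ v ζ : ℝ) : ℂ) * F ζ)) := by
    intro ζ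
    rw [(hder ζ).fderiv, real_inner_comm]
    simp only [_root_.smul_apply, innerSL_apply_apply, smul_eq_mul, Complex.real_smul]
    push_cast
    ring
  rw [integral_stdGaussian, integral_stdGaussian,
    integral_smul_fderiv_eq_neg_fderiv_smul_of_integrable]
  · simp_rw [hneg]
    rw [integral_neg, neg_neg]
  · simp_rw [hneg]
    exact (integrable_stdGaussian_iff.1 hbl).neg
  · exact integrable_stdGaussian_iff.1 hbDF
  · exact integrable_stdGaussian_iff.1 hbF
  · exact fun x _ => (hder x).differentiableAt
  · exact fun x _ => hF.differentiable one_ne_zero x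

end LevyOU

namespace LevyOU

variable {d : ℕ} {κ : Kernel (Rd d) (Rd d)} {A S : Rd d ≃L[ℝ] Rd d} {η μ : Measure (Rd d)}

/-! ### Transition densities and the invariant density -/

lemma measurable_mehler (A S : Rd d ≃L[ℝ] Rd d) :
    Measurable fun q : Rd d × Rd d × Rd d => A q.1 + (S q.2.1 + q.2.2) := by fun_prop

theorem exists_transition_density [IsProbabilityMeasure η]
    (hκ : ∀ x, κ x = ((stdGaussian (Rd d)).prod η).map fun z => A x + (S z.1 + z.2)) :
    ∃ pt : Rd d → Rd d → ℝ,
      ContDiff ℝ ∞ (fun z : Rd d × Rd d => pt z.1 z.2) ∧ (∀ x y, 0 ≤ pt x y) ∧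
      ∀ x, κ x = volume.withDensity (fun y => ENNReal.ofReal (pt x y)) := by
  obtain ⟨ρ, hρ, hpos, hlaw⟩ := exists_density S η
  refine ⟨fun x y => ρ (y - A x), hρ.1.comp (by fun_prop), fun x y => (hpos _).le, fun x => ?_⟩
  have hm : Measurable fun z : Rd d × Rd d => S z.1 + z.2 := by fun_prop
  have h1 : κ x = (((stdGaussian (Rd d)).prod η).map fun z => S z.1 + z.2).map (A x + ·) := by
    rw [hκ, Measure.map_map (by fun_prop) hm]
    rfl
  rw [h1, hlaw]
  have hρm : Measurable ρ := hρ.1.continuous.measurable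
  refine Measure.ext_of_lintegral _ fun F hF => ?_
  rw [lintegral_map hF (by fun_prop), lintegral_withDensity_eq_lintegral_mul _ hρm.ennreal_ofReal
      (show Measurable fun y => F (A x + y) from hF.comp (by fun_prop)),
    lintegral_withDensity_eq_lintegral_mul _
      (show Measurable fun y => ENNReal.ofReal (ρ (y - A x)) from
        (hρm.comp (by fun_prop)).ennreal_ofReal) hF,
    ← lintegral_sub_right_eq_self _ (A x)]
  simp

/-- Invariance of `μ`: if `X ∼ μ` is independent of the Gaussian vector `ζ` and of `y`, then
`A X + S ζ + y ∼ μ`. -/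
theorem measurePreserving_mehler [IsProbabilityMeasure η] [IsProbabilityMeasure μ]
    (hκ : ∀ x, κ x = ((stdGaussian (Rd d)).prod η).map fun z => A x + (S z.1 + z.2))
    (hμ : κ.Invariant μ) :
    MeasurePreserving (fun q : Rd d × Rd d × Rd d => A q.1 + (S q.2.1 + q.2.2))
      (μ.prod ((stdGaussian (Rd d)).prod η)) μ := by
  refine ⟨measurable_mehler A S, Measure.ext fun s hs => ?_⟩
  conv_rhs => rw [← hμ.def]
  rw [Measure.map_apply (measurable_mehler A S) hs,
    Measure.prod_apply (measurable_mehler A S hs), Measure.bind_apply hs κ.measurable.aemeasurable]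
  refine lintegral_congr fun x => ?_
  rw [hκ, Measure.map_apply (by fun_prop) hs]
  rfl

theorem exists_invariant_density [IsProbabilityMeasure η] [IsProbabilityMeasure μ]
    (hκ : ∀ x, κ x = ((stdGaussian (Rd d)).prod η).map fun z => A x + (S z.1 + z.2))
    (hμ : κ.Invariant μ) :
    ∃ ρ : Rd d → ℝ, IsSmoothVanishing ρ ∧ (∀ x, 0 < ρ x) ∧
      μ = volume.withDensity fun x => ENNReal.ofReal (ρ x) := by
  have hmA : Measurable fun q : Rd d × Rd d => A q.1 + q.2 := by fun_prop
  have : IsProbabilityMeasure ((μ.prod η).map fun q => A q.1 + q.2) :=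
    Measure.isProbabilityMeasure_map hmA.aemeasurable
  obtain ⟨ρ, hρ, hpos, hlaw⟩ := exists_density S ((μ.prod η).map fun q => A q.1 + q.2)
  refine ⟨ρ, hρ, hpos, hlaw ▸ ?_⟩
  refine Measure.ext_of_lintegral _ fun F hF => ?_
  conv_lhs => rw [← (measurePreserving_mehler hκ hμ).map_eq]
  have h3 : Measurable fun r : Rd d × Rd d × Rd d => F (S r.1 + (A r.2.1 + r.2.2)) :=
    hF.comp (by fun_prop)
  have h4 : Measurable fun r : Rd d × Rd d => F (S r.1 + r.2) := hF.comp (by fun_prop)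
  have h5 : Measurable fun q : Rd d × Rd d × Rd d => F (A q.1 + (S q.2.1 + q.2.2)) :=
    hF.comp (by fun_prop)
  rw [lintegral_map hF (measurable_mehler A S), lintegral_map hF (by fun_prop),
    lintegral_prod _ h4.aemeasurable, lintegral_prod _ h5.aemeasurable]
  have e1 : ∀ x, ∫⁻ z : Rd d × Rd d, F (A x + (S z.1 + z.2)) ∂((stdGaussian (Rd d)).prod η) =
      ∫⁻ ζ, ∫⁻ y, F (A x + (S ζ + y)) ∂η ∂(stdGaussian (Rd d)) := fun x =>
    lintegral_prod _ (show Measurable fun z : Rd d × Rd d => F (A x + (S z.1 + z.2)) from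
      hF.comp (by fun_prop)).aemeasurable
  have e2 : ∀ ζ, ∫⁻ w, F (S ζ + w) ∂((μ.prod η).map fun q => A q.1 + q.2) =
      ∫⁻ x, ∫⁻ y, F (A x + (S ζ + y)) ∂η ∂μ := fun ζ => by
    rw [lintegral_map (show Measurable fun w => F (S ζ + w) from hF.comp (by fun_prop)) hmA,
      lintegral_prod _ (show Measurable fun q : Rd d × Rd d => F (S ζ + (A q.1 + q.2)) from
      hF.comp (by fun_prop)).aemeasurable]
    simp_rw [add_left_comm]
  simp_rw [e1, e2]
  refine lintegral_lintegral_swap ?_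
  have h6 : Measurable fun r : (Rd d × Rd d) × Rd d => F (A r.1.1 + (S r.1.2 + r.2)) :=
    hF.comp (by fun_prop)
  exact h6.lintegral_prod_right'.aemeasurable

lemma volume_absolutelyContinuous {ρ : Rd d → ℝ} (hρ : Continuous ρ) (hpos : ∀ x, 0 < ρ x) :
    volume ≪ volume.withDensity fun x => ENNReal.ofReal (ρ x) :=
  withDensity_absolutelyContinuous' hρ.measurable.ennreal_ofReal.aemeasurable
    (ae_of_all _ fun x => by simpa using hpos x)

lemma exists_restrict_le_smul {ρ : Rd d → ℝ} (hρ : Continuous ρ) (hpos : ∀ x, 0 < ρ x)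
    {K : Set (Rd d)} (hK : IsCompact K) :
    ∃ C : ℝ≥0, volume.restrict K ≤ (C : ℝ≥0∞) • volume.withDensity fun x => ENNReal.ofReal (ρ x) := by
  obtain ⟨C, hC⟩ := hK.exists_bound_of_continuousOn (f := fun x => (ρ x)⁻¹)
    (hρ.inv₀ fun x => (hpos x).ne').continuousOn
  refine ⟨C.toNNReal, Measure.le_iff.2 fun s hs => ?_⟩
  have hm : Measurable fun x => ENNReal.ofReal (ρ x) := hρ.measurable.ennreal_ofReal
  rw [Measure.restrict_apply hs, Measure.smul_apply, withDensity_apply _ hs, smul_eq_mul,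
    ← lintegral_const_mul _ hm]
  calc volume (s ∩ K) = ∫⁻ x in s ∩ K, 1 := by simp
    _ ≤ ∫⁻ x in s ∩ K, C.toNNReal * ENNReal.ofReal (ρ x) := by
        refine setLIntegral_mono' (hs.inter hK.measurableSet) fun x hx => ?_
        have h1 := hC x hx.2
        rw [Real.norm_of_nonneg (inv_pos.2 (hpos x)).le] at h1
        rw [← ENNReal.ofReal, ← ENNReal.ofReal_mul ((inv_pos.2 (hpos x)).le.trans h1),
          ← ENNReal.ofReal_one]
        refine ENNReal.ofReal_le_ofReal ?_
        calc (1 : ℝ) = (ρ x)⁻¹ * ρ x := (inv_mul_cancel₀ (hpos x).ne').symm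
          _ ≤ _ := mul_le_mul_of_nonneg_right h1 (hpos x).le
    _ ≤ _ := lintegral_mono_set Set.inter_subset_left

/-! ### The semigroup on `L^p(μ)` -/

lemma act_eq_integral
    (hκ : ∀ x, κ x = ((stdGaussian (Rd d)).prod η).map fun z => A x + (S z.1 + z.2))
    {f : Rd d → ℂ} {x : Rd d} (hf : AEStronglyMeasurable f (κ x)) :
    act κ f x = ∫ z, f (A x + (S z.1 + z.2)) ∂((stdGaussian (Rd d)).prod η) := by
  rw [hκ x] at hf
  rw [act, hκ, integral_map (by fun_prop) hf]

/-- Hölder's inequality for the Gaussian weight together with the invariance of `μ`. -/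
theorem eLpNorm_integral_mul_le [IsProbabilityMeasure η] [IsProbabilityMeasure μ]
    (hκ : ∀ x, κ x = ((stdGaussian (Rd d)).prod η).map fun z => A x + (S z.1 + z.2))
    (hμ : κ.Invariant μ) {p q : ℝ≥0∞} [p.HolderConjugate q] (hp0 : p ≠ 0) (hp : p ≠ ⊤)
    {f : Rd d → ℂ}
    (hf : AEStronglyMeasurable f μ) {W : Rd d × Rd d → ℂ}
    (hW : AEStronglyMeasurable W ((stdGaussian (Rd d)).prod η)) :
    eLpNorm (fun x => ∫ z, W z * f (A x + (S z.1 + z.2)) ∂((stdGaussian (Rd d)).prod η)) p μ ≤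
      eLpNorm W q ((stdGaussian (Rd d)).prod η) * eLpNorm f p μ := by
  set lam := (stdGaussian (Rd d)).prod η
  have hΦ := measurePreserving_mehler hκ hμ
  have hfΦ : AEStronglyMeasurable (fun r : Rd d × Rd d × Rd d => f (A r.1 + (S r.2.1 + r.2.2)))
      (μ.prod lam) := hf.comp_measurePreserving hΦ
  have h1 : ∀ᵐ x ∂μ, ‖∫ z, W z * f (A x + (S z.1 + z.2)) ∂lam‖ₑ ≤
      eLpNorm W q lam * eLpNorm (fun z : Rd d × Rd d => f (A x + (S z.1 + z.2))) p lam := by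
    filter_upwards [hfΦ.prodMk_left] with x hx
    refine (enorm_integral_le_lintegral_enorm _).trans ?_
    rw [← eLpNorm_one_eq_lintegral_enorm]
    have : q.HolderTriple p 1 := ENNReal.HolderConjugate.symm
    have hx' : AEStronglyMeasurable (fun z : Rd d × Rd d => f (A x + (S z.1 + z.2))) lam := hx
    have h := eLpNorm_smul_le_mul_eLpNorm (p := q) (q := p) (r := 1) hx' hW
    exact h
  rw [eLpNorm_eq_lintegral_rpow_enorm_toReal hp0 hp]
  have hp' : 0 < p.toReal := ENNReal.toReal_pos hp0 hp
  have h2 : ∀ x, eLpNorm (fun z : Rd d × Rd d => f (A x + (S z.1 + z.2))) p lam ^ p.toReal =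
      ∫⁻ z, ‖f (A x + (S z.1 + z.2))‖ₑ ^ p.toReal ∂lam := fun x => by
    rw [eLpNorm_eq_lintegral_rpow_enorm_toReal hp0 hp, ← ENNReal.rpow_mul,
      one_div_mul_cancel hp'.ne', ENNReal.rpow_one]
  have h3 : ∫⁻ x, ∫⁻ z, ‖f (A x + (S z.1 + z.2))‖ₑ ^ p.toReal ∂lam ∂μ =
      ∫⁻ x, ‖f x‖ₑ ^ p.toReal ∂μ := by
    rw [← lintegral_prod (fun r : Rd d × Rd d × Rd d =>
      ‖f (A r.1 + (S r.2.1 + r.2.2))‖ₑ ^ p.toReal) (hfΦ.enorm.pow_const _)]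
    conv_rhs => rw [← hΦ.map_eq]
    rw [lintegral_map' _ hΦ.measurable.aemeasurable]
    rw [hΦ.map_eq]
    exact hf.enorm.pow_const _
  calc (∫⁻ x, ‖∫ z, W z * f (A x + (S z.1 + z.2)) ∂lam‖ₑ ^ p.toReal ∂μ) ^ (1 / p.toReal)
      ≤ (∫⁻ x, eLpNorm W q lam ^ p.toReal *
          ∫⁻ z, ‖f (A x + (S z.1 + z.2))‖ₑ ^ p.toReal ∂lam ∂μ) ^ (1 / p.toReal) := by
        refine ENNReal.rpow_le_rpow (lintegral_mono_ae ?_) (by positivity)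
        filter_upwards [h1] with x hx
        rw [← h2, ← ENNReal.mul_rpow_of_nonneg _ _ hp'.le]
        exact ENNReal.rpow_le_rpow hx hp'.le
    _ = _ := by
        rw [lintegral_const_mul'' _ (hfΦ.enorm.pow_const _).lintegral_prod_right', h3,
          ENNReal.mul_rpow_of_nonneg _ _ (by positivity), ← ENNReal.rpow_mul,
          mul_one_div_cancel hp'.ne', ENNReal.rpow_one,
          ← eLpNorm_eq_lintegral_rpow_enorm_toReal hp0 hp]

theorem eLpNorm_act_le [IsProbabilityMeasure η] [IsProbabilityMeasure μ]
    (hκ : ∀ x, κ x = ((stdGaussian (Rd d)).prod η).map fun z => A x + (S z.1 + z.2))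
    (hμ : κ.Invariant μ) (hac : ∀ x, κ x ≪ μ) {p q : ℝ≥0∞} [p.HolderConjugate q] (hp0 : p ≠ 0)
    (hp : p ≠ ⊤) {f : Rd d → ℂ} (hf : AEStronglyMeasurable f μ) :
    eLpNorm (act κ f) p μ ≤ eLpNorm f p μ := by
  have h := eLpNorm_integral_mul_le hκ hμ (q := q) hp0 hp hf (W := fun _ => 1) (by fun_prop)
  have hq : q ≠ 0 := ENNReal.HolderConjugate.ne_zero q p
  rw [eLpNorm_const _ hq (IsProbabilityMeasure.ne_zero _)] at h
  simp only [one_mul, enorm_one, measure_univ, ENNReal.one_rpow] at h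
  convert h using 2
  exact funext fun x => act_eq_integral hκ (hf.mono_ac (hac x))

lemma ae_integrable_act [IsProbabilityMeasure η] [IsProbabilityMeasure μ]
    (hκ : ∀ x, κ x = ((stdGaussian (Rd d)).prod η).map fun z => A x + (S z.1 + z.2))
    (hμ : κ.Invariant μ) (hac : ∀ x, κ x ≪ μ) {f : Rd d → ℂ} (hf : Integrable f μ) :
    ∀ᵐ x ∂μ, Integrable f (κ x) := by
  have h1 := ((measurePreserving_mehler hκ hμ).integrable_comp hf.1).2 hf
  filter_upwards [h1.prod_right_ae] with x hx
  have h2 := hf.1.mono_ac (hac x)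
  rw [hκ x] at h2 ⊢
  exact (integrable_map_measure h2 (by fun_prop)).2 hx

lemma aestronglyMeasurable_act [IsProbabilityMeasure η] [IsProbabilityMeasure μ]
    (hκ : ∀ x, κ x = ((stdGaussian (Rd d)).prod η).map fun z => A x + (S z.1 + z.2))
    (hμ : κ.Invariant μ) (hac : ∀ x, κ x ≪ μ) {f : Rd d → ℂ} (hf : AEStronglyMeasurable f μ) :
    AEStronglyMeasurable (act κ f) μ := by
  have h1 := hf.comp_measurePreserving (measurePreserving_mehler hκ hμ)
  have h2 := h1.integral_prod_right'
  convert h2 using 1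
  exact funext fun x => act_eq_integral hκ (hf.mono_ac (hac x))

end LevyOU

namespace LevyOU

variable {d : ℕ} {κ : Kernel (Rd d) (Rd d)} {A S : Rd d ≃L[ℝ] Rd d} {η μ : Measure (Rd d)}

/-! ### Derivatives of the semigroup on smooth functions -/

lemma act_eq_integral_comp_add [IsProbabilityMeasure η]
    (hκ : ∀ x, κ x = ((stdGaussian (Rd d)).prod η).map fun z => A x + (S z.1 + z.2))
    {u : Rd d → ℂ} (hu : Continuous u) :
    act κ u = (fun x => ∫ w, u (x + w) ∂(((stdGaussian (Rd d)).prod η).map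
      fun z => S z.1 + z.2)) ∘ A := by
  funext x
  rw [act_eq_integral hκ hu.aestronglyMeasurable, Function.comp_apply,
    integral_map (by fun_prop) (by fun_prop)]

lemma IsSmoothBounded.act [IsProbabilityMeasure η]
    (hκ : ∀ x, κ x = ((stdGaussian (Rd d)).prod η).map fun z => A x + (S z.1 + z.2))
    {u : Rd d → ℂ} (hu : IsSmoothBounded u) : IsSmoothBounded (act κ u) := by
  have : IsProbabilityMeasure (((stdGaussian (Rd d)).prod η).map fun z => S z.1 + z.2) :=
    Measure.isProbabilityMeasure_map (by fun_prop)
  rw [act_eq_integral_comp_add hκ hu.contDiff.continuous]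
  exact (hu.integral_comp_add _).comp_clm (A : Rd d →L[ℝ] Rd d)

lemma fderiv_act [IsProbabilityMeasure η]
    (hκ : ∀ x, κ x = ((stdGaussian (Rd d)).prod η).map fun z => A x + (S z.1 + z.2))
    {u : Rd d → ℂ} (hu : IsSmoothBounded u) (x h : Rd d) :
    fderiv ℝ (act κ u) x h = act κ (fun y => fderiv ℝ u y (A h)) x := by
  have : IsProbabilityMeasure (((stdGaussian (Rd d)).prod η).map fun z => S z.1 + z.2) :=
    Measure.isProbabilityMeasure_map (by fun_prop)
  rw [act_eq_integral_comp_add hκ hu.contDiff.continuous,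
    act_eq_integral_comp_add hκ (hu.fderiv_apply (A h)).contDiff.continuous,
    ContinuousLinearEquiv.comp_right_fderiv]
  exact hu.fderiv_integral_comp_add _ (A x) (A h)

/-- The Bismut formula: the derivative of `P_s u` is an integral of `u` against a Gaussian
weight. -/
theorem fderiv_act_eq_integral_inner_mul [IsProbabilityMeasure η]
    (hκ : ∀ x, κ x = ((stdGaussian (Rd d)).prod η).map fun z => A x + (S z.1 + z.2))
    {u : Rd d → ℂ} (hu : IsSmoothBounded u) (x h : Rd d) :
    fderiv ℝ (act κ u) x h = ∫ z, ((inner ℝ (S.symm (A h)) z.1 : ℝ) : ℂ) *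
      u (A x + (S z.1 + z.2)) ∂((stdGaussian (Rd d)).prod η) := by
  have hud := hu.fderiv_apply (A h)
  obtain ⟨C, hC⟩ := hu.exists_norm_le
  obtain ⟨C', hC'⟩ := hu.exists_norm_fderiv_le
  obtain ⟨C'', hC''⟩ := hud.exists_norm_le
  have huc := hu.contDiff.continuous
  have hudc := hud.contDiff.continuous
  have hi1 : Integrable (fun z : Rd d × Rd d => fderiv ℝ u (A x + (S z.1 + z.2)) (A h))
      ((stdGaussian (Rd d)).prod η) :=
    Integrable.of_bound (hudc.comp (g := fun y => fderiv ℝ u y (A h))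
      (by fun_prop : Continuous fun z : Rd d × Rd d =>
        A x + (S z.1 + z.2))).aestronglyMeasurable C'' (ae_of_all _ fun z => hC'' _)
  have hi2 : Integrable (fun z : Rd d × Rd d => ((inner ℝ (S.symm (A h)) z.1 : ℝ) : ℂ) *
      u (A x + (S z.1 + z.2))) ((stdGaussian (Rd d)).prod η) := by
    have h1 : Integrable (fun ζ : Rd d => ((inner ℝ (S.symm (A h)) ζ : ℝ) : ℂ))
        (stdGaussian (Rd d)) :=
      (IsGaussian.integrable_dual _ (innerSL ℝ (S.symm (A h)))).ofReal
    exact (h1.comp_fst η).mul_bdd (by fun_prop) (ae_of_all _ fun z => hC _)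
  rw [fderiv_act hκ hu, act_eq_integral hκ hudc.aestronglyMeasurable,
    integral_prod_symm _ hi1, integral_prod_symm _ hi2]
  refine integral_congr_ae (ae_of_all _ fun y => ?_)
  have hder : ∀ ζ, HasFDerivAt (fun ζ => u (A x + (S ζ + y)))
      ((fderiv ℝ u (A x + (S ζ + y))).comp (S : Rd d →L[ℝ] Rd d)) ζ := fun ζ =>
    (hu.differentiable _).hasFDerivAt.comp ζ
      ((S.hasFDerivAt.add_const y).const_add (A x))
  have hibp := integral_fderiv_stdGaussian (F := fun ζ => u (A x + (S ζ + y))) (C := C)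
    (C' := C' * ‖(S : Rd d →L[ℝ] Rd d)‖)
    ((hu.contDiff.of_le (by simp)).comp (by fun_prop)) (fun ζ => hC _)
    (fun ζ => by
      rw [(hder ζ).fderiv]
      exact (ContinuousLinearMap.opNorm_comp_le _ _).trans
        (mul_le_mul_of_nonneg_right (hC' _) (norm_nonneg _))) (S.symm (A h))
  refine Eq.trans (integral_congr_ae (ae_of_all _ fun ζ => ?_)) hibp
  simp [(hder ζ).fderiv]

theorem eLpNorm_fderiv_act_le [IsProbabilityMeasure η] [IsProbabilityMeasure μ]
    (hκ : ∀ x, κ x = ((stdGaussian (Rd d)).prod η).map fun z => A x + (S z.1 + z.2))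
    (hμ : κ.Invariant μ) {p q : ℝ≥0∞} [p.HolderConjugate q] (hp0 : p ≠ 0) (hp : p ≠ ⊤)
    {u : Rd d → ℂ} (hu : IsSmoothBounded u) (h : Rd d) :
    eLpNorm (fun x => fderiv ℝ (act κ u) x h) p μ ≤
      ‖S.symm (A h)‖ₑ * eLpNorm id q (stdGaussian (Rd d)) * eLpNorm u p μ := by
  set v := S.symm (A h)
  have h1 := eLpNorm_integral_mul_le hκ hμ (q := q) hp0 hp
    (hu.contDiff.continuous.aestronglyMeasurable (μ := μ))
    (W := fun z => ((inner ℝ v z.1 : ℝ) : ℂ)) (by fun_prop)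
  rw [funext fun x => fderiv_act_eq_integral_inner_mul hκ hu x h]
  refine h1.trans (mul_le_mul_left (?_ : eLpNorm (fun z : Rd d × Rd d =>
    ((inner ℝ v z.1 : ℝ) : ℂ)) q _ ≤ _) _)
  have h2 : eLpNorm (fun z : Rd d × Rd d => ((inner ℝ v z.1 : ℝ) : ℂ)) q
      ((stdGaussian (Rd d)).prod η) =
      eLpNorm (fun ζ : Rd d => ((inner ℝ v ζ : ℝ) : ℂ)) q (stdGaussian (Rd d)) :=
    eLpNorm_comp_measurePreserving (f := Prod.fst)
      (g := fun ζ : Rd d => ((inner ℝ v ζ : ℝ) : ℂ)) (by fun_prop) measurePreserving_fst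
  rw [h2]
  refine (eLpNorm_le_nnreal_smul_eLpNorm_of_ae_le_mul (c := ‖v‖₊) (g := id)
    (ae_of_all _ fun ζ => ?_) q).trans_eq ?_
  · rw [← NNReal.coe_le_coe]
    simpa using abs_real_inner_le_norm v ζ
  · rw [ENNReal.smul_def, smul_eq_mul]
    rfl

/-! ### Iterated directional derivatives -/

/-- The iterated directional derivative `D_{h_1} ⋯ D_{h_k} u` along a list of directions. -/
noncomputable def dirDeriv {F : Type*} [NormedAddCommGroup F] [NormedSpace ℝ F]
    (l : List (Rd d)) (u : Rd d → F) : Rd d → F :=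
  l.foldr (fun h v x => fderiv ℝ v x h) u

section dirDeriv

variable {F : Type*} [NormedAddCommGroup F] [NormedSpace ℝ F]

lemma dirDeriv_cons (h : Rd d) (l : List (Rd d)) (u : Rd d → F) :
    dirDeriv (h :: l) u = fun x => fderiv ℝ (dirDeriv l u) x h := rfl

lemma dirDeriv_append (l l' : List (Rd d)) (u : Rd d → F) :
    dirDeriv (l ++ l') u = dirDeriv l (dirDeriv l' u) := List.foldr_append

lemma IsSmoothBounded.dirDeriv {u : Rd d → F} (hu : IsSmoothBounded u) (l : List (Rd d)) :
    IsSmoothBounded (dirDeriv l u) := by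
  induction l with
  | nil => exact hu
  | cons h l ih => exact ih.fderiv_apply h

lemma contDiff_dirDeriv {u : Rd d → F} (hu : ContDiff ℝ ∞ u) (l : List (Rd d)) :
    ContDiff ℝ ∞ (dirDeriv l u) := by
  induction l with
  | nil => exact hu
  | cons h l ih => exact (ih.fderiv_right (m := ∞) (by simp)).clm_apply contDiff_const

lemma hasCompactSupport_dirDeriv {u : Rd d → F} (hu : HasCompactSupport u) (l : List (Rd d)) :
    HasCompactSupport (dirDeriv l u) := by
  induction l with
  | nil => exact hu
  | cons h l ih => exact ih.fderiv_apply ℝ h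

lemma dirDeriv_sub {u v : Rd d → F} (hu : IsSmoothBounded u) (hv : IsSmoothBounded v)
    (l : List (Rd d)) : dirDeriv l (u - v) = dirDeriv l u - dirDeriv l v := by
  induction l with
  | nil => rfl
  | cons h l ih =>
    funext x
    rw [dirDeriv_cons, ih]
    simp [fderiv_sub ((hu.dirDeriv l).differentiable x) ((hv.dirDeriv l).differentiable x),
      dirDeriv_cons]

lemma dirDeriv_act [IsProbabilityMeasure η]
    (hκ : ∀ x, κ x = ((stdGaussian (Rd d)).prod η).map fun z => A x + (S z.1 + z.2))
    {u : Rd d → ℂ} (hu : IsSmoothBounded u) (l : List (Rd d)) :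
    dirDeriv l (act κ u) = act κ (dirDeriv (l.map A) u) := by
  induction l with
  | nil => rfl
  | cons h l ih =>
    funext x
    rw [dirDeriv_cons, ih, List.map_cons, dirDeriv_cons]
    exact fderiv_act hκ (hu.dirDeriv _) x h

/-- The directions, with multiplicity, in which `∂^n` differentiates. -/
noncomputable def multiDirections (n : Fin d → ℕ) : List (Rd d) :=
  (List.finRange d).flatMap fun i => List.replicate (n i) (EuclideanSpace.single i 1)

lemma multiDeriv_eq_dirDeriv (n : Fin d → ℕ) (u : Rd d → F) :
    multiDeriv n u = dirDeriv (multiDirections n) u := by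
  have h1 : ∀ (i : Fin d) (m : ℕ) (v : Rd d → F),
      (partialDeriv i)^[m] v = dirDeriv (List.replicate m (EuclideanSpace.single i 1)) v := by
    intro i m v
    induction m with
    | zero => rfl
    | succ m ih => rw [Function.iterate_succ_apply', ih, List.replicate_succ]; rfl
  rw [multiDeriv, multiDirections]
  induction List.finRange d with
  | nil => rfl
  | cons i L ih => rw [List.foldr_cons, ih, h1, List.flatMap_cons, dirDeriv_append]

lemma length_multiDirections (n : Fin d → ℕ) : (multiDirections n).length = ∑ i, n i := by
  simp [multiDirections, List.length_flatMap, Fin.sum_univ_def]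

lemma norm_le_one_of_mem_multiDirections {n : Fin d → ℕ} {h : Rd d}
    (hh : h ∈ multiDirections n) : ‖h‖ ≤ 1 := by
  simp only [multiDirections, List.mem_flatMap, List.mem_replicate] at hh
  obtain ⟨i, _, _, rfl⟩ := hh
  simp

/-- Integration by parts moves the directions from `φ` to `u` one at a time, so they appear in
reverse order. -/
lemma integral_dirDeriv_mul {φ : Rd d → ℝ} (hφ : ContDiff ℝ ∞ φ) (hφc : HasCompactSupport φ)
    (l : List (Rd d)) {u : Rd d → ℂ} (hu : IsSmoothBounded u) :
    ∫ x, ((dirDeriv l φ x : ℝ) : ℂ) * u x =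
      (-1) ^ l.length * ∫ x, (φ x : ℂ) * dirDeriv l.reverse u x := by
  induction l generalizing u with
  | nil => simp [dirDeriv]
  | cons h l ih =>
    have hψ := contDiff_dirDeriv hφ l
    have hψc := hasCompactSupport_dirDeriv hφc l
    have hψ' := contDiff_dirDeriv hφ (h :: l)
    have hψc' := hasCompactSupport_dirDeriv hφc (h :: l)
    have hud := hu.fderiv_apply h
    have hi : ∀ {ψ : Rd d → ℝ} {w : Rd d → ℂ}, Continuous ψ → HasCompactSupport ψ →
        Continuous w → Integrable fun x => ψ x • w x := fun h1 h2 h3 =>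
      (h1.smul h3).integrable_of_hasCompactSupport h2.smul_right
    have hibp := integral_smul_fderiv_eq_neg_fderiv_smul_of_integrable (μ := volume)
      (f := dirDeriv l φ) (g := u) (v := h)
      (hi hψ'.continuous hψc' hu.contDiff.continuous)
      (hi hψ.continuous hψc hud.contDiff.continuous)
      (hi hψ.continuous hψc hu.contDiff.continuous)
      (fun x _ => hψ.differentiable (by simp) x) (fun x _ => hu.differentiable x)
    simp only [Complex.real_smul] at hibp
    have h2 := ih hud
    rw [hibp] at h2
    rw [dirDeriv_cons, List.reverse_cons, dirDeriv_append, List.length_cons, pow_succ, mul_neg_one,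
      neg_mul, eq_neg_iff_add_eq_zero, ← neg_eq_iff_add_eq_zero]
    exact h2

/-- If an operator `T` commutes with differentiation up to the linear map `A`, and each first-order
derivative of `T u` is controlled by `u`, then the derivatives of order `k` of `T^k u` are
controlled by `u`. -/
theorem eLpNorm_dirDeriv_iterate_le {T : (Rd d → ℂ) → (Rd d → ℂ)} {p : ℝ≥0∞} {K a : ℝ≥0}
    (ha : 1 ≤ a) (hA : ∀ h, ‖A h‖₊ ≤ a * ‖h‖₊)
    (hT : ∀ u, IsSmoothBounded u → IsSmoothBounded (T u))
    (hcomm : ∀ u l, IsSmoothBounded u → dirDeriv l (T u) = T (dirDeriv (l.map A) u))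
    (hbound : ∀ u h, IsSmoothBounded u →
      eLpNorm (fun x => fderiv ℝ (T u) x h) p μ ≤ K * ‖h‖₊ * eLpNorm u p μ)
    (l : List (Rd d)) (R : ℝ≥0) (hl : ∀ h ∈ l, ‖h‖₊ ≤ R) {u : Rd d → ℂ}
    (hu : IsSmoothBounded u) :
    eLpNorm (dirDeriv l (T^[l.length] u)) p μ ≤
      (((K * R) ^ l.length * a ^ (l.length ^ 2) : ℝ≥0) : ℝ≥0∞) * eLpNorm u p μ := by
  induction hn : l.length generalizing l R with
  | zero =>
    rw [List.length_eq_zero_iff] at hn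
    subst hn
    simp [dirDeriv]
  | succ n ih =>
    obtain ⟨h, l, rfl⟩ := List.exists_cons_of_length_eq_add_one hn
    have hn' : l.length = n := by simpa using hn
    have hTn : IsSmoothBounded (T^[n] u) := by
      clear ih hn hn'
      induction n with
      | zero => exact hu
      | succ m ihm =>
        rw [Function.iterate_succ_apply']
        exact hT _ ihm
    rw [Function.iterate_succ_apply', dirDeriv_cons, hcomm _ _ hTn]
    refine (hbound _ h (hTn.dirDeriv _)).trans ?_
    have h1 := ih (l.map A) (a * R) (fun h' hh' => by
      obtain ⟨h'', hh'', rfl⟩ := List.mem_map.1 hh'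
      exact (hA h'').trans (mul_le_mul_right (hl h'' (by simp [hh''])) a)) (by simpa using hn')
    calc (K : ℝ≥0∞) * ‖h‖₊ * eLpNorm (dirDeriv (l.map A) (T^[n] u)) p μ
        ≤ K * R * ((((K * (a * R)) ^ n * a ^ (n ^ 2) : ℝ≥0) : ℝ≥0∞) * eLpNorm u p μ) := by
          gcongr
          exact hl h (by simp)
      _ = ((((K * R) ^ (n + 1) * a ^ (n ^ 2 + n)) : ℝ≥0) : ℝ≥0∞) * eLpNorm u p μ := by
          rw [← mul_assoc]
          congr 1
          rw [← ENNReal.coe_mul, ← ENNReal.coe_mul]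
          congr 1
          ring
      _ ≤ _ := by
          gcongr
          nlinarith

end dirDeriv

end LevyOU

namespace LevyOU

variable {d : ℕ} {κ : Kernel (Rd d) (Rd d)} {A S : Rd d ≃L[ℝ] Rd d} {η μ : Measure (Rd d)}

/-! ### Weak derivatives -/

/-- `μ` dominates Lebesgue measure, up to a constant, on every compact set. -/
def DominatesVolume (μ : Measure (Rd d)) : Prop :=
  volume ≪ μ ∧ ∀ K : Set (Rd d), IsCompact K → ∃ C : ℝ≥0, volume.restrict K ≤ (C : ℝ≥0∞) • μ

lemma DominatesVolume.memLp_restrict (hμ : DominatesVolume μ) {p : ℝ≥0∞} {f : Rd d → ℂ}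
    (hf : MemLp f p μ) {K : Set (Rd d)} (hK : IsCompact K) : MemLp f p (volume.restrict K) := by
  obtain ⟨C, hC⟩ := hμ.2 K hK
  exact (hf.smul_measure ENNReal.coe_ne_top).mono_measure hC

lemma DominatesVolume.locallyIntegrable (hμ : DominatesVolume μ) {p : ℝ≥0∞} (hp : 1 ≤ p)
    {f : Rd d → ℂ} (hf : MemLp f p μ) : LocallyIntegrable f volume := by
  refine locallyIntegrable_iff.2 fun K hK => ?_
  have : IsFiniteMeasure ((volume : Measure (Rd d)).restrict K) :=
    isFiniteMeasure_restrict.2 hK.measure_lt_top.ne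
  exact (hμ.memLp_restrict hf hK).integrable hp

lemma DominatesVolume.exists_lintegral_mul_le [IsProbabilityMeasure μ] (hμ : DominatesVolume μ)
    {p : ℝ≥0∞} (hp : 1 ≤ p) {ψ : Rd d → ℂ} (hψ : Continuous ψ) (hψc : HasCompactSupport ψ) :
    ∃ C : ℝ≥0, ∀ h : Rd d → ℂ, AEStronglyMeasurable h μ →
      ∫⁻ x, ‖ψ x * h x‖ₑ ≤ C * eLpNorm h p μ := by
  obtain ⟨M, hM⟩ := hψc.exists_bound_of_continuous hψ
  obtain ⟨C, hC⟩ := hμ.2 _ hψc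
  refine ⟨M.toNNReal * C, fun h hh => ?_⟩
  have hMe : ∀ x, ‖ψ x‖ₑ ≤ M.toNNReal := fun x => by
    rw [← ofReal_norm]
    exact ENNReal.ofReal_le_ofReal (hM x)
  calc ∫⁻ x, ‖ψ x * h x‖ₑ
      ≤ ∫⁻ x, (tsupport ψ).indicator (fun x => M.toNNReal * ‖h x‖ₑ) x := by
        refine lintegral_mono fun x => ?_
        by_cases hx : x ∈ tsupport ψ
        · rw [Set.indicator_of_mem hx, enorm_mul]
          exact mul_le_mul_left (hMe x) _
        · simp [image_eq_zero_of_notMem_tsupport hx]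
    _ = M.toNNReal * ∫⁻ x in tsupport ψ, ‖h x‖ₑ := by
        rw [lintegral_indicator (isClosed_tsupport ψ).measurableSet,
          lintegral_const_mul' _ _ ENNReal.coe_ne_top]
    _ ≤ M.toNNReal * (C * ∫⁻ x, ‖h x‖ₑ ∂μ) := by
        gcongr
        rw [← smul_eq_mul, ← lintegral_smul_measure]
        exact lintegral_mono' hC le_rfl
    _ ≤ _ := by
        rw [← mul_assoc, ENNReal.coe_mul]
        gcongr
        rw [← eLpNorm_one_eq_lintegral_enorm]
        exact eLpNorm_le_eLpNorm_of_exponent_le hp hh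

lemma DominatesVolume.integrable_mul [IsProbabilityMeasure μ] (hμ : DominatesVolume μ)
    {p : ℝ≥0∞} (hp : 1 ≤ p) {ψ : Rd d → ℂ} (hψ : Continuous ψ) (hψc : HasCompactSupport ψ)
    {h : Rd d → ℂ} (hh : MemLp h p μ) : Integrable fun x => ψ x * h x := by
  obtain ⟨C, hC⟩ := hμ.exists_lintegral_mul_le hp hψ hψc
  exact ⟨hψ.aestronglyMeasurable.mul (hh.1.mono_ac hμ.1),
    (hC h hh.1).trans_lt (ENNReal.mul_lt_top ENNReal.coe_lt_top hh.2)⟩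

lemma DominatesVolume.tendsto_integral_mul [IsProbabilityMeasure μ] (hμ : DominatesVolume μ)
    {p : ℝ≥0∞} (hp : 1 ≤ p) {ψ : Rd d → ℂ} (hψ : Continuous ψ) (hψc : HasCompactSupport ψ)
    {h : ℕ → Rd d → ℂ} {g : Rd d → ℂ} (hh : ∀ j, MemLp (h j) p μ) (hg : MemLp g p μ)
    (hlim : Tendsto (fun j => eLpNorm (h j - g) p μ) atTop (𝓝 0)) :
    Tendsto (fun j => ∫ x, ψ x * h j x) atTop (𝓝 (∫ x, ψ x * g x)) := by
  obtain ⟨C, hC⟩ := hμ.exists_lintegral_mul_le hp hψ hψc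
  refine tendsto_integral_of_L1 _ (hμ.integrable_mul hp hψ hψc hg).1
    (Eventually.of_forall fun j => hμ.integrable_mul hp hψ hψc (hh j)) ?_
  have h1 : Tendsto (fun j => (C : ℝ≥0∞) * eLpNorm (h j - g) p μ) atTop (𝓝 0) := by
    simpa using ENNReal.Tendsto.const_mul hlim (Or.inr ENNReal.coe_ne_top)
  refine tendsto_of_tendsto_of_tendsto_of_le_of_le tendsto_const_nhds h1
    (fun _ => zero_le) fun j => ?_
  simp_rw [← mul_sub]
  exact hC _ ((hh j).1.sub hg.1)

lemma act_sub_ae_eq [IsProbabilityMeasure η] [IsProbabilityMeasure μ]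
    (hκ : ∀ x, κ x = ((stdGaussian (Rd d)).prod η).map fun z => A x + (S z.1 + z.2))
    (hμ : κ.Invariant μ) (hac : ∀ x, κ x ≪ μ) {f g : Rd d → ℂ} (hf : Integrable f μ)
    (hg : Integrable g μ) : act κ f - act κ g =ᵐ[μ] act κ (f - g) := by
  filter_upwards [ae_integrable_act hκ hμ hac hf, ae_integrable_act hκ hμ hac hg] with x h1 h2
  exact (integral_sub h1 h2).symm

lemma IsSmoothBounded.memLp [IsProbabilityMeasure μ] {u : Rd d → ℂ} (hu : IsSmoothBounded u)
    (p : ℝ≥0∞) : MemLp u p μ := by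
  obtain ⟨C, hC⟩ := hu.exists_norm_le
  exact MemLp.of_bound hu.contDiff.continuous.aestronglyMeasurable C (ae_of_all _ hC)

lemma IsSmoothBounded.sub {u v : Rd d → ℂ} (hu : IsSmoothBounded u) (hv : IsSmoothBounded v) :
    IsSmoothBounded (u - v) := by
  refine ⟨hu.contDiff.sub hv.contDiff, fun n => ?_⟩
  obtain ⟨C, hC⟩ := hu.bounded n
  obtain ⟨C', hC'⟩ := hv.bounded n
  refine ⟨C + C', fun x => ?_⟩
  rw [iteratedFDeriv_sub_apply (hu.contDiff.of_le (by exact_mod_cast le_top)).contDiffAt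
    (hv.contDiff.of_le (by exact_mod_cast le_top)).contDiffAt]
  exact (norm_sub_le _ _).trans (add_le_add (hC x) (hC' x))

/-- A bound on the derivatives of `P_t u` for smooth bounded `u` extends to weak derivatives of
`P_t f` for all `f ∈ L^p(μ)`: test functions are dense, and convergence in `L^p(μ)` implies local
convergence in `L^1(dx)`. -/
theorem exists_weak_dirDeriv_act [IsProbabilityMeasure η] [IsProbabilityMeasure μ]
    (hκ : ∀ x, κ x = ((stdGaussian (Rd d)).prod η).map fun z => A x + (S z.1 + z.2))
    (hμ : κ.Invariant μ) (hac : ∀ x, κ x ≪ μ) (hvol : DominatesVolume μ) {p : ℝ≥0∞}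
    (hp1 : 1 ≤ p) (hp : p ≠ ⊤) {l : List (Rd d)} {K : ℝ≥0}
    (hK : ∀ u : Rd d → ℂ, IsSmoothBounded u →
      eLpNorm (dirDeriv l.reverse (act κ u)) p μ ≤ K * eLpNorm u p μ)
    {f : Rd d → ℂ} (hf : MemLp f p μ) :
    ∃ v, MemLp v p μ ∧ eLpNorm v p μ ≤ K * eLpNorm f p μ ∧
      ∀ φ : Rd d → ℝ, ContDiff ℝ ∞ φ → HasCompactSupport φ →
        ∫ x, ((dirDeriv l φ x : ℝ) : ℂ) * act κ f x =
          (-1) ^ l.length * ∫ x, (φ x : ℂ) * v x := by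
  have := ENNReal.HolderConjugate.conjExponent hp1
  have hp0 : p ≠ 0 := (one_pos.trans_le hp1).ne'
  -- the summable rate makes the derivatives a rapidly Cauchy sequence
  choose u huc hus hu using fun j : ℕ =>
    hf.exist_eLpNorm_sub_le hp hp1 (ε := (1 / 2 : ℝ) ^ j) (by positivity)
  have hub : ∀ j, IsSmoothBounded (u j) := fun j =>
    isSmoothBounded_of_hasCompactSupport (hus j) (huc j)
  have hTu : ∀ j, IsSmoothBounded (act κ (u j)) := fun j => (hub j).act hκ
  have hTf : MemLp (act κ f) p μ := ⟨aestronglyMeasurable_act hκ hμ hac hf.1,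
    (eLpNorm_act_le hκ hμ hac (q := p.conjExponent) hp0 hp hf.1).trans_lt hf.2⟩
  have he : ∀ N j : ℕ, N ≤ j → eLpNorm (f - u j) p μ ≤ (1 / 2 : ℝ≥0∞) ^ N := by
    intro N j hj
    refine (hu j).trans ?_
    rw [ENNReal.ofReal_pow (by norm_num), ENNReal.ofReal_div_of_pos two_pos]
    simp only [ENNReal.ofReal_one, ENNReal.ofReal_ofNat]
    exact pow_le_pow_of_le_one zero_le (by simp) hj
  have he0 : Tendsto (fun j => eLpNorm (f - u j) p μ) atTop (𝓝 0) :=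
    tendsto_of_tendsto_of_tendsto_of_le_of_le tendsto_const_nhds
      (ENNReal.tendsto_pow_atTop_nhds_zero_of_lt_one (by simp)) (fun _ => zero_le)
      fun j => he j j le_rfl
  have hcau : ∀ n m, eLpNorm (dirDeriv l.reverse (act κ (u n)) -
      dirDeriv l.reverse (act κ (u m))) p μ ≤
      K * (eLpNorm (f - u n) p μ + eLpNorm (f - u m) p μ) := by
    intro n m
    have e : act κ (u n) - act κ (u m) = act κ (u n - u m) := by
      have := fun x => (hκ x ▸ Measure.isProbabilityMeasure_map (by fun_prop) :
        IsProbabilityMeasure (κ x))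
      funext x
      exact (integral_sub (memLp_one_iff_integrable.1 ((hub n).memLp 1))
        (memLp_one_iff_integrable.1 ((hub m).memLp 1))).symm
    rw [← dirDeriv_sub (hTu n) (hTu m), e]
    refine (hK _ ((hub n).sub (hub m))).trans ?_
    gcongr
    have : u n - u m = (f - u m) - (f - u n) := by abel
    rw [this, add_comm]
    exact eLpNorm_sub_le (hf.1.sub (hub m).contDiff.continuous.aestronglyMeasurable)
      (hf.1.sub (hub n).contDiff.continuous.aestronglyMeasurable) hp1
  obtain ⟨v, hv, hvlim⟩ := Lp.cauchy_complete_eLpNorm (μ := μ) (p := p) hp1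
    (f := fun j => dirDeriv l.reverse (act κ (u j)))
    (fun j => ((hTu j).dirDeriv _).memLp p) (B := fun N => (2 * K + 1) * (1 / 2 : ℝ≥0∞) ^ N) (by
      rw [ENNReal.tsum_mul_left]
      refine ENNReal.mul_ne_top (by finiteness) ?_
      rw [ENNReal.tsum_geometric]
      simp) (fun N n m hn hm => by
      refine (hcau n m).trans_lt ?_
      have h1 : ((1 / 2 : ℝ≥0∞) ^ N) ≠ 0 := by simp
      have h2 : ((1 / 2 : ℝ≥0∞) ^ N) ≠ ⊤ := by finiteness
      calc K * (eLpNorm (f - u n) p μ + eLpNorm (f - u m) p μ)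
          ≤ K * ((1 / 2 : ℝ≥0∞) ^ N + (1 / 2 : ℝ≥0∞) ^ N) := by
            gcongr
            exacts [he N n hn, he N m hm]
        _ = 2 * K * (1 / 2 : ℝ≥0∞) ^ N := by ring
        _ < _ := by
            rw [add_mul, one_mul]
            exact ENNReal.lt_add_right (by finiteness) h1)
  refine ⟨v, hv, ?_, fun φ hφ hφc => ?_⟩
  · have hle : ∀ j, eLpNorm v p μ ≤ eLpNorm (dirDeriv l.reverse (act κ (u j)) - v) p μ +
        K * (eLpNorm f p μ + eLpNorm (f - u j) p μ) := by
      intro j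
      have h1 : v = dirDeriv l.reverse (act κ (u j)) -
          (dirDeriv l.reverse (act κ (u j)) - v) := by abel
      have hm := ((hTu j).dirDeriv l.reverse).contDiff.continuous.aestronglyMeasurable (μ := μ)
      have h2 : u j = f - (f - u j) := by abel
      calc eLpNorm v p μ ≤ eLpNorm (dirDeriv l.reverse (act κ (u j))) p μ +
            eLpNorm (dirDeriv l.reverse (act κ (u j)) - v) p μ := by
            conv_lhs => rw [h1]
            exact eLpNorm_sub_le hm (hm.sub hv.1) hp1
        _ ≤ K * (eLpNorm f p μ + eLpNorm (f - u j) p μ) +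
            eLpNorm (dirDeriv l.reverse (act κ (u j)) - v) p μ := by
            gcongr
            refine (hK _ (hub j)).trans ?_
            gcongr
            conv_lhs => rw [h2]
            exact eLpNorm_sub_le hf.1
              (hf.1.sub (hub j).contDiff.continuous.aestronglyMeasurable) hp1
        _ = _ := add_comm _ _
    have hlim : Tendsto (fun j => eLpNorm (dirDeriv l.reverse (act κ (u j)) - v) p μ +
        K * (eLpNorm f p μ + eLpNorm (f - u j) p μ)) atTop
        (𝓝 (0 + K * (eLpNorm f p μ + 0))) :=
      hvlim.add (ENNReal.Tendsto.const_mul (tendsto_const_nhds.add he0)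
        (Or.inr ENNReal.coe_ne_top))
    simpa using ge_of_tendsto' hlim hle
  · have hTlim : Tendsto (fun j => eLpNorm (act κ (u j) - act κ f) p μ) atTop (𝓝 0) := by
      refine tendsto_of_tendsto_of_tendsto_of_le_of_le tendsto_const_nhds he0
        (fun _ => zero_le) fun j => ?_
      have hmu := (hub j).memLp (μ := μ) p
      rw [eLpNorm_congr_ae (act_sub_ae_eq hκ hμ hac (hmu.integrable hp1) (hf.integrable hp1)),
        ← eLpNorm_sub_comm]
      exact eLpNorm_act_le hκ hμ hac (q := p.conjExponent) hp0 hp (hmu.1.sub hf.1)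
    have hψ := contDiff_dirDeriv hφ l
    have hψc := hasCompactSupport_dirDeriv hφc l
    have h1 := hvol.tendsto_integral_mul hp1 (ψ := fun x => ((dirDeriv l φ x : ℝ) : ℂ))
      (Complex.continuous_ofReal.comp hψ.continuous)
      (hψc.comp_left (g := Complex.ofReal) Complex.ofReal_zero)
      (fun j => (hTu j).memLp p) hTf hTlim
    have h2 := (hvol.tendsto_integral_mul hp1 (ψ := fun x => ((φ x : ℝ) : ℂ))
      (Complex.continuous_ofReal.comp hφ.continuous)
      (hφc.comp_left (g := Complex.ofReal) Complex.ofReal_zero)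
      (fun j => ((hTu j).dirDeriv l.reverse).memLp p) hv hvlim).const_mul
      ((-1 : ℂ) ^ l.length)
    refine tendsto_nhds_unique h1 (h2.congr fun j => ?_)
    exact (integral_dirDeriv_mul hφ hφc l (hTu j)).symm

end LevyOU

namespace LevyOU

variable {d : ℕ} {Q B : Matrix (Fin d) (Fin d) ℝ} {Lm : Measure (Rd d)}
  {P : ℝ≥0 → Kernel (Rd d) (Rd d)} {μ : Measure (Rd d)}

lemma hasWeakDeriv_ae_unique {n : Fin d → ℕ} {u v v' : Rd d → ℂ} (h : HasWeakDeriv n u v)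
    (h' : HasWeakDeriv n u v') : v =ᵐ[volume] v' := by
  refine ae_eq_of_integral_contDiff_smul_eq h.2.1 h'.2.1 fun φ hφ hφc => ?_
  have h1 := (h.2.2 φ hφ hφc).symm.trans (h'.2.2 φ hφ hφc)
  simpa [Complex.real_smul] using mul_left_cancel₀ (pow_ne_zero _ (by norm_num)) h1

lemma HasWeakDeriv.weakDeriv {n : Fin d → ℕ} {u v : Rd d → ℂ} (h : HasWeakDeriv n u v) :
    HasWeakDeriv n u (weakDeriv n u) := by
  have hex : ∃ v, HasWeakDeriv n u v := ⟨v, h⟩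
  rw [LevyOU.weakDeriv, dif_pos hex]
  exact hex.choose_spec

lemma HasWeakDeriv.congr_left {n : Fin d → ℕ} {u u' v : Rd d → ℂ} (h : HasWeakDeriv n u v)
    (huu' : u =ᵐ[volume] u') : HasWeakDeriv n u' v := by
  refine ⟨h.1.congr huu', h.2.1, fun φ hφ hφc => ?_⟩
  rw [← h.2.2 φ hφ hφc]
  refine integral_congr_ae ?_
  filter_upwards [huu'] with x hx
  rw [hx]

lemma act_act_of_isSmoothBounded (hP : IsFellerSemigroup P) {u : Rd d → ℂ}
    (hu : IsSmoothBounded u) (s t : ℝ≥0) :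
    act (P (s + t)) u = act (P s) (act (P t) u) := by
  have := hP.markov
  exact funext fun x => act_add hP s t (memLp_one_iff_integrable.1 (hu.memLp 1))

/-! ### The smoothing estimate -/

/-- Splitting `[0, t]` into `k + 1` equal pieces, each of the first `k` absorbs one derivative
through the Gaussian integration by parts, at the cost of a factor `t^{-(1/2 + 𝔪)}`. -/
theorem exists_weakDeriv_act (hP : IsLevyOUSemigroup Q B Lm P) (hQ : Q.PosSemidef)
    (hLm : IsLevyMeasure Lm) (hQt : ∀ t : ℝ, 0 < t → 0 < (Qt Q B t).det)
    [IsProbabilityMeasure μ] (hμ : ∀ t, (P t).Invariant μ)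
    (hac : ∀ t : ℝ≥0, 0 < t → ∀ x, P t x ≪ μ) (hvol : DominatesVolume μ)
    {p : ℝ≥0∞} (hp1 : 1 < p) (hp : p ≠ ⊤) (k : ℕ) :
    ∃ C : ℝ, 0 < C ∧ ∀ t : ℝ≥0, 0 < t → t ≤ 1 → ∀ n : Fin d → ℕ, ∑ i, n i = k →
      ∀ f : Rd d → ℂ, MemLp f p μ → ∃ v, HasWeakDeriv n (act (P t) f) v ∧ MemLp v p μ ∧
        eLpNorm v p μ ≤ ENNReal.ofReal
          (C / (t : ℝ) ^ ((k : ℝ) * (1 / 2 + (kalmanIndex Q B : ℝ)))) * eLpNorm f p μ := by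
  obtain ⟨S, hS, Cs, hCs, hSinv⟩ := exists_mehler hP hQ hLm hQt
  obtain ⟨a, ha, hA⟩ := exists_norm_flow_apply_le B
  have hpq := ENNReal.HolderConjugate.conjExponent hp1.le
  have hp0 : p ≠ 0 := (one_pos.trans hp1).ne'
  have hq : p.conjExponent ≠ ⊤ := by
    rw [ENNReal.conjExponent]
    simpa using (tsub_pos_of_lt hp1).ne'
  have hM := (IsGaussian.memLp_id (stdGaussian (Rd d)) p.conjExponent hq).2.ne
  set M : ℝ := (eLpNorm id p.conjExponent (stdGaussian (Rd d))).toReal with hMdef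
  have hM0 : 0 ≤ M := ENNReal.toReal_nonneg
  set α : ℝ := 1 / 2 + kalmanIndex Q B with hα
  refine ⟨(Cs * a * (M + 1) * (k + 1 : ℝ) ^ α) ^ k * a ^ (k ^ 2), by positivity,
    fun t ht ht1 n hn f hf => ?_⟩
  -- `k + 1` pieces rather than `k`, so that `s` is defined also for `k = 0`
  obtain ⟨s, hs⟩ : ∃ s : ℝ≥0, s = t / (k + 1) := ⟨_, rfl⟩
  have hs0 : 0 < s := hs ▸ by positivity
  have hs1 : s ≤ 1 := hs ▸ (div_le_self zero_le (by simp)).trans ht1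
  have hst : (k + 1) • s = t := by
    rw [hs, nsmul_eq_mul]
    push_cast
    exact mul_div_cancel₀ _ (by positivity)
  have hs0' : (0 : ℝ) < s := hs0
  have hs1' : (s : ℝ) ≤ 1 := hs1
  obtain ⟨η, hη, hκ⟩ := hS s hs0
  obtain ⟨η', hη', hκ'⟩ := hS t ht
  -- `K` bounds the norm of one derivative of `P_s` on `L^p(μ)`; `M + 1` keeps it positive if `d = 0`
  set K : ℝ := Cs / (s : ℝ) ^ α * a * (M + 1) with hK
  have hK0 : 0 ≤ K := by positivity
  have hbound : ∀ (u : Rd d → ℂ) h, IsSmoothBounded u →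
      eLpNorm (fun x => fderiv ℝ (act (P s) u) x h) p μ ≤
        K.toNNReal * ‖h‖₊ * eLpNorm u p μ := by
    intro u h hu
    refine (eLpNorm_fderiv_act_le hκ (hμ s) (q := p.conjExponent) hp0 hp hu h).trans
      (mul_le_mul_left ?_ _)
    rw [← ofReal_norm, ← ENNReal.ofReal_toReal hM, ← ENNReal.ofReal_mul (norm_nonneg _),
      ← enorm_eq_nnnorm, ← ofReal_norm, ← ENNReal.ofReal, ← ENNReal.ofReal_mul hK0]
    refine ENNReal.ofReal_le_ofReal ?_
    have h1 : ‖(S s).symm (flow B s h)‖ ≤ Cs / (s : ℝ) ^ α * (a * ‖h‖) :=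
      (hSinv s hs0' hs1' _).trans
        (mul_le_mul_of_nonneg_left (hA s hs0'.le hs1' h) (by positivity))
    calc ‖(S s).symm (flow B s h)‖ * M ≤ Cs / (s : ℝ) ^ α * (a * ‖h‖) * (M + 1) := by
          gcongr
          linarith
      _ = K * ‖h‖ := by rw [hK]; ring
  have hiter : ∀ (u : Rd d → ℂ), IsSmoothBounded u → ∀ m : ℕ,
      (act (P s))^[m] (act (P s) u) = act (P ((m + 1) • s)) u := by
    intro u hu m
    induction m with
    | zero => simp
    | succ m ih =>
      rw [Function.iterate_succ_apply', ih, succ_nsmul' s (m + 1),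
        act_act_of_isSmoothBounded hP.toIsFellerSemigroup hu]
  set l := multiDirections n with hl
  have hlen : l.length = k := (length_multiDirections n).trans hn
  have hmain : ∀ u : Rd d → ℂ, IsSmoothBounded u →
      eLpNorm (dirDeriv l.reverse (act (P t) u)) p μ ≤
        ((K.toNNReal ^ k * a.toNNReal ^ (k ^ 2) : ℝ≥0) : ℝ≥0∞) * eLpNorm u p μ := by
    intro u hu
    have h1 := eLpNorm_dirDeriv_iterate_le (A := flow B s) (T := act (P s)) (p := p) (μ := μ)
      (K := K.toNNReal) (a := a.toNNReal) (by simpa using ha)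
      (fun h => by
        rw [← NNReal.coe_le_coe]
        simpa [Real.coe_toNNReal a (by linarith)] using hA s hs0'.le hs1' h)
      (fun u hu => hu.act hκ) (fun u l hu => dirDeriv_act hκ hu l) hbound l.reverse 1
      (fun h hh => norm_le_one_of_mem_multiDirections (List.mem_reverse.1 hh)) (hu.act hκ)
    rw [List.length_reverse, hlen, hiter u hu k, hst, mul_one] at h1
    refine h1.trans ?_
    gcongr
    exact eLpNorm_act_le hκ (hμ s) (hac s hs0) (q := p.conjExponent) hp0 hp
      hu.contDiff.continuous.aestronglyMeasurable
  obtain ⟨v, hv, hvle, hvw⟩ := exists_weak_dirDeriv_act hκ' (hμ t) (hac t ht) hvol hp1.le hp hmain hf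
  have hTf : MemLp (act (P t) f) p μ := ⟨aestronglyMeasurable_act hκ' (hμ t) (hac t ht) hf.1,
    (eLpNorm_act_le hκ' (hμ t) (hac t ht) (q := p.conjExponent) hp0 hp hf.1).trans_lt hf.2⟩
  refine ⟨v, ⟨hvol.locallyIntegrable hp1.le hTf, hvol.locallyIntegrable hp1.le hv,
    fun φ hφ hφc => ?_⟩, hv, hvle.trans_eq ?_⟩
  · rw [multiDeriv_eq_dirDeriv, hvw φ hφ hφc, hlen, hn]
  · congr 1
    have ht0' : (0 : ℝ) < t := ht
    have hsα : (s : ℝ) ^ α = (t : ℝ) ^ α / (k + 1 : ℝ) ^ α := by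
      rw [hs]
      push_cast
      rw [Real.div_rpow ht0'.le (by positivity)]
    rw [← Real.toNNReal_pow hK0, ← Real.toNNReal_pow (by linarith),
      ← Real.toNNReal_mul (by positivity), ← ENNReal.ofReal]
    congr 1
    rw [mul_comm (k : ℝ) α, Real.rpow_mul ht0'.le, Real.rpow_natCast, hK, hsα]
    have : (0 : ℝ) < (t : ℝ) ^ α := by positivity
    have : (0 : ℝ) < (k + 1 : ℝ) ^ α := by positivity
    rw [mul_div_right_comm, ← div_pow]
    congr 2
    field_simp

end LevyOU

open LevyOU in
theorem theorem3p1 {d : ℕ} (Q B : Matrix (Fin d) (Fin d) ℝ) (Lm : Measure (LevyOU.Rd d))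
    (hQ : Q.PosSemidef) (hLm : LevyOU.IsLevyMeasure Lm)
    (hQt : ∀ t : ℝ, 0 < t → 0 < (LevyOU.Qt Q B t).det)
    (hB : LevyOU.IsStable B) (hlog : LevyOU.HasLogMoment Lm)
    (P : ℝ≥0 → Kernel (LevyOU.Rd d) (LevyOU.Rd d)) (hP : LevyOU.IsLevyOUSemigroup Q B Lm P)
    (μ : Measure (LevyOU.Rd d)) [IsProbabilityMeasure μ] (hμ : ∀ t, (P t).Invariant μ) :
    -- for every `t > 0` the semigroup has a smooth transition density
    (∀ t : ℝ≥0, 0 < t → ∃ pt : LevyOU.Rd d → LevyOU.Rd d → ℝ,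
      ContDiff ℝ ∞ (fun z : LevyOU.Rd d × LevyOU.Rd d => pt z.1 z.2) ∧
      (∀ x y, 0 ≤ pt x y) ∧
      ∀ x, P t x = volume.withDensity (fun y => ENNReal.ofReal (pt x y))) ∧
    -- the invariant distribution has a density in `C_0^∞`
    (∃ ρ : LevyOU.Rd d → ℝ, LevyOU.IsSmoothVanishing ρ ∧ (∀ x, 0 ≤ ρ x) ∧
      μ = volume.withDensity (fun x => ENNReal.ofReal (ρ x))) ∧
    -- `P_t f` is well defined for `f ∈ L^p(μ)`, and `P_t : L^p(μ) → W^{k,p}(μ)` is continuous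
    (∀ p : ℝ≥0∞, 1 < p → p < ⊤ → ∀ k : ℕ, ∀ t : ℝ≥0, 0 < t → t ≤ 1 →
      (∀ f : LevyOU.Rd d → ℂ, MemLp f p μ →
        (∀ᵐ x ∂μ, Integrable f (P t x)) ∧ LevyOU.MemSobolev k p μ (LevyOU.act (P t) f)) ∧
      ∃ M : ℝ≥0, ∀ f g : LevyOU.Rd d → ℂ, MemLp f p μ → MemLp g p μ →
        LevyOU.sobolevNorm k p μ (LevyOU.act (P t) f - LevyOU.act (P t) g)
          ≤ M * eLpNorm (f - g) p μ) ∧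
    -- the quantitative estimate, with `C` depending only on `k` and `p`
    (∀ p : ℝ≥0∞, 1 < p → p < ⊤ → ∀ k : ℕ, ∃ C : ℝ, 0 < C ∧
      ∀ t : ℝ≥0, 0 < t → t ≤ 1 → ∀ n : Fin d → ℕ, ∑ i, n i = k →
        ∀ f : LevyOU.Rd d → ℂ, MemLp f p μ →
          eLpNorm (LevyOU.weakDeriv n (LevyOU.act (P t) f)) p μ ≤
            ENNReal.ofReal
              (C / (t : ℝ) ^ ((k : ℝ) * (1 / 2 + (LevyOU.kalmanIndex Q B : ℝ)))) *
              eLpNorm f p μ) := by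
  obtain ⟨S, hS, -⟩ := exists_mehler hP hQ hLm hQt
  have hdens : ∀ t : ℝ≥0, 0 < t → ∃ pt : Rd d → Rd d → ℝ,
      ContDiff ℝ ∞ (fun z : Rd d × Rd d => pt z.1 z.2) ∧ (∀ x y, 0 ≤ pt x y) ∧
      ∀ x, P t x = volume.withDensity (fun y => ENNReal.ofReal (pt x y)) := by
    intro t ht
    obtain ⟨η, hη, hκ⟩ := hS t ht
    exact exists_transition_density hκ
  obtain ⟨η, hη, hκ1⟩ := hS 1 one_pos
  obtain ⟨ρ, hρ, hpos, hμρ⟩ := exists_invariant_density hκ1 (hμ 1)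
  have hvol : DominatesVolume μ := by
    rw [hμρ]
    exact ⟨volume_absolutelyContinuous hρ.1.continuous hpos,
      fun K hK => exists_restrict_le_smul hρ.1.continuous hpos hK⟩
  have hμvol : μ ≪ volume := hμρ ▸ withDensity_absolutelyContinuous _ _
  have hac : ∀ t : ℝ≥0, 0 < t → ∀ x, P t x ≪ μ := by
    intro t ht x
    obtain ⟨pt, -, -, h⟩ := hdens t ht
    rw [h x]
    exact (withDensity_absolutelyContinuous _ _).trans hvol.1
  -- the canonical weak derivative inherits every property of a given one
  have hcanon : ∀ {p : ℝ≥0∞} {n : Fin d → ℕ} {u v : Rd d → ℂ}, HasWeakDeriv n u v →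
      MemLp v p μ → MemLp (weakDeriv n u) p μ ∧
        eLpNorm (weakDeriv n u) p μ = eLpNorm v p μ := fun h hv => by
    have hae := hμvol.ae_eq (hasWeakDeriv_ae_unique h.weakDeriv h)
    exact ⟨(memLp_congr_ae hae).2 hv, eLpNorm_congr_ae hae⟩
  refine ⟨hdens, ⟨ρ, hρ, fun x => (hpos x).le, hμρ⟩, fun p hp1 hp k t ht ht1 => ?_,
    fun p hp1 hp k => ?_⟩
  · obtain ⟨η', hη', hκ⟩ := hS t ht
    refine ⟨fun f hf => ⟨ae_integrable_act hκ (hμ t) (hac t ht) (hf.integrable hp1.le),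
      fun n hn => ?_⟩, ?_⟩
    · obtain ⟨C, -, hC⟩ := exists_weakDeriv_act hP hQ hLm hQt hμ hac hvol hp1 hp.ne (∑ i, n i)
      obtain ⟨v, hv, hvp, -⟩ := hC t ht ht1 n rfl f hf
      have h := (hcanon hv hvp).1
      exact ⟨hv.weakDeriv, fun K hK => hvol.memLp_restrict h hK, h⟩
    · choose C hC0 hC using fun j => exists_weakDeriv_act hP hQ hLm hQt hμ hac hvol hp1 hp.ne j
      refine ⟨∑ j ∈ Finset.range (k + 1),
        ∑ n ∈ Finset.piAntidiag (Finset.univ : Finset (Fin d)) j,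
          (C j / (t : ℝ) ^ ((j : ℝ) * (1 / 2 + (kalmanIndex Q B : ℝ)))).toNNReal,
        fun f g hf hg => ?_⟩
      rw [sobolevNorm, ENNReal.ofNNReal_finsetSum, Finset.sum_mul]
      refine Finset.sum_le_sum fun j _ => ?_
      rw [ENNReal.ofNNReal_finsetSum, Finset.sum_mul]
      refine Finset.sum_le_sum fun n hn => ?_
      obtain ⟨v, hv, hvp, hvle⟩ := hC j t ht ht1 n (Finset.mem_piAntidiag.1 hn).1 _ (hf.sub hg)
      have hae := hvol.1.ae_eq (act_sub_ae_eq hκ (hμ t) (hac t ht) (hf.integrable hp1.le)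
        (hg.integrable hp1.le))
      rw [(hcanon (hv.congr_left hae.symm) hvp).2]
      exact hvle
  · obtain ⟨C, hC0, hC⟩ := exists_weakDeriv_act hP hQ hLm hQt hμ hac hvol hp1 hp.ne k
    refine ⟨C, hC0, fun t ht ht1 n hn f hf => ?_⟩
    obtain ⟨v, hv, hvp, hvle⟩ := hC t ht ht1 n hn f hf
    rw [(hcanon hv hvp).2]
    exact hvle
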